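/- **Proposition 6.1.** *Notation.* Write $\mathbf T=\mathbf R/\mathbf Z$, let $\|t\|$ be the distance from $t$ to the nearest integer, and $e(t)=e^{2\pi i t}$. For integers $d,N\ge 1$, $\theta=(\theta_1,\dots,\theta_d)\in\mathbf T^d$ and a real $\varepsilon>0$, the Bohr set of dimension $d$ with these parameters is $$\Lambda_{\theta,\varepsilon,N}=\{n\in\mathbf Z:\ |n|\le N,\ \|n\theta_j\|<\varepsilon\ (1\le j\le d)\}.$$ It is *regular* if for every $\kappa\in(0,1)$, every real $\varepsilon'$ and every integer $N'\ge 0$ with $|\varepsilon-\varepsilon'|<\frac{\kappa}{100d}\varepsilon$ and $|N-N'|<\frac{\kappa}{100d}N$ one has $1-\kappa<|\Lambda_{\theta,\varepsilon',N'}|/|\Lambda_{\theta,\varepsilon,N}|<1+\kappa$. A regular Bohr set $\Lambda_{\theta',\varepsilon',N'}$ is an $\eta$ *attendant* of $\Lambda_{\theta,\varepsilon,N}$, $\theta\in\mathbf T^d$, if $\theta'=(\theta_1,\dots,\theta_d,\theta_{d+1},\dots,\theta_{d+k})$ for some $k\ge0$, $\eta\varepsilon/2\le\varepsilon'\le\eta\varepsilon$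 and $\eta N/2\le N'\le\eta N$. For finite sets $A,P$ put $\delta_P(A)=|A\cap P|/|P|$. For finite $Q,M\subset\mathbf Z$ and real $\rho$ put $\Phi(Q,M,\rho)=\sup_{x\in\mathbf R}\bigl|\sum_{s\in M}(1_Q(s)-\rho)e(-sx)\bigr|$. Let $\Lambda$ be a Bohr set, let $M_1,M_2$ be translates of $\Lambda$, and let $Q_i\subseteq M_i$, $\rho_i=|Q_i|/|M_i|$ ($i=1,2$). The sets $Q_1,Q_2$ are called $(\alpha,\eta)$-*uniform* in $M_1,M_2$ if there is an $\eta$ attendant $\Lambda'$ of $\Lambda$ (the same for both sets) such that for $i=1,2$ $$\bigl|\{m\in M_i:\ \Phi(Q_i,\Lambda'+m,\rho_i)\ge\alpha|\Lambda'|\}\bigr|\le\alpha|M_i|,$$ $$\frac1{|M_i|}\sum_{m\in M_i}\bigl|\delta_{\Lambda'+m}(Q_i)-\rho_i\bigr|^2\le\alpha^2,\qquad \Phi(Q_i,M_i,\rho_i)\le\alpha|M_i|.$$ *Statement.* Let $\Lambda=\Lambda_{\theta,\varepsilon_0,N}$ be a regular Bohr set with $\theta\in\mathbf T^d$ and $0<\varepsilon_0\le1$,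 let $s_1,s_2\in\mathbf Z$, and let $E_i\subseteq\Lambda+s_i$ with $|E_i|=\beta_i|\Lambda|$ ($i=1,2$); put $\beta=\beta_1\beta_2$. Let $A\subseteq E_1\times E_2$ be non-empty, put $\delta=\delta_{E_1\times E_2}(A)$, and suppose that $A$ contains no triple $(k,m),(k+r,m),(k,m+r)$ with $r\ne0$. Put $$\alpha_0=2^{-2000}\delta^{96}\beta_1^{48}\beta_2^{48},\qquad \varepsilon=\frac{2^{-100}\alpha_0^2}{100d},\qquad D'=2^{250000}\delta^{-20000}\beta^{-200}+d .$$ Suppose that $E_1,E_2$ are $(\alpha_0,2^{-10}\varepsilon^2)$-uniform in $\Lambda+s_1,\Lambda+s_2$, and that $$\log N\ \ge\ 2^{1000000}\bigl(2^{250000}\delta^{-20000}\beta^{-200}+d\bigr)^3\log\frac1{\delta\beta\varepsilon_0}.\tag{169}$$ Then there are a regular Bohr set $\tilde\Lambda=\Lambda_{\tilde\theta,\tilde\varepsilon,\tilde N}$ with $\tilde\theta\in\mathbf T^D$, $0<\tilde\varepsilon\le1$, a vector $\vec y=(y_1,y_2)\in\mathbf Z^2$, and sets $E_1'\subseteq(E_1-y_1)\cap\tilde\Lambda$,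 $E_2'\subseteq(E_2-y_2)\cap\tilde\Lambda$ such that, with $|E_i'|=\beta_i'|\tilde\Lambda|$, $\beta'=\beta_1'\beta_2'$, $\alpha_0'=2^{-2000}\delta^{96}\beta'^{48}$ and $\varepsilon'=\dfrac{2^{-100}\alpha_0'^2}{100D'}$: 1. $\beta'\ge2^{-1500}\delta^{100}\beta$; 2. $E_1',E_2'$ are $(\alpha_0',2^{-10}\varepsilon'^2)$-uniform in $\tilde\Lambda,\tilde\Lambda$; 3. $D\le D'$, $\tilde\varepsilon\ge(2^{-100}\varepsilon'^2)^D\varepsilon_0$ and $\tilde N\ge(2^{-100}\varepsilon'^2)^DN$; 4. $\delta_{E_1'\times E_2'}(A-\vec y)\ge\delta+2^{-600}\delta^{37}$. -/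

import Mathlib

open scoped Finset

noncomputable section

/-- The translate `S + t` of a finite set of integers. -/
def shift (t : ℤ) (S : Finset ℤ) : Finset ℤ := S.image (fun n => n + t)

/-- The relative density `δ_P(A) = |A ∩ P| / |P|`. -/
def relDensity {ι : Type*} [DecidableEq ι] (P A : Finset ι) : ℝ :=
  (#(A ∩ P) : ℝ) / (#P : ℝ)

/-- The set `Λ_{θ,ε,N}` of all integers `n` with `|n| ≤ N` and `‖n θ_j‖ < ε` for every `j`.
The norm of `UnitAddCircle = ℝ/ℤ` is the distance to the nearest integer. -/
def bohrSet {d : ℕ} (θ : Fin d → UnitAddCircle) (ε : ℝ) (N : ℕ) : Finset ℤ :=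
  open Classical in
  {n ∈ Finset.Icc (-(N : ℤ)) (N : ℤ) | ∀ j, ‖n • θ j‖ < ε}

/-- A Bohr set, given by its parameters: the dimension `d ≥ 1`, the generative vector
`θ ∈ 𝕋^d`, the radius `ε > 0` and the length `N ≥ 1`. -/
structure BohrDatum where
  dim : ℕ
  dim_pos : 0 < dim
  freq : Fin dim → UnitAddCircle
  radius : ℝ
  radius_pos : 0 < radius
  length : ℕ
  length_pos : 0 < length

namespace BohrDatum

/-- The underlying finite set of integers. -/
def carrier (Λ : BohrDatum) : Finset ℤ := bohrSet Λ.freq Λ.radius Λ.length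

/-- Regularity: for all `κ ∈ (0,1)`, changing the radius and the length by a relative amount less
than `κ / (100 d)` changes the cardinality by a factor strictly between `1 - κ` and `1 + κ`. -/
def IsRegular (Λ : BohrDatum) : Prop :=
  ∀ κ : ℝ, 0 < κ → κ < 1 → ∀ (ε' : ℝ) (N' : ℕ),
    |Λ.radius - ε'| < κ / (100 * (Λ.dim : ℝ)) * Λ.radius →
    |(Λ.length : ℝ) - (N' : ℝ)| < κ / (100 * (Λ.dim : ℝ)) * (Λ.length : ℝ) →
      1 - κ < (#(bohrSet Λ.freq ε' N') : ℝ) / (#Λ.carrier : ℝ) ∧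
        (#(bohrSet Λ.freq ε' N') : ℝ) / (#Λ.carrier : ℝ) < 1 + κ

/-- `Λ'` is an `η` attendant of `Λ`: it is regular, its generative vector extends that of `Λ` by
`k ≥ 0` further entries, and its radius and length lie between `η / 2` times and `η` times those
of `Λ`. -/
def IsAttendant (Λ' : BohrDatum) (η : ℝ) (Λ : BohrDatum) : Prop :=
  Λ'.IsRegular ∧
  (∃ h : Λ.dim ≤ Λ'.dim, ∀ j : Fin Λ.dim, Λ'.freq (Fin.castLE h j) = Λ.freq j) ∧
  η * Λ.radius / 2 ≤ Λ'.radius ∧ Λ'.radius ≤ η * Λ.radius ∧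
  η * (Λ.length : ℝ) / 2 ≤ (Λ'.length : ℝ) ∧ (Λ'.length : ℝ) ≤ η * (Λ.length : ℝ)

end BohrDatum

/-- The Fourier transform at `x` of the function `Q ∩ M - δ M` (sets being identified with their
indicator functions), that is `∑_{s ∈ M} (Q(s) - δ) e(-s x)` with `e(t) = exp (2 π i t)`. -/
def balancedFourier (Q M : Finset ℤ) (δ x : ℝ) : ℂ :=
  ∑ s ∈ M, (((if s ∈ Q then (1 : ℝ) else 0) - δ : ℝ) : ℂ) *
    Complex.exp (-(2 * (Real.pi : ℂ) * Complex.I * (s : ℂ) * (x : ℂ)))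

/-- The supremum over `x` of the absolute value of the Fourier transform of `Q ∩ M - δ M`. -/
def balancedFourierSup (Q M : Finset ℤ) (δ : ℝ) : ℝ :=
  ⨆ x : ℝ, ‖balancedFourier Q M δ x‖

/-- The three conditions of `(α, ε)`-uniformity of a set `Q ⊆ M`, where `M` is a Bohr set or
a translate of one, with respect to a chosen `ε` attendant with underlying set `M'`.
Here `δ = |Q ∩ M| / |M|`. -/
def UniformWith (M M' Q : Finset ℤ) (α : ℝ) : Prop :=
  open Classical in
  ((#{m ∈ M | α * (#M' : ℝ) ≤ balancedFourierSup Q (shift m M') (relDensity M Q)} : ℝ)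
      ≤ α * (#M : ℝ)) ∧
  (1 / (#M : ℝ) * ∑ m ∈ M, |relDensity (shift m M') Q - relDensity M Q| ^ 2 ≤ α ^ 2) ∧
  balancedFourierSup Q M (relDensity M Q) ≤ α * (#M : ℝ)

/-- `E₁ ⊆ Λ + s₁` and `E₂ ⊆ Λ + s₂` are `(α, η)`-uniform: for some `η` attendant `Λ'` of `Λ`, the
same for both sets, they satisfy the uniformity conditions with respect to `Λ'`. -/
def PairUniform (Λ : BohrDatum) (s₁ s₂ : ℤ) (E₁ E₂ : Finset ℤ) (α η : ℝ) : Prop :=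
  ∃ Λ' : BohrDatum, Λ'.IsAttendant η Λ ∧
    UniformWith (shift s₁ Λ.carrier) Λ'.carrier E₁ α ∧
    UniformWith (shift s₂ Λ.carrier) Λ'.carrier E₂ α

/-- `A` contains no triple `(k, m), (k + d, m), (k, m + d)` with `d ≠ 0`. -/
def CornerFree (A : Finset (ℤ × ℤ)) : Prop :=
  ∀ k m d : ℤ, d ≠ 0 → ¬ ((k, m) ∈ A ∧ (k + d, m) ∈ A ∧ (k, m + d) ∈ A)

/-- The translate `A - (y₁, y₂)` of a finite planar set. -/
def planarShift (y₁ y₂ : ℤ) (A : Finset (ℤ × ℤ)) : Finset (ℤ × ℤ) :=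
  A.image (fun p => (p.1 - y₁, p.2 - y₂))

end

/-!
Write `A(x, y)` for the indicator function of `A`. The proof has two stages: a density increment on a
rectangle in a translate of the square of a small Bohr set, and a refinement that makes the sides of
the rectangle uniform again at no loss of density.

**The increment.** Let `K` be a regular Bohr set with the frequencies of `Λ` and radius and length
smaller by a factor about `ε`. Regularity makes `Λ` nearly invariant under `K`, and `K` nearly
invariant under the attendant `S` that witnesses uniformity. So `E₁ × E₂` may be studied in cells
`(i, j) + K × K`, in most of which the sides are locally uniform at the scale of `S`
(`LocallyUniform.card_bad_cells_le`). By Parseval's identity, local uniformity makes the correlations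
of the sides along `S` small (`LocallyUniform.sum_abs_correlation_le`), which is the pseudorandomness
used. In a cell, one counts triples `(a, b), (r - b, b), (a, r - a)` with `r ∈ S`, which are corners,
of side `r - a - b`. The last two points lie on the antidiagonal `x + y = r`, so Cauchy–Schwarz bounds
the number of such pairs from below by the number of points on these antidiagonals
(`stripSum_sq_le`). As `A` has no nontrivial corner, the balanced function `A - δ` at the vertex
`(a, b)` must cancel this main term (`cornerSum_le_of_cornerFree`). Two more applications of
Cauchy–Schwarz bound the cancelling sum by the box norm of `A - δ`, with a weight that pseudorandomness
makes nearly constant (`cornerSum_pow_four_le`, `Pseudorandom.sum_abs_weight_sub_le`). A large box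
norm gives a subrectangle on which `A` is denser (`exists_subrectangle_of_boxSum`). The outcome is
`exists_increment_bohr`: sets `U, V ⊆ K` with `∑ (A - (δ + σ)) ≥ 2⁻⁴⁰ δ²⁵ β |K|²` over `U × V`, where
`σ = 2⁻⁶⁰⁰ δ³⁷` is the increment required.

**Uniform sides.** For sets `F₁, F₂ ⊆ L`, where `L` is a Bohr set, of densities `γ₁, γ₂`, consider the
`potential`
`|L|⁻² ∑ (A - (δ + σ)) + lam (γ₁² + γ₂²)`, the sum being over `F₁ × F₂`.
If the sides are not uniform in `L`, then many local Fourier transforms of one of them are large.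
Passing to a Bohr set with the offending frequency adjoined, on which the character is nearly
constant, makes the local densities deviate from `γᵢ` in mean square. On average over the translates
of this set the first term is preserved and the squares of the densities increase, so some translate
has larger potential, by `2⁻⁹ lam α⁴` where `α` is the parameter of uniformity
(`exists_potential_increment`). The potential is at most `1 + 2 lam`, hence after boundedly many steps
the sides are uniform (`exists_uniform_of_potential`). With `lam = 2⁻⁴² δ²⁵ β` the energy term is at
most half of the gain of the first stage, so an excess `x₀ = 2⁻⁴¹ δ²⁵ β` survives throughout. It shows
both that the density remains above `δ + σ` and that `γ₁ γ₂ ≥ x₀`, which bounds all parameters of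
uniformity from below.

**Sizes.** Each step adds one frequency and shrinks radius and length by a bounded factor. Zero
frequencies, which do not affect the set, are adjoined beforehand (`BohrDatum.pad`) so that the total
loss is covered by the power of the final dimension. The lower bound for `log N` keeps all lengths
large, since the logarithm on its right-hand side is at least `1 / 8` (`one_div_eight_le_log`). The
regular Bohr sets come from a covering argument with a maximal inequality (`exists_regular`).
-/

noncomputable section

/-! ### Bohr sets: elementary properties -/

theorem mem_bohrSet {d : ℕ} {θ : Fin d → UnitAddCircle} {ε : ℝ} {N : ℕ} {n : ℤ} :
    n ∈ bohrSet θ ε N ↔ |n| ≤ (N : ℤ) ∧ ∀ j, ‖n • θ j‖ < ε := by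
  simp [bohrSet, abs_le]

theorem neg_mem_bohrSet {d : ℕ} {θ : Fin d → UnitAddCircle} {ε : ℝ} {N : ℕ} {n : ℤ}
    (h : n ∈ bohrSet θ ε N) : -n ∈ bohrSet θ ε N := by
  rw [mem_bohrSet] at *
  simpa [abs_neg, neg_smul] using h

theorem zero_mem_bohrSet {d : ℕ} {θ : Fin d → UnitAddCircle} {ε : ℝ} {N : ℕ} (hε : 0 < ε) :
    (0 : ℤ) ∈ bohrSet θ ε N := by
  rw [mem_bohrSet]; simp [hε]

theorem bohrSet_mono {d : ℕ} {θ : Fin d → UnitAddCircle} {ε ε' : ℝ} {N N' : ℕ}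
    (hε : ε ≤ ε') (hN : N ≤ N') : bohrSet θ ε N ⊆ bohrSet θ ε' N' := by
  intro n hn
  rw [mem_bohrSet] at *
  exact ⟨hn.1.trans (by exact_mod_cast hN), fun j => (hn.2 j).trans_le hε⟩

theorem add_mem_bohrSet {d : ℕ} {θ : Fin d → UnitAddCircle} {ε ε' : ℝ} {N N' : ℕ} {m n : ℤ}
    (hm : m ∈ bohrSet θ ε N) (hn : n ∈ bohrSet θ ε' N') :
    m + n ∈ bohrSet θ (ε + ε') (N + N') := by
  rw [mem_bohrSet] at *
  refine ⟨(abs_add_le m n).trans (by push_cast; linarith [hm.1, hn.1]), fun j => ?_⟩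
  rw [add_smul]
  exact (norm_add_le _ _).trans_lt (add_lt_add (hm.2 j) (hn.2 j))

theorem BohrDatum.zero_mem (L : BohrDatum) : (0 : ℤ) ∈ L.carrier :=
  zero_mem_bohrSet L.radius_pos

theorem BohrDatum.neg_mem (L : BohrDatum) {n : ℤ} (h : n ∈ L.carrier) : -n ∈ L.carrier :=
  neg_mem_bohrSet h

theorem BohrDatum.card_pos (L : BohrDatum) : 0 < #L.carrier :=
  Finset.card_pos.2 ⟨0, L.zero_mem⟩

theorem BohrDatum.one_le_dim (L : BohrDatum) : (1 : ℝ) ≤ L.dim := by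
  exact_mod_cast L.dim_pos

/-- Translation by an element of `S` moves at most the proportion `κ` of `L` outside `L`. -/
def NearlyInvariant (L S : Finset ℤ) (κ : ℝ) : Prop :=
  ∀ s ∈ S, (#{m ∈ L | m + s ∉ L} : ℝ) ≤ κ * #L

theorem NearlyInvariant.translate {L S : Finset ℤ} {κ : ℝ} (h : NearlyInvariant L S κ)
    (t : ℤ) : NearlyInvariant (shift t L) S κ := by
  intro s hs
  have hinj : Function.Injective (fun n : ℤ => n + t) := add_left_injective t
  have hc : #(shift t L) = #L := Finset.card_image_of_injective _ hinj
  have : #{m ∈ shift t L | m + s ∉ shift t L} = #{m ∈ L | m + s ∉ L} := by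
    rw [← Finset.card_image_of_injective {m ∈ L | m + s ∉ L} hinj]
    congr 1
    ext m
    simp only [shift, Finset.mem_filter, Finset.mem_image]
    constructor
    · rintro ⟨⟨n, hn, rfl⟩, h2⟩
      exact ⟨n, ⟨hn, fun h3 => h2 ⟨n + s, h3, by ring⟩⟩, rfl⟩
    · rintro ⟨n, ⟨hn, h2⟩, rfl⟩
      refine ⟨⟨n, hn, rfl⟩, ?_⟩
      rintro ⟨k, hk, hk2⟩
      exact h2 (by convert hk using 1; linarith)
  rw [this, hc]
  exact h s hs

/-- A regular Bohr set grows by a factor less than `1 + κ` when its radius and length grow by a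
factor `1 + η` with `100 d η < κ`. -/
theorem BohrDatum.IsRegular.card_enlarge_lt {L : BohrDatum} (hL : L.IsRegular) {κ η : ℝ}
    (hκ : 0 < κ) (hκ1 : κ < 1) (hη : 0 ≤ η) (hηκ : 100 * L.dim * η < κ) {M : ℕ}
    (hM : (M : ℝ) ≤ η * L.length) :
    (#(bohrSet L.freq (L.radius + η * L.radius) (L.length + M)) : ℝ) < (1 + κ) * #L.carrier := by
  have hd := L.one_le_dim
  have hlt : η < κ / (100 * (L.dim : ℝ)) := by
    rw [lt_div_iff₀ (by positivity)]; linarith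
  have h1 : |L.radius - (L.radius + η * L.radius)| < κ / (100 * (L.dim : ℝ)) * L.radius := by
    rw [sub_add_cancel_left, abs_neg, abs_of_nonneg (mul_nonneg hη L.radius_pos.le)]
    exact mul_lt_mul_of_pos_right hlt L.radius_pos
  have hlen : (0 : ℝ) < L.length := by exact_mod_cast L.length_pos
  have h2 : |(L.length : ℝ) - ((L.length + M : ℕ) : ℝ)| <
      κ / (100 * (L.dim : ℝ)) * (L.length : ℝ) := by
    rw [Nat.cast_add, sub_add_cancel_left, abs_neg, abs_of_nonneg (Nat.cast_nonneg _)]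
    exact hM.trans_lt (mul_lt_mul_of_pos_right hlt hlen)
  have h := (hL κ hκ hκ1 _ _ h1 h2).2
  have hc : (0 : ℝ) < #L.carrier := by exact_mod_cast L.card_pos
  rwa [div_lt_iff₀ hc] at h

/-- A regular Bohr set is nearly invariant under the elements of a much smaller Bohr set with the same
frequencies, because its translates stay in an enlargement of almost the same size. -/
theorem BohrDatum.IsRegular.nearlyInvariant {L : BohrDatum} (hL : L.IsRegular) {κ η : ℝ}
    (hκ : 0 < κ) (hκ1 : κ < 1) (hη : 0 ≤ η) (hηκ : 100 * L.dim * η < κ) {M : ℕ}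
    (hM : (M : ℝ) ≤ η * L.length) {S : Finset ℤ}
    (hS : S ⊆ bohrSet L.freq (η * L.radius) M) : NearlyInvariant L.carrier S κ := by
  intro s hs
  have hcard := hL.card_enlarge_lt hκ hκ1 hη hηκ hM
  set L' := bohrSet L.freq (L.radius + η * L.radius) (L.length + M)
  have hsub : L.carrier ⊆ L' :=
    bohrSet_mono (le_add_of_nonneg_right (mul_nonneg hη L.radius_pos.le)) (Nat.le_add_right _ _)
  have himg : ({m ∈ L.carrier | m + s ∉ L.carrier}).image (· + s) ⊆ L' \ L.carrier := by
    intro n hn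
    simp only [Finset.mem_image, Finset.mem_filter] at hn
    obtain ⟨m, ⟨hm, hms⟩, rfl⟩ := hn
    exact Finset.mem_sdiff.2 ⟨add_mem_bohrSet hm (hS hs), hms⟩
  have h1 := Finset.card_le_card himg
  rw [Finset.card_image_of_injective _ (add_left_injective s),
    Finset.card_sdiff_of_subset hsub] at h1
  have h2 := Finset.card_le_card hsub
  have h3 : (#{m ∈ L.carrier | m + s ∉ L.carrier} : ℝ) ≤ (#L' : ℝ) - #L.carrier := by
    rw [← Nat.cast_sub h2]; exact_mod_cast h1
  linarith

/-- Averages over a nearly invariant set change little under translation. -/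
theorem NearlyInvariant.norm_sum_translate_sub_le {E : Type*} [NormedAddCommGroup E]
    {L S : Finset ℤ} {κ : ℝ} (h : NearlyInvariant L S κ) {s : ℤ} (hs : s ∈ S) (g : ℤ → E)
    {C : ℝ} (hg : ∀ n, ‖g n‖ ≤ C) :
    ‖∑ m ∈ L, g (m + s) - ∑ m ∈ L, g m‖ ≤ 2 * C * κ * #L := by
  classical
  have hC : 0 ≤ C := (norm_nonneg _).trans (hg 0)
  have hinj : Function.Injective (fun n : ℤ => n + s) := add_left_injective s
  have e1 : ∑ m ∈ L, g (m + s) = ∑ n ∈ shift s L, g n := by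
    rw [shift, Finset.sum_image (fun a _ b _ hab => hinj hab)]
  have hcs : #(shift s L) = #L := Finset.card_image_of_injective _ hinj
  have e2 : ∑ n ∈ shift s L, g n - ∑ m ∈ L, g m
      = ∑ n ∈ shift s L \ L, g n - ∑ n ∈ L \ shift s L, g n := by
    rw [← Finset.sum_inter_add_sum_sdiff (shift s L) L, ← Finset.sum_inter_add_sum_sdiff L (shift s L),
      Finset.inter_comm]
    abel
  have hc1 : #(shift s L \ L) = #{m ∈ L | m + s ∉ L} := by
    rw [← Finset.card_image_of_injective {m ∈ L | m + s ∉ L} hinj]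
    congr 1
    ext n
    simp only [shift, Finset.mem_sdiff, Finset.mem_image, Finset.mem_filter]
    constructor
    · rintro ⟨⟨m, hm, rfl⟩, h2⟩; exact ⟨m, ⟨hm, h2⟩, rfl⟩
    · rintro ⟨m, ⟨hm, h2⟩, rfl⟩; exact ⟨⟨m, hm, rfl⟩, h2⟩
  have hc2 : #(L \ shift s L) = #(shift s L \ L) := by
    exact (Finset.card_sdiff_comm hcs).symm
  have b : ∀ T : Finset ℤ, ‖∑ n ∈ T, g n‖ ≤ C * #T := fun T => by
    refine (norm_sum_le_of_le T (fun n _ => hg n)).trans ?_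
    simp [mul_comm]
  have hk := h s hs
  rw [e1, e2]
  refine (norm_sub_le _ _).trans ((add_le_add (b _) (b _)).trans ?_)
  rw [hc2, hc1]
  have := mul_le_mul_of_nonneg_left hk hC
  linarith

/-! ### Covering estimates -/

theorem exists_real_repr (x : UnitAddCircle) : ∃ y : ℝ, (y : UnitAddCircle) = x ∧ |y| = ‖x‖ := by
  obtain ⟨z, rfl⟩ := QuotientAddGroup.mk_surjective x
  refine ⟨z - round z, ?_, ?_⟩
  · have : ((z - round z : ℝ) : UnitAddCircle) = (z : UnitAddCircle) := by
      rw [AddCircle.coe_sub]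
      have : (((round z : ℤ) : ℝ) : UnitAddCircle) = 0 := by
        rw [AddCircle.coe_eq_zero_iff]; exact ⟨round z, by simp⟩
      rw [this, sub_zero]
    exact this
  · exact (UnitAddCircle.norm_eq (x := z)).symm

/-- Pigeonhole: split each interval `(-ε, ε)` into `p` arcs and the range of `n` into `q` intervals. Two
elements of one class differ by an element of the smaller Bohr set. -/
theorem card_bohrSet_le_mul {d : ℕ} (θ : Fin d → UnitAddCircle) {ε : ℝ} (hε : 0 < ε) {N N' p q : ℕ}
    (hp : 0 < p) (hq : 2 * N + 1 ≤ q * (N' + 1)) :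
    #(bohrSet θ ε N) ≤ p ^ d * q * #(bohrSet θ (2 * ε / p) N') := by
  classical
  choose y hy hy' using fun (n : ℤ) (j : Fin d) => exists_real_repr (n • θ j)
  let f : ℤ → (Fin d → ℕ) × ℕ := fun n =>
    (fun j => ⌊(p : ℝ) * (y n j + ε) / (2 * ε)⌋₊, (n + N).toNat / (N' + 1))
  have hpR : (0 : ℝ) < p := by exact_mod_cast hp
  have hsmall : ∀ n ∈ bohrSet θ ε N, ∀ j, 0 ≤ (p : ℝ) * (y n j + ε) / (2 * ε) := by
    intro n hn j
    have h1 := (mem_bohrSet.1 hn).2 j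
    rw [← hy', abs_lt] at h1
    apply div_nonneg _ (by linarith)
    apply mul_nonneg hpR.le; linarith [h1.1]
  have himage : (bohrSet θ ε N).image f ⊆
      (Fintype.piFinset fun _ : Fin d => Finset.range p) ×ˢ Finset.range q := by
    intro c hc
    obtain ⟨n, hn, rfl⟩ := Finset.mem_image.1 hc
    have hn' := mem_bohrSet.1 hn
    simp only [f, Finset.mem_product, Fintype.mem_piFinset, Finset.mem_range]
    constructor
    · intro j
      rw [Nat.floor_lt (hsmall n hn j), div_lt_iff₀ (by linarith)]
      have h1 := hn'.2 j
      rw [← hy', abs_lt] at h1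
      nlinarith [h1.2]
    · rw [Nat.div_lt_iff_lt_mul (Nat.succ_pos _)]
      have := abs_le.1 hn'.1
      have h0 : (0 : ℤ) ≤ n + N := by omega
      zify
      rw [Int.toNat_of_nonneg h0]
      zify at hq
      linarith [this.2]
  have hfib : ∀ c ∈ (bohrSet θ ε N).image f,
      #{n ∈ bohrSet θ ε N | f n = c} ≤ #(bohrSet θ (2 * ε / p) N') := by
    intro c hc
    obtain ⟨n₀, hn₀, rfl⟩ := Finset.mem_image.1 hc
    refine Finset.card_le_card_of_injOn (fun n => n - n₀) ?_ (fun a _ b _ h => by simpa using h)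
    intro n hn
    simp only [Finset.coe_filter, Set.mem_ofPred_eq] at hn
    obtain ⟨hn, hfn⟩ := hn
    have h1 := congrArg Prod.fst hfn
    have h2 := congrArg Prod.snd hfn
    simp only [f] at h1 h2
    rw [Finset.mem_coe, mem_bohrSet]
    constructor
    · have e1 := Nat.div_add_mod (n + N).toNat (N' + 1)
      have e2 := Nat.div_add_mod (n₀ + N).toNat (N' + 1)
      have l1 := Nat.mod_lt (n + N).toNat (Nat.succ_pos N')
      have l2 := Nat.mod_lt (n₀ + N).toNat (Nat.succ_pos N')
      rw [h2] at e1
      have a1 := abs_le.1 (mem_bohrSet.1 hn).1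
      have a2 := abs_le.1 (mem_bohrSet.1 hn₀).1
      rw [abs_le]
      beta_reduce
      simp only [Nat.succ_eq_add_one] at l1 l2
      generalize (N' + 1) * ((n₀ + N).toNat / (N' + 1)) = w at *
      constructor <;> omega
    · intro j
      have h3 := congrFun h1 j
      have hlt : |(p : ℝ) * (y n j + ε) / (2 * ε) - (p : ℝ) * (y n₀ j + ε) / (2 * ε)| < 1 := by
        have b1 := Nat.floor_le (hsmall n hn j)
        have b2 := Nat.lt_floor_add_one ((p : ℝ) * (y n j + ε) / (2 * ε))
        have b3 := Nat.floor_le (hsmall n₀ hn₀ j)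
        have b4 := Nat.lt_floor_add_one ((p : ℝ) * (y n₀ j + ε) / (2 * ε))
        rw [h3] at b1 b2
        rw [abs_lt]; constructor <;> linarith
      have hlt' : |y n j - y n₀ j| < 2 * ε / p := by
        rw [lt_div_iff₀ hpR]
        have : (p : ℝ) * (y n j + ε) / (2 * ε) - (p : ℝ) * (y n₀ j + ε) / (2 * ε)
            = (y n j - y n₀ j) * (p / (2 * ε)) := by field_simp; ring
        rw [this, abs_mul, abs_of_pos (by positivity : (0 : ℝ) < p / (2 * ε)), ← mul_div_assoc,
          div_lt_iff₀ (by positivity)] at hlt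
        linarith
      have e : (n - n₀) • θ j = ((y n j - y n₀ j : ℝ) : UnitAddCircle) := by
        rw [sub_smul, AddCircle.coe_sub, hy, hy]
      rw [e]
      refine lt_of_le_of_lt ?_ hlt'
      rw [UnitAddCircle.norm_eq]
      simpa using round_le (y n j - y n₀ j) 0
  have := Finset.card_le_mul_card_image (bohrSet θ ε N) _ hfib
  refine this.trans ?_
  rw [mul_comm]
  refine Nat.mul_le_mul_right _ ((Finset.card_le_card himage).trans ?_)
  rw [Finset.card_product, Fintype.card_piFinset]
  simp

/-- The pigeonhole lower bound for the size of a Bohr set. -/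
theorem le_card_bohrSet {d : ℕ} (θ : Fin d → UnitAddCircle) {ρ : ℝ} (hρ : 0 < ρ) (hρ1 : ρ ≤ 1)
    (N : ℕ) : (N : ℝ) * (ρ / 3) ^ d ≤ #(bohrSet θ ρ N) := by
  set p := ⌈2 / ρ⌉₊
  have hp : 0 < p := Nat.ceil_pos.2 (by positivity)
  have hpR : (0 : ℝ) < p := by exact_mod_cast hp
  have h1 := card_bohrSet_le_mul θ (one_pos) (N := N) (N' := N) (q := 2) hp (by omega)
  have hfull : bohrSet θ 1 N = Finset.Icc (-(N : ℤ)) N := by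
    ext n
    rw [mem_bohrSet, Finset.mem_Icc, abs_le]
    refine ⟨fun h => h.1, fun h => ⟨h, fun j => ?_⟩⟩
    have := AddCircle.norm_le_half_period (p := (1 : ℝ)) (x := n • θ j) one_ne_zero
    rw [abs_one] at this; linarith
  have hcard : #(Finset.Icc (-(N : ℤ)) N) = 2 * N + 1 := by
    rw [Int.card_Icc]; omega
  rw [hfull, hcard] at h1
  have h2 : 2 * 1 / (p : ℝ) ≤ ρ := by
    rw [div_le_iff₀ hpR]
    have := Nat.le_ceil (2 / ρ)
    rw [div_le_iff₀ hρ] at this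
    linarith
  have h3 := Finset.card_le_card (bohrSet_mono (θ := θ) h2 (le_refl N))
  have h4 : (2 * N + 1 : ℝ) ≤ (p : ℝ) ^ d * 2 * #(bohrSet θ ρ N) := by
    have : 2 * N + 1 ≤ p ^ d * 2 * #(bohrSet θ ρ N) := h1.trans (Nat.mul_le_mul_left _ h3)
    exact_mod_cast this
  have h5 : (p : ℝ) * (ρ / 3) ≤ 1 := by
    have := (Nat.ceil_lt_add_one (by positivity : 0 ≤ 2 / ρ)).le
    have h6 : (p : ℝ) * ρ ≤ (2 / ρ + 1) * ρ := mul_le_mul_of_nonneg_right this hρ.le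
    rw [add_mul, div_mul_cancel₀ _ hρ.ne'] at h6
    linarith
  have h6 : ((p : ℝ) * (ρ / 3)) ^ d ≤ 1 := pow_le_one₀ (by positivity) h5
  rw [mul_pow] at h6
  have h7 : (N : ℝ) ≤ (p : ℝ) ^ d * #(bohrSet θ ρ N) := by linarith
  calc (N : ℝ) * (ρ / 3) ^ d ≤ ((p : ℝ) ^ d * #(bohrSet θ ρ N)) * (ρ / 3) ^ d := by gcongr
    _ = ((p : ℝ) ^ d * (ρ / 3) ^ d) * #(bohrSet θ ρ N) := by ring
    _ ≤ 1 * #(bohrSet θ ρ N) := by gcongr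
    _ = _ := one_mul _

/-! ### Existence of regular Bohr sets -/

/-- The increments of a monotone function over disjoint intervals add up to at most its total
increment. -/
theorem Monotone.sum_increments_le {ι : Type*} {g : ℝ → ℝ} (hg : Monotone g) (p q : ι → ℝ)
    (v : Finset ι) {a : ℝ} : ∀ {b : ℝ}, a ≤ b → (∀ i ∈ v, a ≤ p i ∧ p i ≤ q i ∧ q i ≤ b) →
    (v : Set ι).PairwiseDisjoint (fun i => Set.Icc (p i) (q i)) →
    ∑ i ∈ v, (g (q i) - g (p i)) ≤ g b - g a := by
  classical
  induction v using Finset.induction_on_max_value q with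
  | empty => intro b hab _ _; simpa using hg hab
  | insert i s his hmax ih =>
    intro b hab hv hd
    rw [Finset.sum_insert his]
    have hi := hv i (Finset.mem_insert_self _ _)
    have h1 : ∑ j ∈ s, (g (q j) - g (p j)) ≤ g (p i) - g a := by
      refine ih hi.1 (fun j hj => ?_) (hd.subset (by simp))
      have hj' := hv j (Finset.mem_insert_of_mem hj)
      refine ⟨hj'.1, hj'.2.1, ?_⟩
      by_contra hlt
      push Not at hlt
      have hne : i ≠ j := fun h => his (h ▸ hj)
      have := hd (by simp) (by simp [hj]) hne
      exact Set.disjoint_left.1 this ⟨hlt.le, hmax j hj⟩ ⟨hj'.2.1, le_rfl⟩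
    have h2 := hg hi.2.2
    linarith

/-- A monotone function of small total increment has a point of `[3/5, 1]` that lies in no
short interval of large average slope; this is the maximal inequality behind regularity. -/
theorem Monotone.exists_no_steep_interval {g : ℝ → ℝ} (hg : Monotone g) {C : ℝ} (hC : 0 < C)
    (hvar : g (11 / 10) - g (11 / 20) < C / 10) :
    ∃ t ∈ Set.Icc (3 / 5 : ℝ) 1, ∀ p q : ℝ, p < q → p ≤ t → t ≤ q → q - p ≤ 1 / 50 →
      g q - g p < C * (q - p) := by
  by_contra hcon
  push Not at hcon
  choose! p q hpq hpt htq hlen hinc using hcon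
  -- by Vitali's covering lemma a disjoint subfamily of the steep intervals has total length at
  -- least a quarter of the length of the interval they cover
  set T : Set ℝ := Set.Icc (3 / 5 : ℝ) 1
  obtain ⟨u, huT, hdis, hcov⟩ := Vitali.exists_disjoint_subfamily_covering_enlargement_closedBall
    T (fun t => (p t + q t) / 2) (fun t => (q t - p t) / 2) (1 / 100)
    (fun t ht => by have := hlen t ht; linarith) 4 (by norm_num)
  have hball : ∀ t, Metric.closedBall ((p t + q t) / 2) ((q t - p t) / 2) = Set.Icc (p t) (q t) := by
    intro t; rw [Real.closedBall_eq_Icc]; congr 1 <;> ring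
  simp only [hball] at hdis hcov
  have hcount : u.Countable := by
    refine Set.PairwiseDisjoint.countable_of_nonempty_interior hdis (fun t ht => ?_)
    rw [interior_Icc]
    exact Set.nonempty_Ioo.2 (hpq t (huT ht))
  have hTsub : T ⊆ ⋃ t ∈ u, Metric.closedBall ((p t + q t) / 2) (4 * ((q t - p t) / 2)) := by
    intro t ht
    obtain ⟨b, hb, hsub⟩ := hcov t ht
    exact Set.mem_biUnion hb (hsub ⟨hpt t ht, htq t ht⟩)
  have hfin : ∀ v : Finset u, ∑ t ∈ v, (q t - p t) ≤ (g (11 / 10) - g (11 / 20)) / C := by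
    intro v
    rw [le_div_iff₀ hC, Finset.sum_mul]
    have h1 := hg.sum_increments_le (fun t : u => p t) (fun t : u => q t) v
      (a := 11 / 20) (b := 11 / 10) (by norm_num) (fun t _ => by
        have h := huT t.2
        have h1 := hpt t h
        have h2 := htq t h
        have h3 := hlen t h
        exact ⟨by linarith [h.1], (hpq t h).le, by linarith [h.2]⟩)
      (fun x _ y _ hxy => hdis x.2 y.2 (fun h => hxy (Subtype.ext h)))
    refine le_trans (Finset.sum_le_sum fun t _ => ?_) h1
    have := hinc t (huT t.2)
    linarith
  have hvol := (MeasureTheory.measure_mono (μ := MeasureTheory.volume) hTsub).trans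
    (MeasureTheory.measure_biUnion_le _ hcount _)
  rw [Real.volume_Icc] at hvol
  simp only [Real.volume_closedBall] at hvol
  rw [ENNReal.tsum_eq_iSup_sum] at hvol
  have hle : (⨆ s : Finset u, ∑ a ∈ s, ENNReal.ofReal (2 * (4 * ((q a - p a) / 2))))
      ≤ ENNReal.ofReal (4 * ((g (11 / 10) - g (11 / 20)) / C)) := by
    refine iSup_le fun v => ?_
    rw [← ENNReal.ofReal_sum_of_nonneg]
    · refine ENNReal.ofReal_le_ofReal ?_
      have := hfin v
      calc ∑ t ∈ v, 2 * (4 * ((q t - p t) / 2)) = 4 * ∑ t ∈ v, (q t - p t) := by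
            rw [Finset.mul_sum]; exact Finset.sum_congr rfl fun _ _ => by ring
        _ ≤ _ := by linarith
    · intro t _
      have := hpq t (huT t.2)
      linarith
  have h2 := hvol.trans hle
  rw [ENNReal.ofReal_le_ofReal_iff'] at h2
  have h3 : (g (11 / 10) - g (11 / 20)) / C < 1 / 10 := by rw [div_lt_iff₀ hC]; linarith
  rcases h2 with h2 | h2 <;> linarith

set_option maxHeartbeats 400000 in
/-- Regular Bohr sets with prescribed frequencies exist within a factor two of any prescribed
radius and length. Along the family with radius `t ρ` and length `t X` the logarithm of the size is
monotone in `t`, and by covering it increases by `O(D)` in total. At a parameter `t` that lies in no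
interval of average slope exceeding `50 D`, small changes of radius and length change the size
little, which is regularity. -/
theorem exists_regular {D : ℕ} (hD : 0 < D) (θ : Fin D → UnitAddCircle) {ρ X : ℝ} (hρ : 0 < ρ)
    (hX : 10 ≤ X) : ∃ (r : ℝ) (n : ℕ) (hr : 0 < r) (hn : 0 < n),
      (⟨D, hD, θ, r, hr, n, hn⟩ : BohrDatum).IsRegular ∧
      ρ / 2 ≤ r ∧ r ≤ ρ ∧ X / 2 ≤ n ∧ (n : ℝ) ≤ X := by
  set c : ℝ → ℕ := fun t => #(bohrSet θ (t * ρ) ⌊t * X⌋₊)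
  have hX0 : 0 < X := by linarith
  have hDR : (1 : ℝ) ≤ D := by exact_mod_cast hD
  have hcmono : Monotone c := fun s t hst => Finset.card_le_card
    (bohrSet_mono (by gcongr) (Nat.floor_mono (by gcongr)))
  have hcpos : ∀ t, 0 < t → 0 < c t := fun t ht =>
    Finset.card_pos.2 ⟨0, zero_mem_bohrSet (by positivity)⟩
  have hgmono : Monotone fun t => Real.log (c t) := by
    intro s t hst
    rcases Nat.eq_zero_or_pos (c s) with h | h
    · simp only [h]; simpa using Real.log_natCast_nonneg _
    · exact Real.log_le_log (by exact_mod_cast h) (by exact_mod_cast hcmono hst)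
  have hvar : Real.log (c (11 / 10)) - Real.log (c (11 / 20)) < (50 * D) / 10 := by
    have hq : 2 * ⌊11 / 10 * X⌋₊ + 1 ≤ 4 * (⌊11 / 20 * X⌋₊ + 1) := by
      have h1 := Nat.lt_floor_add_one (11 / 20 * X)
      have h2 := Nat.floor_le (by positivity : 0 ≤ 11 / 10 * X)
      have h3 : ((2 * ⌊11 / 10 * X⌋₊ : ℕ) : ℝ) < ((4 * (⌊11 / 20 * X⌋₊ + 1) : ℕ) : ℝ) := by
        push_cast; linarith
      have := Nat.cast_lt.1 h3
      omega
    have h := card_bohrSet_le_mul θ (by positivity : 0 < 11 / 10 * ρ) (p := 4) (by norm_num) hq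
    have e : 2 * (11 / 10 * ρ) / ((4 : ℕ) : ℝ) = 11 / 20 * ρ := by push_cast; ring
    rw [e] at h
    have h' : (c (11 / 10) : ℝ) ≤ 4 ^ (D + 1) * c (11 / 20) := by
      rw [pow_succ]; exact_mod_cast h
    have hp : (0 : ℝ) < c (11 / 20) := by exact_mod_cast hcpos _ (by norm_num)
    have hp' : (0 : ℝ) < c (11 / 10) := by exact_mod_cast hcpos _ (by norm_num)
    have h2 := Real.log_le_log hp' h'
    rw [Real.log_mul (by positivity) hp.ne', Real.log_pow] at h2
    have h4 : Real.log 4 < 2 := by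
      rw [show (4 : ℝ) = 2 ^ 2 by norm_num, Real.log_pow]
      have := Real.log_two_lt_d9
      push_cast; linarith
    have h5 : 0 < Real.log 4 := Real.log_pos (by norm_num)
    push_cast at h2
    nlinarith
  obtain ⟨t, ht, hsteep⟩ := hgmono.exists_no_steep_interval (by positivity) hvar
  have ht0 : 0 < t := by linarith [ht.1]
  have hfl := Nat.lt_floor_add_one (t * X)
  have hfl' := Nat.floor_le (by positivity : 0 ≤ t * X)
  have htX : 3 / 5 * X ≤ t * X := by gcongr; exact ht.1
  have htX' : t * X ≤ 1 * X := by gcongr; exact ht.2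
  have hnpos : 0 < ⌊t * X⌋₊ := Nat.floor_pos.2 (by linarith)
  have htρ : 3 / 5 * ρ ≤ t * ρ := by gcongr; exact ht.1
  have htρ' : t * ρ ≤ 1 * ρ := by gcongr; exact ht.2
  refine ⟨t * ρ, ⌊t * X⌋₊, by positivity, hnpos, ?_, by linarith, by linarith, by linarith,
    by linarith⟩
  intro κ hκ hκ1 ε' N' hε' hN'
  simp only [BohrDatum.carrier] at *
  set h := κ / (100 * (D : ℝ)) with hh
  have hh0 : 0 < h := by positivity
  have hκh : κ = 100 * D * h := by rw [hh]; field_simp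
  have hh1 : h < 1 / 100 := by
    rw [hh, div_lt_iff₀ (by positivity)]; nlinarith
  rw [abs_lt] at hε' hN'
  have hct : (0 : ℝ) < c t := by exact_mod_cast hcpos t ht0
  have hup : (#(bohrSet θ ε' N') : ℝ) ≤ c ((1 + h) * t) := by
    norm_cast
    refine Finset.card_le_card (bohrSet_mono (by linarith [hε'.1]) (Nat.le_floor ?_))
    have h1 := mul_le_mul_of_nonneg_left hfl' (by linarith : 0 ≤ 1 + h)
    linarith [hN'.1]
  have hlow : (c ((1 - 2 * h) * t) : ℝ) ≤ #(bohrSet θ ε' N') := by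
    norm_cast
    refine Finset.card_le_card (bohrSet_mono ?_ ?_)
    · have := mul_pos hh0 (mul_pos ht0 hρ)
      linarith [hε'.2]
    by_cases hle : ⌊t * X⌋₊ ≤ N'
    · refine le_trans (Nat.floor_mono ?_) hle
      have := mul_pos hh0 (mul_pos ht0 hX0)
      linarith
    · push Not at hle
      have h1 : (N' : ℝ) + 1 ≤ ⌊t * X⌋₊ := by exact_mod_cast hle
      -- a shorter integer length forces the admissible change of the length to exceed one
      have h2 : 1 < h * ⌊t * X⌋₊ := by linarith [hN'.2]
      have h3 : (1 - 2 * h) * t * X < N' := by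
        have : (1 - 2 * h) * (t * X) ≤ (1 - 2 * h) * (⌊t * X⌋₊ + 1) := by
          apply mul_le_mul_of_nonneg_left hfl.le; linarith
        linarith [hN'.2]
      exact (Nat.floor_le_of_le h3.le)
  have hc1 : (0 : ℝ) < c ((1 - 2 * h) * t) := by
    exact_mod_cast hcpos _ (mul_pos (by linarith) ht0)
  have hc2 : (0 : ℝ) < c ((1 + h) * t) := by exact_mod_cast hcpos _ (by positivity)
  have hth0 : 0 < t * h := mul_pos ht0 hh0
  have hth1 : t * h ≤ 1 * h := mul_le_mul_of_nonneg_right ht.2 hh0.le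
  have hd1 := hsteep ((1 - 2 * h) * t) t (by linarith) (by linarith) le_rfl (by linarith)
  have hd2 := hsteep t ((1 + h) * t) (by linarith) le_rfl (by linarith) (by linarith)
  have hDh : 0 < D * h := by positivity
  have hDth : D * (t * h) ≤ D * (1 * h) := mul_le_mul_of_nonneg_left hth1 (Nat.cast_nonneg _)
  have hb1 : Real.log (c t) - Real.log (c ((1 - 2 * h) * t)) < κ := by
    refine hd1.trans_le ?_
    linarith
  have hb2 : Real.log (c ((1 + h) * t)) - Real.log (c t) < κ / 2 := by
    refine hd2.trans_le ?_
    linarith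
  rw [lt_div_iff₀ hct, div_lt_iff₀ hct]
  constructor
  · refine lt_of_lt_of_le ?_ hlow
    have h1 : Real.log ((1 - κ) * c t) < Real.log (c ((1 - 2 * h) * t)) := by
      rw [Real.log_mul (by linarith) hct.ne']
      have := Real.log_le_sub_one_of_pos (by linarith : 0 < 1 - κ)
      linarith
    exact (Real.log_lt_log_iff (mul_pos (by linarith) hct) hc1).1 h1
  · refine lt_of_le_of_lt hup ?_
    have h1 : Real.log (c ((1 + h) * t)) < Real.log ((1 + κ) * c t) := by
      rw [Real.log_mul (by linarith) hct.ne']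
      have h6 : κ / 2 ≤ Real.log (1 + κ) := by
        have := Real.one_sub_inv_le_log_of_pos (by linarith : 0 < 1 + κ)
        have h7 : κ / 2 ≤ 1 - (1 + κ)⁻¹ := by
          rw [← sub_nonneg]
          have : 1 - (1 + κ)⁻¹ - κ / 2 = κ * (1 - κ) / (2 * (1 + κ)) := by
            field_simp; ring
          rw [this]
          apply div_nonneg (mul_nonneg hκ.le (by linarith)) (by linarith)
        linarith
      linarith
    exact (Real.log_lt_log_iff hc2 (mul_pos (by linarith) hct)).1 h1

/-- Appending zero frequencies changes neither the Bohr set nor its regularity. -/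
theorem bohrSet_append_zero {d p : ℕ} (θ : Fin d → UnitAddCircle) {ε : ℝ} (hε : 0 < ε) (N : ℕ) :
    bohrSet (Fin.append θ (fun _ : Fin p => 0)) ε N = bohrSet θ ε N := by
  ext n
  rw [mem_bohrSet, mem_bohrSet, Fin.forall_fin_add]
  simp [hε]

/-- The Bohr datum with `p` zero frequencies appended. -/
def BohrDatum.pad (L : BohrDatum) (p : ℕ) : BohrDatum where
  dim := L.dim + p
  dim_pos := Nat.add_pos_left L.dim_pos p
  freq := Fin.append L.freq (fun _ => 0)
  radius := L.radius
  radius_pos := L.radius_pos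
  length := L.length
  length_pos := L.length_pos

theorem BohrDatum.pad_carrier (L : BohrDatum) (p : ℕ) : (L.pad p).carrier = L.carrier :=
  bohrSet_append_zero L.freq L.radius_pos L.length

theorem BohrDatum.IsRegular.pad {L : BohrDatum} (hL : L.IsRegular) (p : ℕ) :
    (L.pad p).IsRegular := by
  intro κ hκ hκ1 ε' N' hε' hN'
  have hd := L.one_le_dim
  have hle : κ / (100 * (((L.pad p).dim : ℕ) : ℝ)) ≤ κ / (100 * (L.dim : ℝ)) := by
    apply div_le_div_of_nonneg_left hκ.le (by positivity)
    simp only [BohrDatum.pad]; push_cast; linarith [Nat.cast_nonneg (α := ℝ) p]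
  have hlt1 : κ / (100 * (L.dim : ℝ)) ≤ 1 := by
    rw [div_le_one (by positivity)]; linarith
  have hε1 : |L.radius - ε'| < κ / (100 * (L.dim : ℝ)) * L.radius :=
    lt_of_lt_of_le hε' (mul_le_mul_of_nonneg_right hle L.radius_pos.le)
  have hN1 : |(L.length : ℝ) - N'| < κ / (100 * (L.dim : ℝ)) * L.length :=
    lt_of_lt_of_le hN' (mul_le_mul_of_nonneg_right hle (Nat.cast_nonneg _))
  have hpos : 0 < ε' := by
    have h1 := (abs_lt.1 hε1).2
    have := mul_le_mul_of_nonneg_right hlt1 L.radius_pos.le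
    linarith
  have := hL κ hκ hκ1 ε' N' hε1 hN1
  rw [BohrDatum.pad_carrier]
  have e : bohrSet (L.pad p).freq ε' N' = bohrSet L.freq ε' N' := bohrSet_append_zero L.freq hpos N'
  rw [e]
  exact this

/-! ### Parseval's identity on finite sets of integers -/

/-- The character `e(-s x)` with `e(t) = exp (2 π i t)`. -/
def negChar (s : ℤ) (x : ℝ) : ℂ :=
  Complex.exp (-(2 * (Real.pi : ℂ) * Complex.I * (s : ℂ) * (x : ℂ)))

theorem negChar_eq (s : ℤ) (x : ℝ) :
    negChar s x = Complex.exp (((-(2 * Real.pi * s * x) : ℝ) : ℂ) * Complex.I) := by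
  rw [negChar]; congr 1; push_cast; ring

theorem norm_negChar (s : ℤ) (x : ℝ) : ‖negChar s x‖ = 1 := by
  rw [negChar_eq, Complex.norm_exp_ofReal_mul_I]

theorem negChar_add (s t : ℤ) (x : ℝ) : negChar (s + t) x = negChar s x * negChar t x := by
  rw [negChar, negChar, negChar, ← Complex.exp_add]; congr 1; push_cast; ring

theorem negChar_zero_left (x : ℝ) : negChar 0 x = 1 := by simp [negChar]

theorem negChar_zero_right (s : ℤ) : negChar s 0 = 1 := by simp [negChar]

theorem conj_negChar (s : ℤ) (x : ℝ) : (starRingEnd ℂ) (negChar s x) = negChar (-s) x := by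
  rw [negChar_eq, negChar_eq, ← Complex.exp_conj, map_mul, Complex.conj_ofReal, Complex.conj_I]
  congr 1
  push_cast
  ring

theorem continuous_negChar (s : ℤ) : Continuous (negChar s) := by
  unfold negChar; fun_prop

theorem integral_negChar (s : ℤ) : ∫ x in (0 : ℝ)..1, negChar s x = if s = 0 then 1 else 0 := by
  split_ifs with h
  · subst h; simp [negChar_zero_left]
  · have hc : (-(2 * (Real.pi : ℂ) * Complex.I * (s : ℂ))) ≠ 0 := by
      have : (s : ℂ) ≠ 0 := by exact_mod_cast h
      have h2 : (Real.pi : ℂ) ≠ 0 := by exact_mod_cast Real.pi_ne_zero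
      simp [this, h2]
    have e : ∀ x : ℝ, negChar s x = Complex.exp (-(2 * (Real.pi : ℂ) * Complex.I * (s : ℂ)) * x) :=
      fun x => by rw [negChar]; congr 1; ring
    simp_rw [e]
    rw [integral_exp_mul_complex hc]
    have : Complex.exp (-(2 * (Real.pi : ℂ) * Complex.I * (s : ℂ)) * ((1 : ℝ) : ℂ)) = 1 := by
      rw [Complex.exp_eq_one_iff]
      exact ⟨-s, by push_cast; ring⟩
    rw [this]; simp

/-- The trigonometric polynomial `∑_{n ∈ T} c(n) e(-n x)`. -/
def trigPoly (T : Finset ℤ) (c : ℤ → ℝ) (x : ℝ) : ℂ := ∑ n ∈ T, (c n : ℂ) * negChar n x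

theorem continuous_trigPoly (T : Finset ℤ) (c : ℤ → ℝ) : Continuous (trigPoly T c) := by
  unfold trigPoly
  exact continuous_finsetSum _ fun n _ => continuous_const.mul (continuous_negChar n)

theorem conj_trigPoly (T : Finset ℤ) (c : ℤ → ℝ) (x : ℝ) :
    (starRingEnd ℂ) (trigPoly T c x) = ∑ n ∈ T, (c n : ℂ) * negChar (-n) x := by
  simp [trigPoly, conj_negChar]

theorem norm_trigPoly_le {T : Finset ℤ} {c : ℤ → ℝ} (hc : ∀ n, |c n| ≤ 1) (x : ℝ) :
    ‖trigPoly T c x‖ ≤ #T := by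
  refine (norm_sum_le_of_le T (f := fun n => (c n : ℂ) * negChar n x) (n := fun _ => 1)
    fun n _ => ?_).trans (by simp)
  rw [norm_mul, norm_negChar, mul_one, Complex.norm_real]
  exact hc n

theorem integral_finset_sum_negChar {ι : Type*} (I : Finset ι) (a : ι → ℂ) (φ : ι → ℤ) :
    ∫ x in (0 : ℝ)..1, ∑ i ∈ I, a i * negChar (φ i) x = ∑ i ∈ I, if φ i = 0 then a i else 0 := by
  rw [intervalIntegral.integral_finsetSum]
  · refine Finset.sum_congr rfl fun i _ => ?_
    rw [intervalIntegral.integral_const_mul, integral_negChar]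
    simp
  · intro i _
    exact (continuous_const.mul (continuous_negChar _)).intervalIntegrable _ _

theorem integral_norm_trigPoly_sq (T : Finset ℤ) (c : ℤ → ℝ) :
    ∫ x in (0 : ℝ)..1, ‖trigPoly T c x‖ ^ 2 = ∑ n ∈ T, c n ^ 2 := by
  have h : ∀ x, ((‖trigPoly T c x‖ ^ 2 : ℝ) : ℂ)
      = ∑ p ∈ T ×ˢ T, ((c p.1 : ℂ) * c p.2) * negChar (p.1 - p.2) x := by
    intro x
    rw [Complex.ofReal_pow, ← Complex.mul_conj', conj_trigPoly, trigPoly, Finset.sum_mul_sum,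
      Finset.sum_product]
    refine Finset.sum_congr rfl fun m _ => Finset.sum_congr rfl fun n _ => ?_
    rw [sub_eq_add_neg, negChar_add]; ring
  apply Complex.ofReal_injective
  rw [← intervalIntegral.integral_ofReal]
  simp_rw [h]
  rw [integral_finset_sum_negChar, Finset.sum_product]
  push_cast
  refine Finset.sum_congr rfl fun m hm => ?_
  simp only [sub_eq_zero]
  rw [Finset.sum_ite_eq]
  simp [hm, sq]

/-- The second moment of a truncated correlation is bounded by the sup norm of one Fourier
transform and the `ℓ²` norm of the other factor. -/
theorem sum_correlation_sq_le (S K : Finset ℤ) (h g : ℤ → ℝ) {Y : Finset ℤ}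
    (hY : ∀ s ∈ S, ∀ k ∈ K, s - k ∈ Y) {B : ℝ} (hB : ∀ x, ‖trigPoly S h x‖ ≤ B)
    (hg : ∀ n, |g n| ≤ 1) :
    ∑ k ∈ K, (∑ s ∈ S, h s * g (s - k)) ^ 2 ≤ B ^ 2 * #Y := by
  set c : ℤ → ℝ := fun k => ∑ s ∈ S, h s * g (s - k)
  set F := trigPoly K c
  set H := trigPoly S h
  set G := trigPoly Y g
  have hB0 : 0 ≤ B := (norm_nonneg _).trans (hB 0)
  have key : ((∑ k ∈ K, c k ^ 2 : ℝ) : ℂ)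
      = ∫ x in (0 : ℝ)..1, (starRingEnd ℂ) (F x) * (H x * (starRingEnd ℂ) (G x)) := by
    have e : ∀ x, (starRingEnd ℂ) (F x) * (H x * (starRingEnd ℂ) (G x))
        = ∑ p ∈ K ×ˢ (S ×ˢ Y), ((c p.1 : ℂ) * (h p.2.1 * g p.2.2)) *
            negChar (-p.1 + (p.2.1 + -p.2.2)) x := by
      intro x
      rw [conj_trigPoly, conj_trigPoly]
      simp only [H, trigPoly]
      rw [Finset.sum_mul_sum, Finset.sum_mul, Finset.sum_product]
      refine Finset.sum_congr rfl fun k _ => ?_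
      rw [Finset.mul_sum, Finset.sum_product]
      refine Finset.sum_congr rfl fun s _ => ?_
      rw [Finset.mul_sum]
      refine Finset.sum_congr rfl fun y _ => ?_
      rw [negChar_add, negChar_add]; ring
    simp_rw [e]
    rw [integral_finset_sum_negChar, Finset.sum_product]
    push_cast
    refine Finset.sum_congr rfl fun k hk => ?_
    rw [Finset.sum_product, sq]
    conv_lhs => rw [show ((c k : ℝ) : ℂ) * (c k : ℂ) = (c k : ℂ) * ∑ s ∈ S, ((h s : ℂ) * g (s - k)) by
      congr 1; simp [c]]
    rw [Finset.mul_sum]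
    refine Finset.sum_congr rfl fun s hs => ?_
    rw [Finset.sum_eq_single (s - k)]
    · simp
    · intro y _ hy
      rw [if_neg]
      intro h0
      exact hy (by linarith)
    · intro h0; exact absurd (hY s hs k hk) h0
  have hcF : Continuous F := continuous_trigPoly _ _
  have hcH : Continuous H := continuous_trigPoly _ _
  have hcG : Continuous G := continuous_trigPoly _ _
  have bound : ∑ k ∈ K, c k ^ 2
      ≤ ∫ x in (0 : ℝ)..1, (1 / 2 * ‖F x‖ ^ 2 + 1 / 2 * (B ^ 2 * ‖G x‖ ^ 2)) := by
    have h1 : ∑ k ∈ K, c k ^ 2 = ‖((∑ k ∈ K, c k ^ 2 : ℝ) : ℂ)‖ := by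
      rw [Complex.norm_real, Real.norm_of_nonneg (Finset.sum_nonneg fun _ _ => sq_nonneg _)]
    rw [h1, key]
    refine intervalIntegral.norm_integral_le_of_norm_le zero_le_one ?_ ?_
    · refine Filter.Eventually.of_forall fun x _ => ?_
      rw [norm_mul, norm_mul, RCLike.norm_conj, RCLike.norm_conj]
      have h2 : ‖F x‖ * (‖H x‖ * ‖G x‖) ≤ ‖F x‖ * (B * ‖G x‖) := by
        gcongr; exact hB x
      nlinarith [sq_nonneg (‖F x‖ - B * ‖G x‖)]
    · apply Continuous.intervalIntegrable; fun_prop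
  rw [intervalIntegral.integral_add, intervalIntegral.integral_const_mul,
    intervalIntegral.integral_const_mul, intervalIntegral.integral_const_mul,
    integral_norm_trigPoly_sq, integral_norm_trigPoly_sq] at bound
  · have hY1 : ∑ n ∈ Y, g n ^ 2 ≤ #Y := by
      refine (Finset.sum_le_card_nsmul Y _ 1 fun n _ => ?_).trans (by simp)
      rw [sq_le_one_iff_abs_le_one]; exact hg n
    have := mul_le_mul_of_nonneg_left hY1 (sq_nonneg B)
    change ∑ k ∈ K, c k ^ 2 ≤ _
    linarith
  · apply Continuous.intervalIntegrable; fun_prop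
  · apply Continuous.intervalIntegrable; fun_prop

/-! ### Correlations of locally uniform functions -/

open Classical in
/-- For all but a proportion `ω` of the translates `a + S`, `a ∈ K`, the Fourier transform of `g`
restricted to `a + S` is at most `α |S|` everywhere. -/
def LocallyUniform (K S : Finset ℤ) (g : ℤ → ℝ) (α ω : ℝ) : Prop :=
  (#{a ∈ K | ¬ ∀ x, ‖trigPoly S (fun r => g (a + r)) x‖ ≤ α * #S} : ℝ) ≤ ω * #K

/-- The correlation bound at each good translate comes from `sum_correlation_sq_le`; the bad ones are
estimated trivially. -/
theorem LocallyUniform.sum_correlation_sq_le {K S Y : Finset ℤ} {g : ℤ → ℝ} {α ω : ℝ}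
    (h : LocallyUniform K S g α ω) (hK : ∀ a ∈ K, -a ∈ K)
    (hY : ∀ s ∈ S, ∀ k ∈ K, s - k ∈ Y) (hg : ∀ n, |g n| ≤ 1) :
    ∑ b ∈ K, ∑ b' ∈ K, (∑ s ∈ S, g (s - b) * g (s - b')) ^ 2
      ≤ (α ^ 2 + ω) * (#S : ℝ) ^ 2 * #K * #Y := by
  classical
  set good : ℤ → Prop := fun a => ∀ x, ‖trigPoly S (fun r => g (a + r)) x‖ ≤ α * #S
  have hneg : ∑ b ∈ K, ∑ b' ∈ K, (∑ s ∈ S, g (s - b) * g (s - b')) ^ 2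
      = ∑ a ∈ K, ∑ b' ∈ K, (∑ s ∈ S, g (a + s) * g (s - b')) ^ 2 := by
    refine Finset.sum_nbij' (fun b => -b) (fun b => -b) hK hK (by simp) (by simp) fun b _ => ?_
    refine Finset.sum_congr rfl fun b' _ => ?_
    congr 1
    refine Finset.sum_congr rfl fun s _ => ?_
    rw [show s - b = -b + s by ring]
  have hpt : ∀ a ∈ K, ∑ b' ∈ K, (∑ s ∈ S, g (a + s) * g (s - b')) ^ 2
      ≤ α ^ 2 * (#S : ℝ) ^ 2 * #Y + if ¬ good a then (#S : ℝ) ^ 2 * #Y else 0 := by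
    intro a _
    by_cases hga : good a
    · have := _root_.sum_correlation_sq_le S K (fun s => g (a + s)) g hY hga hg
      rw [if_neg (not_not.2 hga), add_zero, ← mul_pow]
      exact this
    · have := _root_.sum_correlation_sq_le S K (fun s => g (a + s)) g hY
        (norm_trigPoly_le fun n => hg _) hg
      rw [if_pos hga]
      have h0 : 0 ≤ α ^ 2 * (#S : ℝ) ^ 2 * #Y := by positivity
      linarith
  rw [hneg]
  refine (Finset.sum_le_sum hpt).trans ?_
  rw [Finset.sum_add_distrib, ← Finset.sum_filter, Finset.sum_const, Finset.sum_const,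
    nsmul_eq_mul, nsmul_eq_mul]
  have h1 : (#{a ∈ K | ¬ good a} : ℝ) * ((#S : ℝ) ^ 2 * #Y) ≤ ω * #K * ((#S : ℝ) ^ 2 * #Y) :=
    mul_le_mul_of_nonneg_right h (by positivity)
  linarith

/-- The correlation of a locally uniform function with an arbitrary bounded weight and the
translates of an arbitrary bounded function is small on average. Cauchy–Schwarz over the translates
makes room to discard the weight and the other function, and a second application leaves the second
moment of the autocorrelations. -/
theorem LocallyUniform.sum_abs_correlation_le {K S Y : Finset ℤ} {g : ℤ → ℝ} {α ω ξ : ℝ}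
    (h : LocallyUniform K S g α ω) (hK : ∀ a ∈ K, -a ∈ K)
    (hY : ∀ s ∈ S, ∀ k ∈ K, s - k ∈ Y) (hg : ∀ n, |g n| ≤ 1) (hYK : (#Y : ℝ) ≤ 2 * #K)
    (hω : 0 ≤ ω) (hξ : 0 ≤ ξ) (hξ4 : 2 * (α ^ 2 + ω) ≤ ξ ^ 4) {w e : ℤ → ℝ}
    (hw : ∀ n, |w n| ≤ 1) (he : ∀ n, |e n| ≤ 1) :
    ∑ b ∈ K, ∑ a ∈ K, |∑ s ∈ S, g (s - b) * w s * e (s - a)| ≤ ξ * (#K : ℝ) ^ 2 * #S := by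
  set C : ℤ × ℤ → ℝ := fun p => ∑ b ∈ K, g (p.1 - b) * g (p.2 - b)
  set E : ℤ × ℤ → ℝ := fun p => ∑ a ∈ K, e (p.1 - a) * e (p.2 - a)
  have hE : ∀ p, |E p| ≤ #K := by
    intro p
    refine (Finset.abs_sum_le_sum_abs _ _).trans ?_
    refine (Finset.sum_le_card_nsmul K _ 1 fun a _ => ?_).trans (by simp)
    rw [abs_mul]; exact mul_le_one₀ (he _) (abs_nonneg _) (he _)
  have h1 : (∑ b ∈ K, ∑ a ∈ K, |∑ s ∈ S, g (s - b) * w s * e (s - a)|) ^ 2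
      ≤ (#K : ℝ) ^ 2 * ∑ b ∈ K, ∑ a ∈ K, (∑ s ∈ S, g (s - b) * w s * e (s - a)) ^ 2 := by
    rw [← Finset.sum_product', ← Finset.sum_product']
    refine sq_sum_le_card_mul_sum_sq.trans ?_
    simp only [sq_abs, Finset.card_product]
    push_cast
    rw [sq (#K : ℝ)]
  have h2 : ∑ b ∈ K, ∑ a ∈ K, (∑ s ∈ S, g (s - b) * w s * e (s - a)) ^ 2
      = ∑ p ∈ S ×ˢ S, w p.1 * w p.2 * C p * E p := by
    simp only [sq, Finset.sum_mul_sum, C, E]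
    simp_rw [← Finset.sum_product' S S]
    simp_rw [Finset.sum_comm (s := K) (t := S ×ˢ S)]
    refine Finset.sum_congr rfl fun p _ => ?_
    rw [mul_assoc, Finset.sum_mul_sum, Finset.mul_sum]
    refine Finset.sum_congr rfl fun b _ => ?_
    rw [Finset.mul_sum]
    refine Finset.sum_congr rfl fun a _ => ?_
    ring
  have h3 : ∑ p ∈ S ×ˢ S, w p.1 * w p.2 * C p * E p ≤ (∑ p ∈ S ×ˢ S, |C p|) * #K := by
    rw [Finset.sum_mul]
    refine Finset.sum_le_sum fun p _ => (le_abs_self _).trans ?_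
    rw [abs_mul, abs_mul, abs_mul]
    have : |w p.1| * |w p.2| ≤ 1 := mul_le_one₀ (hw _) (abs_nonneg _) (hw _)
    calc |w p.1| * |w p.2| * |C p| * |E p| ≤ 1 * |C p| * #K := by
          gcongr; exact hE p
      _ = _ := by ring
  have h4 : (∑ p ∈ S ×ˢ S, |C p|) ^ 2 ≤ (#S : ℝ) ^ 2 * ∑ p ∈ S ×ˢ S, C p ^ 2 := by
    refine sq_sum_le_card_mul_sum_sq.trans ?_
    simp only [sq_abs, Finset.card_product]
    push_cast
    rw [sq (#S : ℝ)]
  have h5 : ∑ p ∈ S ×ˢ S, C p ^ 2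
      = ∑ b ∈ K, ∑ b' ∈ K, (∑ s ∈ S, g (s - b) * g (s - b')) ^ 2 := by
    simp only [sq, Finset.sum_mul_sum, C]
    simp_rw [← Finset.sum_product' S S]
    rw [Finset.sum_comm]
    refine Finset.sum_congr rfl fun b _ => ?_
    rw [Finset.sum_comm]
    refine Finset.sum_congr rfl fun b' _ => Finset.sum_congr rfl fun p _ => ?_
    ring
  have h6 : (∑ p ∈ S ×ˢ S, |C p|) ^ 2 ≤ (ξ ^ 2 * (#S : ℝ) ^ 2 * #K) ^ 2 := by
    refine h4.trans ?_
    rw [h5]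
    have h7 := h.sum_correlation_sq_le hK hY hg
    have h8 : (α ^ 2 + ω) * (#S : ℝ) ^ 2 * #K * #Y ≤ ξ ^ 4 * (#S : ℝ) ^ 2 * #K * #K := by
      calc (α ^ 2 + ω) * (#S : ℝ) ^ 2 * #K * #Y
          ≤ (α ^ 2 + ω) * (#S : ℝ) ^ 2 * #K * (2 * #K) := by gcongr
        _ = (2 * (α ^ 2 + ω)) * (#S : ℝ) ^ 2 * #K * #K := by ring
        _ ≤ _ := by gcongr
    have := mul_le_mul_of_nonneg_left (h7.trans h8) (sq_nonneg (#S : ℝ))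
    refine this.trans (le_of_eq ?_)
    ring
  have h9 : ∑ p ∈ S ×ˢ S, |C p| ≤ ξ ^ 2 * (#S : ℝ) ^ 2 * #K :=
    (le_abs_self _).trans (abs_le_of_sq_le_sq h6 (by positivity))
  refine (le_abs_self _).trans (abs_le_of_sq_le_sq ?_ (by positivity))
  refine h1.trans ?_
  rw [h2]
  calc (#K : ℝ) ^ 2 * ∑ p ∈ S ×ˢ S, w p.1 * w p.2 * C p * E p
      ≤ (#K : ℝ) ^ 2 * ((ξ ^ 2 * (#S : ℝ) ^ 2 * #K) * #K) := by
        gcongr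
        exact h3.trans (by gcongr)
    _ = (ξ * (#K : ℝ) ^ 2 * #S) ^ 2 := by ring

theorem LocallyUniform.sum_abs_sum_le {K S Y : Finset ℤ} {g : ℤ → ℝ} {α ω ξ : ℝ}
    (h : LocallyUniform K S g α ω) (hK : ∀ a ∈ K, -a ∈ K) (hKpos : 0 < #K)
    (hY : ∀ s ∈ S, ∀ k ∈ K, s - k ∈ Y) (hg : ∀ n, |g n| ≤ 1) (hYK : (#Y : ℝ) ≤ 2 * #K)
    (hω : 0 ≤ ω) (hξ : 0 ≤ ξ) (hξ4 : 2 * (α ^ 2 + ω) ≤ ξ ^ 4) :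
    ∑ b ∈ K, |∑ s ∈ S, g (s - b)| ≤ ξ * #K * #S := by
  have h1 := h.sum_abs_correlation_le hK hY hg hYK hω hξ hξ4 (w := 1) (e := 1) (by simp) (by simp)
  simp only [Pi.one_apply, mul_one, Finset.sum_const, nsmul_eq_mul] at h1
  rw [← Finset.mul_sum] at h1
  have hpos : (0 : ℝ) < #K := by exact_mod_cast hKpos
  have h2 : (#K : ℝ) * ∑ b ∈ K, |∑ s ∈ S, g (s - b)| ≤ #K * (ξ * #K * #S) :=
    h1.trans (le_of_eq (by ring))
  exact le_of_mul_le_mul_left h2 hpos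

/-! ### The counting inequality for corners -/

/-- The sum `∑ f(a,b) f(a,b') f(a',b) f(a',b')` over `a, a' ∈ X` and `b, b' ∈ Y`: the fourth power
of the (unnormalised) rectangular norm of `f`. -/
def boxSum (X Y : Finset ℤ) (f : ℤ → ℤ → ℝ) : ℝ :=
  ∑ a ∈ X, ∑ a' ∈ X, ∑ b ∈ Y, ∑ b' ∈ Y, f a b * f a b' * f a' b * f a' b'

/-- Two applications of the Cauchy–Schwarz inequality: the number of corners weighted by `f` at the
corner point is controlled by a rectangular sum of `f` with a weight that depends only on the
two one-dimensional sets. -/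
theorem cornerSum_pow_four_le (K S : Finset ℤ) {e₁ e₂ : ℤ → ℝ} {f A : ℤ → ℤ → ℝ}
    (he₁ : ∀ n, e₁ n = 0 ∨ e₁ n = 1) (he₂ : ∀ n, e₂ n = 0 ∨ e₂ n = 1)
    (hA0 : ∀ x y, 0 ≤ A x y) (hA : ∀ x y, A x y ≤ e₁ x * e₂ y) :
    (∑ a ∈ K, ∑ b ∈ K, ∑ r ∈ S, f a b * A (r - b) b * A a (r - a)) ^ 4
      ≤ (∑ a ∈ K, ∑ r ∈ S, e₁ a * e₂ (r - a)) ^ 2 *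
        (∑ b ∈ K, ∑ b' ∈ K, ∑ r ∈ S, e₁ (r - b) * e₁ (r - b') * (e₂ b * e₂ b')) *
        ∑ a ∈ K, ∑ a' ∈ K, ∑ b ∈ K, ∑ b' ∈ K, f a b * f a b' * f a' b * f a' b' *
          ∑ r ∈ S, e₁ (r - b) * e₁ (r - b') * (e₂ (r - a) * e₂ (r - a')) := by
  have sq₁ : ∀ n, e₁ n ^ 2 = e₁ n := fun n => by rcases he₁ n with h | h <;> simp [h]
  have sq₂ : ∀ n, e₂ n ^ 2 = e₂ n := fun n => by rcases he₂ n with h | h <;> simp [h]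
  have n₁ : ∀ n, 0 ≤ e₁ n := fun n => by rcases he₁ n with h | h <;> simp [h]
  have n₂ : ∀ n, 0 ≤ e₂ n := fun n => by rcases he₂ n with h | h <;> simp [h]
  have l₁ : ∀ n, e₁ n ≤ 1 := fun n => by rcases he₁ n with h | h <;> simp [h]
  have l₂ : ∀ n, e₂ n ≤ 1 := fun n => by rcases he₂ n with h | h <;> simp [h]
  have hAe : ∀ x y, e₁ x * e₂ y * A x y = A x y := by
    intro x y
    have h1 := hA x y
    have h2 := hA0 x y
    rcases he₁ x with h | h <;> rcases he₂ y with h' | h' <;> simp [h, h'] at h1 ⊢ <;> linarith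
  have hA1 : ∀ x y, A x y ≤ 1 := fun x y => (hA x y).trans (mul_le_one₀ (l₁ _) (n₂ _) (l₂ _))
  have hA2 : ∀ x y, A x y ^ 2 ≤ e₁ x := fun x y => by
    have h1 : A x y ^ 2 ≤ A x y := by nlinarith [hA1 x y, hA0 x y]
    have h2 : e₁ x * e₂ y ≤ e₁ x * 1 := mul_le_mul_of_nonneg_left (l₂ y) (n₁ x)
    linarith [hA x y]
  have hA2' : ∀ x y, A x y ^ 2 ≤ e₂ y := fun x y => by
    have h1 : A x y ^ 2 ≤ A x y := by nlinarith [hA1 x y, hA0 x y]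
    have h2 : e₁ x * e₂ y ≤ 1 * e₂ y := mul_le_mul_of_nonneg_right (l₁ x) (n₂ y)
    linarith [hA x y]
  set T := ∑ a ∈ K, ∑ b ∈ K, ∑ r ∈ S, f a b * A (r - b) b * A a (r - a) with hT
  set P := ∑ a ∈ K, ∑ r ∈ S, e₁ a * e₂ (r - a) with hP
  set Q := ∑ b ∈ K, ∑ b' ∈ K, ∑ r ∈ S, e₁ (r - b) * e₁ (r - b') * (e₂ b * e₂ b') with hQ
  set U : ℝ := ∑ p ∈ K ×ˢ S, e₂ (p.2 - p.1) * (∑ b ∈ K, f p.1 b * A (p.2 - b) b) ^ 2 with hU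
  -- the first Cauchy–Schwarz inequality, over `(a, r)`, removes the factor `A a (r - a)`
  have hT_sq : T ^ 2 ≤ P * U := by
    have e1 : T = ∑ p ∈ K ×ˢ S, (e₁ p.1 * e₂ (p.2 - p.1)) *
        (A p.1 (p.2 - p.1) * ∑ b ∈ K, f p.1 b * A (p.2 - b) b) := by
      rw [hT, Finset.sum_product]
      refine Finset.sum_congr rfl fun a _ => ?_
      rw [Finset.sum_comm]
      refine Finset.sum_congr rfl fun r _ => ?_
      rw [← mul_assoc, hAe, Finset.mul_sum]
      exact Finset.sum_congr rfl fun b _ => by ring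
    rw [e1]
    refine (Finset.sum_mul_sq_le_sq_mul_sq _ _ _).trans ?_
    have e2 : ∑ p ∈ K ×ˢ S, (e₁ p.1 * e₂ (p.2 - p.1)) ^ 2 = P := by
      rw [hP, Finset.sum_product]
      simp only [mul_pow, sq₁, sq₂]
    rw [e2]
    refine mul_le_mul_of_nonneg_left ?_ ?_
    · refine Finset.sum_le_sum fun p _ => ?_
      rw [mul_pow]
      exact mul_le_mul_of_nonneg_right (hA2' _ _) (sq_nonneg _)
    · exact Finset.sum_nonneg fun a _ => Finset.sum_nonneg fun r _ => mul_nonneg (n₁ _) (n₂ _)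
  set V : ℤ → ℤ → ℤ → ℝ := fun b b' r => ∑ a ∈ K, e₂ (r - a) * (f a b * f a b') with hV
  -- expanding the square doubles `b`; the weights `e₁`, `e₂` may be inserted as `A` lives on them
  have hU_eq : U = ∑ p ∈ K ×ˢ (K ×ˢ S), (e₁ (p.2.2 - p.1) * e₁ (p.2.2 - p.2.1) *
      (e₂ p.1 * e₂ p.2.1)) *
      (A (p.2.2 - p.1) p.1 * A (p.2.2 - p.2.1) p.2.1 * V p.1 p.2.1 p.2.2) := by
    have e1 : ∀ p : ℤ × ℤ × ℤ, (e₁ (p.2.2 - p.1) * e₁ (p.2.2 - p.2.1) * (e₂ p.1 * e₂ p.2.1)) *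
      (A (p.2.2 - p.1) p.1 * A (p.2.2 - p.2.1) p.2.1 * V p.1 p.2.1 p.2.2)
      = A (p.2.2 - p.1) p.1 * A (p.2.2 - p.2.1) p.2.1 * V p.1 p.2.1 p.2.2 := by
      intro p
      conv_rhs => rw [← hAe (p.2.2 - p.1) p.1, ← hAe (p.2.2 - p.2.1) p.2.1]
      ring
    simp only [e1]
    rw [Finset.sum_product, hU, Finset.sum_product, Finset.sum_comm]
    simp only [Finset.sum_product, hV, sq, Finset.sum_mul_sum]
    simp only [Finset.mul_sum]
    simp_rw [Finset.sum_comm (s := K) (t := S)]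
    refine Finset.sum_congr rfl fun r _ => ?_
    rw [Finset.sum_comm]
    refine Finset.sum_congr rfl fun b _ => ?_
    rw [Finset.sum_comm]
    refine Finset.sum_congr rfl fun b' _ => Finset.sum_congr rfl fun a _ => ?_
    ring
  -- the second one, over `(b, b', r)`, removes the factors `A (r - b) b` and `A (r - b') b'`
  have hU_sq : U ^ 2 ≤ Q * ∑ a ∈ K, ∑ a' ∈ K, ∑ b ∈ K, ∑ b' ∈ K,
      f a b * f a b' * f a' b * f a' b' *
          ∑ r ∈ S, e₁ (r - b) * e₁ (r - b') * (e₂ (r - a) * e₂ (r - a')) := by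
    rw [hU_eq]
    refine (Finset.sum_mul_sq_le_sq_mul_sq _ _ _).trans ?_
    have e2 : ∑ p ∈ K ×ˢ (K ×ˢ S), (e₁ (p.2.2 - p.1) * e₁ (p.2.2 - p.2.1) *
      (e₂ p.1 * e₂ p.2.1)) ^ 2 = Q := by
      simp only [mul_pow, sq₁, sq₂]
      rw [Finset.sum_product, hQ]
      refine Finset.sum_congr rfl fun b _ => ?_
      rw [Finset.sum_product]
    rw [e2]
    refine mul_le_mul_of_nonneg_left ?_ ?_
    · have e3 : ∀ p ∈ K ×ˢ (K ×ˢ S),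
          (A (p.2.2 - p.1) p.1 * A (p.2.2 - p.2.1) p.2.1 * V p.1 p.2.1 p.2.2) ^ 2
          ≤ e₁ (p.2.2 - p.1) * e₁ (p.2.2 - p.2.1) * V p.1 p.2.1 p.2.2 ^ 2 := by
        intro p _
        rw [mul_pow, mul_pow]
        exact mul_le_mul_of_nonneg_right
          (mul_le_mul (hA2 _ _) (hA2 _ _) (sq_nonneg _) (n₁ _)) (sq_nonneg _)
      refine (Finset.sum_le_sum e3).trans (le_of_eq ?_)
      simp only [Finset.sum_product, hV, sq, Finset.sum_mul_sum]
      simp only [Finset.mul_sum]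
      -- both sides are sums over the same five variables
      have c1 : ∀ F : ℤ → ℤ → ℤ → ℤ → ℤ → ℝ,
          ∑ b ∈ K, ∑ b' ∈ K, ∑ r ∈ S, ∑ a ∈ K, ∑ a' ∈ K, F a a' b b' r
          = ∑ a ∈ K, ∑ a' ∈ K, ∑ b ∈ K, ∑ b' ∈ K, ∑ r ∈ S, F a a' b b' r := by
        intro F
        have := Finset.sum_comm (s := K ×ˢ (K ×ˢ S)) (t := K ×ˢ K)
          (f := fun p q => F q.1 q.2 p.1 p.2.1 p.2.2)
        simpa only [Finset.sum_product] using this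
      rw [c1 (fun a a' b b' r => _)]
      refine Finset.sum_congr rfl fun a _ => Finset.sum_congr rfl fun a' _ =>
        Finset.sum_congr rfl fun b _ => Finset.sum_congr rfl fun b' _ =>
        Finset.sum_congr rfl fun r _ => ?_
      ring
    · exact Finset.sum_nonneg fun a _ => Finset.sum_nonneg fun r _ => Finset.sum_nonneg fun _ _ =>
        mul_nonneg (mul_nonneg (n₁ _) (n₁ _)) (mul_nonneg (n₂ _) (n₂ _))
  calc T ^ 4 = (T ^ 2) ^ 2 := by ring
    _ ≤ (P * U) ^ 2 := by
        have := sq_nonneg T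
        gcongr
    _ = P ^ 2 * U ^ 2 := by ring
    _ ≤ P ^ 2 * (Q * _) := mul_le_mul_of_nonneg_left hU_sq (sq_nonneg _)
    _ = _ := by ring

/-! ### From a large rectangular norm to a density increment -/

/-- If `A` has density `δ` on `X × Y` up to a small error and `A - δ` has a large rectangular
norm, then `A - δ` has a large sum over some `U × V`. -/
theorem exists_subrectangle_of_boxSum {X Y : Finset ℤ} {A : ℤ → ℤ → ℝ} {δ c : ℝ}
    (hA : ∀ x y, A x y = 0 ∨ A x y = 1) (hδ0 : 0 ≤ δ) (hδ1 : δ ≤ 1) (hc : 0 < c)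
    (hbox : c * (#X : ℝ) ^ 2 * (#Y : ℝ) ^ 2 ≤ boxSum X Y fun x y => A x y - δ)
    (hmean : |∑ a ∈ X, ∑ b ∈ Y, (A a b - δ)| ≤ c / 8 * (#X * #Y)) :
    ∃ U ⊆ X, ∃ V ⊆ Y, c / 24 * (#X * #Y) ≤ ∑ a ∈ U, ∑ b ∈ V, (A a b - δ) := by
  classical
  by_contra hcon
  push Not at hcon
  -- if all the sums `s U V` are small from above, they are small from below as well, since the
  -- complement of `U × V` is the union of three rectangles and the total is small
  set N : ℝ := #X * #Y with hN
  set f : ℤ → ℤ → ℝ := fun a b => A a b - δ with hf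
  set s : Finset ℤ → Finset ℤ → ℝ := fun U V => ∑ a ∈ U, ∑ b ∈ V, f a b with hs
  have hup : ∀ U ⊆ X, ∀ V ⊆ Y, s U V < c / 24 * N := fun U hU V hV => hcon U hU V hV
  have hNpos : 0 < N := by
    have h := hup ∅ (Finset.empty_subset _) ∅ (Finset.empty_subset _)
    simp only [hs, Finset.sum_empty] at h
    by_contra h0
    have : N = 0 := le_antisymm (not_lt.1 h0) (by positivity)
    rw [this] at h; simp at h
  have hlow : ∀ U ⊆ X, ∀ V ⊆ Y, -(c / 4 * N) ≤ s U V := by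
    intro U hU V hV
    have e : s X Y = s U V + s (X \ U) V + s U (Y \ V) + s (X \ U) (Y \ V) := by
      have h1 : ∀ a, ∑ b ∈ Y, f a b = ∑ b ∈ V, f a b + ∑ b ∈ Y \ V, f a b := fun a =>
        (by rw [add_comm, Finset.sum_sdiff hV])
      simp only [hs]
      simp_rw [h1, Finset.sum_add_distrib]
      rw [← Finset.sum_sdiff hU, ← Finset.sum_sdiff (f := fun a => ∑ b ∈ Y \ V, f a b) hU]
      ring
    have h1 := hup (X \ U) Finset.sdiff_subset V hV
    have h2 := hup U hU (Y \ V) Finset.sdiff_subset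
    have h3 := hup (X \ U) Finset.sdiff_subset (Y \ V) Finset.sdiff_subset
    have h4 := (abs_le.1 hmean).1
    change -(c / 8 * N) ≤ s X Y at h4
    linarith
  have habs : ∀ U ⊆ X, ∀ V ⊆ Y, |s U V| ≤ c / 4 * N := fun U hU V hV =>
    abs_le.2 ⟨hlow U hU V hV, (hup U hU V hV).le.trans (by nlinarith [mul_pos hc hNpos])⟩
  have hf1 : ∀ a b, |f a b| ≤ 1 := by
    intro a b
    rw [abs_le]
    rcases hA a b with h | h <;> simp only [hf, h] <;> constructor <;> linarith
  -- for fixed `a'`, `b'` the factors `f a b'` and `f a' b` are indicator functions of sets of `a`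
  -- and of `b`, minus `δ`, so that the box sum splits into sums over rectangles
  have hG : ∀ a' ∈ X, ∀ b' ∈ Y, f a' b' * ∑ a ∈ X, ∑ b ∈ Y, f a b * f a b' * f a' b < c * N := by
    intro a' _ b' _
    set U := {a ∈ X | A a b' = 1}
    set V := {b ∈ Y | A a' b = 1}
    have hU : U ⊆ X := Finset.filter_subset _ _
    have hV : V ⊆ Y := Finset.filter_subset _ _
    have hu : ∀ a, f a b' = (if A a b' = 1 then 1 else 0) - δ := by
      intro a; rcases hA a b' with h | h <;> simp [hf, h]
    have hv : ∀ b, f a' b = (if A a' b = 1 then 1 else 0) - δ := by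
      intro b; rcases hA a' b with h | h <;> simp [hf, h]
    have e : ∑ a ∈ X, ∑ b ∈ Y, f a b * f a b' * f a' b
        = s U V - δ * s U Y - δ * s X V + δ ^ 2 * s X Y := by
      simp only [hs, U, V]
      rw [Finset.sum_filter, Finset.sum_filter]
      simp_rw [Finset.sum_filter]
      rw [Finset.mul_sum, Finset.mul_sum, Finset.mul_sum, ← Finset.sum_sub_distrib,
        ← Finset.sum_sub_distrib, ← Finset.sum_add_distrib]
      refine Finset.sum_congr rfl fun a _ => ?_
      rw [hu a]
      have h1 : (if A a b' = 1 then ∑ b ∈ Y, (if A a' b = 1 then f a b else 0) else 0)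
          = ∑ b ∈ Y, (if A a b' = 1 then (if A a' b = 1 then f a b else 0) else 0) := by
        split_ifs <;> simp
      have h2 : (if A a b' = 1 then ∑ b ∈ Y, f a b else 0)
          = ∑ b ∈ Y, (if A a b' = 1 then f a b else 0) := by
        split_ifs <;> simp
      rw [h1, h2, Finset.mul_sum, Finset.mul_sum, Finset.mul_sum, ← Finset.sum_sub_distrib,
        ← Finset.sum_sub_distrib, ← Finset.sum_add_distrib]
      refine Finset.sum_congr rfl fun b _ => ?_
      rw [hv b]
      split_ifs <;> ring
    have h1 := habs U hU V hV
    have h2 := habs U hU Y subset_rfl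
    have h3 := habs X subset_rfl V hV
    have h4 : |s X Y| ≤ c / 8 * N := hmean
    have hcN := mul_pos hc hNpos
    have hb : |∑ a ∈ X, ∑ b ∈ Y, f a b * f a b' * f a' b| < c * N := by
      rw [e]
      have k2 : |δ * s U Y| ≤ c / 4 * N := by
        rw [abs_mul, abs_of_nonneg hδ0]; nlinarith [abs_nonneg (s U Y)]
      have k3 : |δ * s X V| ≤ c / 4 * N := by
        rw [abs_mul, abs_of_nonneg hδ0]; nlinarith [abs_nonneg (s X V)]
      have k4 : |δ ^ 2 * s X Y| ≤ c / 8 * N := by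
        rw [abs_mul, abs_of_nonneg (sq_nonneg δ)]
        have : δ ^ 2 ≤ 1 := pow_le_one₀ hδ0 hδ1
        nlinarith [abs_nonneg (s X Y)]
      rw [abs_le] at h1 k2 k3 k4
      rw [abs_lt]
      constructor <;> linarith [h1.1, h1.2, k2.1, k2.2, k3.1, k3.2, k4.1, k4.2]
    calc _ ≤ |f a' b' * ∑ a ∈ X, ∑ b ∈ Y, f a b * f a b' * f a' b| := le_abs_self _
      _ = |f a' b'| * |∑ a ∈ X, ∑ b ∈ Y, f a b * f a b' * f a' b| := abs_mul _ _
      _ ≤ 1 * |∑ a ∈ X, ∑ b ∈ Y, f a b * f a b' * f a' b| := by gcongr; exact hf1 _ _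
      _ < _ := by rwa [one_mul]
  have hbox2 : boxSum X Y f
      = ∑ p ∈ X ×ˢ Y, f p.1 p.2 * ∑ a ∈ X, ∑ b ∈ Y, f a b * f a p.2 * f p.1 b := by
    simp only [boxSum, Finset.sum_product, Finset.mul_sum]
    rw [Finset.sum_comm]
    refine Finset.sum_congr rfl fun a' _ => ?_
    rw [Finset.sum_comm]
    simp_rw [Finset.sum_comm (s := X) (t := Y)]
    rw [Finset.sum_comm]
    refine Finset.sum_congr rfl fun b' _ => ?_
    rw [Finset.sum_comm (s := Y) (t := X), Finset.sum_comm (s := X) (t := Y)]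
    refine Finset.sum_congr rfl fun b _ => Finset.sum_congr rfl fun a _ => ?_
    ring
  have hne : (X ×ˢ Y).Nonempty := by
    rw [← Finset.card_pos, Finset.card_product]
    rw [hN] at hNpos
    exact_mod_cast hNpos
  have hlt : boxSum X Y f < ∑ p ∈ X ×ˢ Y, c * N := by
    rw [hbox2]
    refine Finset.sum_lt_sum_of_nonempty hne fun p hp => ?_
    rw [Finset.mem_product] at hp
    exact hG _ hp.1 _ hp.2
  rw [Finset.sum_const, nsmul_eq_mul, Finset.card_product] at hlt
  push_cast at hlt
  have : c * (#X : ℝ) ^ 2 * (#Y : ℝ) ^ 2 = #X * #Y * (c * N) := by rw [hN]; ring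
  linarith

/-! ### Corners in a pseudorandom cell -/

/-- The consequences of local uniformity used for counting corners: `g` has small average over `K`,
small average absolute sum over the translates of `S`, and small correlations. -/
structure Pseudorandom (K S : Finset ℤ) (g : ℤ → ℝ) (ξ : ℝ) : Prop where
  correlation : ∀ w e : ℤ → ℝ, (∀ n, |w n| ≤ 1) → (∀ n, |e n| ≤ 1) →
    ∑ b ∈ K, ∑ a ∈ K, |∑ s ∈ S, g (s - b) * w s * e (s - a)| ≤ ξ * (#K : ℝ) ^ 2 * #S
  local_sum : ∑ b ∈ K, |∑ s ∈ S, g (s - b)| ≤ ξ * #K * #S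
  mean : |∑ b ∈ K, g b| ≤ 2 * ξ * #K

theorem LocallyUniform.pseudorandom {K S Y : Finset ℤ} {g : ℤ → ℝ} {α ω ξ κ : ℝ}
    (h : LocallyUniform K S g α ω) (hK : ∀ a ∈ K, -a ∈ K) (hKpos : 0 < #K) (hSpos : 0 < #S)
    (hinv : NearlyInvariant K S κ) (hκ : 2 * κ ≤ ξ)
    (hY : ∀ s ∈ S, ∀ k ∈ K, s - k ∈ Y) (hg : ∀ n, |g n| ≤ 1) (hYK : (#Y : ℝ) ≤ 2 * #K)
    (hω : 0 ≤ ω) (hξ : 0 ≤ ξ) (hξ4 : 2 * (α ^ 2 + ω) ≤ ξ ^ 4) : Pseudorandom K S g ξ := by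
  have hloc := h.sum_abs_sum_le hK hKpos hY hg hYK hω hξ hξ4
  refine ⟨fun w e hw he => h.sum_abs_correlation_le hK hY hg hYK hω hξ hξ4 hw he, hloc, ?_⟩
  have hS : (0 : ℝ) < #S := by exact_mod_cast hSpos
  have h1 : ∑ b ∈ K, ∑ s ∈ S, g (s - b) = ∑ s ∈ S, ∑ b ∈ K, g (b + s) := by
    rw [Finset.sum_comm]
    refine Finset.sum_congr rfl fun s _ => ?_
    refine Finset.sum_nbij' (fun b => -b) (fun b => -b) hK hK (by simp) (by simp) fun b _ => ?_
    congr 1; ring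
  have h2 : |∑ s ∈ S, (∑ b ∈ K, g (b + s) - ∑ b ∈ K, g b)| ≤ #S * (2 * κ * #K) := by
    refine (Finset.abs_sum_le_sum_abs _ _).trans ?_
    refine (Finset.sum_le_card_nsmul S _ (2 * κ * #K) fun s hs => ?_).trans (by simp)
    have := hinv.norm_sum_translate_sub_le hs g (C := 1) hg
    rw [mul_one] at this
    exact this
  rw [Finset.sum_sub_distrib, ← h1, Finset.sum_const, nsmul_eq_mul] at h2
  have h3 : |∑ b ∈ K, ∑ s ∈ S, g (s - b)| ≤ ξ * #K * #S :=
    (Finset.abs_sum_le_sum_abs _ _).trans hloc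
  have h4 : |(#S : ℝ) * ∑ b ∈ K, g b| ≤ #S * (2 * ξ * #K) := by
    have h5 : (2 * κ) * (#S * #K : ℝ) ≤ ξ * (#S * #K) := by gcongr
    rw [abs_le] at *
    constructor <;> linarith [h2.1, h2.2, h3.1, h3.2]
  rw [abs_mul, abs_of_pos hS] at h4
  exact le_of_mul_le_mul_left h4 hS

section Weights

variable {K S : Finset ℤ} {e₁ e₂ : ℤ → ℝ} {β₁ β₂ ξ : ℝ}

theorem sum_eq_of_mean (h : |∑ b ∈ K, (e₁ b - β₁)| ≤ 2 * ξ * #K) :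
    ∑ b ∈ K, e₁ b ≤ (β₁ + 2 * ξ) * #K ∧ (β₁ - 2 * ξ) * #K ≤ ∑ b ∈ K, e₁ b := by
  rw [Finset.sum_sub_distrib, Finset.sum_const, nsmul_eq_mul, abs_le] at h
  constructor <;> linarith [h.1, h.2]

/-- The total weight `P` in the first application of Cauchy–Schwarz in `cornerSum_pow_four_le`; it also
bounds the strip sum of a set with sides `e₁`, `e₂`. -/
theorem Pseudorandom.sum_mul_le (he₁ : ∀ n, 0 ≤ e₁ n) (he₁' : ∀ n, e₁ n ≤ 1)
    (hβ₂ : 0 ≤ β₂) (hβ₂' : β₂ ≤ 1) (hξ : 0 ≤ ξ)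
    (h₁ : Pseudorandom K S (fun n => e₁ n - β₁) ξ) (h₂ : Pseudorandom K S (fun n => e₂ n - β₂) ξ) :
    ∑ a ∈ K, ∑ r ∈ S, e₁ a * e₂ (r - a) ≤ (β₁ * β₂ + 3 * ξ) * #K * #S := by
  have h3 : ∀ a ∈ K, ∑ r ∈ S, e₁ a * e₂ (r - a)
      ≤ β₂ * #S * e₁ a + |∑ r ∈ S, (e₂ (r - a) - β₂)| := by
    intro a _
    rw [← Finset.mul_sum]
    have e : ∑ r ∈ S, e₂ (r - a) = β₂ * #S + ∑ r ∈ S, (e₂ (r - a) - β₂) := by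
      rw [Finset.sum_sub_distrib, Finset.sum_const, nsmul_eq_mul]; ring
    rw [e, mul_add]
    have h4 : e₁ a * ∑ r ∈ S, (e₂ (r - a) - β₂) ≤ 1 * |∑ r ∈ S, (e₂ (r - a) - β₂)| :=
      (mul_le_mul_of_nonneg_left (le_abs_self _) (he₁ a)).trans
        (mul_le_mul_of_nonneg_right (he₁' a) (abs_nonneg _))
    linarith
  refine (Finset.sum_le_sum h3).trans ?_
  rw [Finset.sum_add_distrib, ← Finset.mul_sum]
  have h5 := (sum_eq_of_mean h₁.mean).1
  have h6 := h₂.local_sum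
  have h7 : β₂ * #S * ∑ a ∈ K, e₁ a ≤ β₂ * #S * ((β₁ + 2 * ξ) * #K) := by gcongr
  have h8 : β₂ * (ξ * #S * #K) ≤ 1 * (ξ * #S * #K) := by gcongr
  linarith

/-- The total weight `Q` in the second application of Cauchy–Schwarz in `cornerSum_pow_four_le`. -/
theorem Pseudorandom.sum_weight_le (he₁ : ∀ n, 0 ≤ e₁ n) (he₁' : ∀ n, e₁ n ≤ 1)
    (he₂ : ∀ n, 0 ≤ e₂ n) (he₂' : ∀ n, e₂ n ≤ 1) (hβ₁ : 0 ≤ β₁) (hβ₁' : β₁ ≤ 1) (hβ₂ : 0 ≤ β₂)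
    (hβ₂' : β₂ ≤ 1) (hξ : 0 ≤ ξ) (hξ1 : ξ ≤ 1)
    (h₁ : Pseudorandom K S (fun n => e₁ n - β₁) ξ) (h₂ : Pseudorandom K S (fun n => e₂ n - β₂) ξ) :
    ∑ b ∈ K, ∑ b' ∈ K, ∑ r ∈ S, e₁ (r - b) * e₁ (r - b') * (e₂ b * e₂ b')
      ≤ ((β₁ * β₂) ^ 2 + 10 * ξ) * (#K : ℝ) ^ 2 * #S := by
  have hpt : ∀ b ∈ K, ∀ b' ∈ K, ∑ r ∈ S, e₁ (r - b) * e₁ (r - b') * (e₂ b * e₂ b')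
      ≤ β₁ ^ 2 * #S * (e₂ b * e₂ b') + |∑ r ∈ S, (e₁ (r - b') - β₁)|
        + |∑ r ∈ S, (e₁ (r - b) - β₁) * 1 * e₁ (r - b')| := by
    intro b _ b' _
    have e : ∑ r ∈ S, e₁ (r - b) * e₁ (r - b') = β₁ ^ 2 * #S
        + β₁ * ∑ r ∈ S, (e₁ (r - b') - β₁) + ∑ r ∈ S, (e₁ (r - b) - β₁) * 1 * e₁ (r - b') := by
      have : β₁ ^ 2 * (#S : ℝ) = ∑ r ∈ S, β₁ ^ 2 := by simp [mul_comm]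
      rw [this, Finset.mul_sum, ← Finset.sum_add_distrib, ← Finset.sum_add_distrib]
      exact Finset.sum_congr rfl fun r _ => by ring
    rw [← Finset.sum_mul, e, add_mul, add_mul]
    have hw0 : 0 ≤ e₂ b * e₂ b' := mul_nonneg (he₂ b) (he₂ b')
    have hw1 : e₂ b * e₂ b' ≤ 1 := mul_le_one₀ (he₂' b) (he₂ b') (he₂' b')
    have k : ∀ x y : ℝ, 0 ≤ y → y ≤ 1 → x * y ≤ |x| := fun x y h0 h1 =>
      (mul_le_mul_of_nonneg_right (le_abs_self x) h0).trans
        (mul_le_of_le_one_right (abs_nonneg x) h1)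
    have k1 := k (∑ r ∈ S, (e₁ (r - b') - β₁)) (β₁ * (e₂ b * e₂ b')) (by positivity)
      (mul_le_one₀ hβ₁' hw0 hw1)
    have k2 := k (∑ r ∈ S, (e₁ (r - b) - β₁) * 1 * e₁ (r - b')) _ hw0 hw1
    linarith
  refine (Finset.sum_le_sum fun b hb => Finset.sum_le_sum fun b' hb' => hpt b hb b' hb').trans ?_
  simp only [Finset.sum_add_distrib]
  have c1 : ∑ b ∈ K, ∑ b' ∈ K, β₁ ^ 2 * #S * (e₂ b * e₂ b')
      = β₁ ^ 2 * #S * (∑ b ∈ K, e₂ b) ^ 2 := by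
    rw [sq (∑ b ∈ K, e₂ b), Finset.sum_mul_sum, Finset.mul_sum]
    simp_rw [Finset.mul_sum]
  have c2 := h₁.local_sum
  have c3 := h₁.correlation 1 e₁ (by simp) (fun n => by rw [abs_of_nonneg (he₁ n)]; exact he₁' n)
  have c4 := (sum_eq_of_mean h₂.mean).1
  have c5 : (∑ b ∈ K, e₂ b) ^ 2 ≤ ((β₂ + 2 * ξ) * #K) ^ 2 := by
    have : 0 ≤ ∑ b ∈ K, e₂ b := Finset.sum_nonneg fun b _ => he₂ b
    gcongr
  rw [c1, Finset.sum_const, nsmul_eq_mul]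
  have c6 : (#K : ℝ) * ∑ b ∈ K, |∑ s ∈ S, (e₁ (s - b) - β₁)| ≤ #K * (ξ * #K * #S) := by gcongr
  have c7 : β₁ ^ 2 * #S * (∑ b ∈ K, e₂ b) ^ 2
      ≤ ((β₁ * β₂) ^ 2 + 8 * ξ) * (#K : ℝ) ^ 2 * #S := by
    calc β₁ ^ 2 * #S * (∑ b ∈ K, e₂ b) ^ 2 ≤ β₁ ^ 2 * #S * ((β₂ + 2 * ξ) * #K) ^ 2 := by gcongr
      _ = (β₁ ^ 2 * (β₂ + 2 * ξ) ^ 2) * ((#K : ℝ) ^ 2 * #S) := by ring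
      _ ≤ ((β₁ * β₂) ^ 2 + 8 * ξ) * ((#K : ℝ) ^ 2 * #S) := by
        gcongr
        have : β₁ ^ 2 ≤ 1 := pow_le_one₀ hβ₁ hβ₁'
        have h8 : β₁ ^ 2 * (4 * ξ * β₂ + 4 * ξ ^ 2) ≤ 1 * (4 * ξ * 1 + 4 * (ξ * 1)) := by
          gcongr
          rw [sq]; gcongr
        nlinarith
      _ = _ := by ring
  simp only [Pi.one_apply] at c3
  linarith

/-- The weight produced by the Cauchy–Schwarz argument is nearly constant on average. -/
theorem Pseudorandom.sum_abs_weight_sub_le (he₁ : ∀ n, 0 ≤ e₁ n) (he₁' : ∀ n, e₁ n ≤ 1)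
    (he₂ : ∀ n, 0 ≤ e₂ n) (he₂' : ∀ n, e₂ n ≤ 1) (hβ₁ : 0 ≤ β₁) (hβ₁' : β₁ ≤ 1) (hβ₂ : 0 ≤ β₂)
    (hβ₂' : β₂ ≤ 1)
    (h₁ : Pseudorandom K S (fun n => e₁ n - β₁) ξ) (h₂ : Pseudorandom K S (fun n => e₂ n - β₂) ξ) :
    ∑ a ∈ K, ∑ a' ∈ K, ∑ b ∈ K, ∑ b' ∈ K,
      |∑ r ∈ S, e₁ (r - b) * e₁ (r - b') * (e₂ (r - a) * e₂ (r - a')) - (β₁ * β₂) ^ 2 * #S|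
      ≤ 4 * ξ * (#K : ℝ) ^ 4 * #S := by
  have a₁ : ∀ n, |e₁ n| ≤ 1 := fun n => by rw [abs_of_nonneg (he₁ n)]; exact he₁' n
  have a₂ : ∀ n, |e₂ n| ≤ 1 := fun n => by rw [abs_of_nonneg (he₂ n)]; exact he₂' n
  have b₁ : |β₁| ≤ 1 := by rwa [abs_of_nonneg hβ₁]
  have b₂ : |β₂| ≤ 1 := by rwa [abs_of_nonneg hβ₂]
  -- the four terms of the telescoping sum replacing one factor at a time by its average
  set t₁ : ℤ → ℤ → ℤ → ℤ → ℝ := fun a a' b b' =>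
    |∑ r ∈ S, (e₁ (r - b) - β₁) * (e₂ (r - a) * e₂ (r - a')) * e₁ (r - b')| with ht₁
  set t₂ : ℤ → ℤ → ℤ → ℤ → ℝ := fun a a' _ b' =>
    |∑ r ∈ S, (e₁ (r - b') - β₁) * (β₁ * e₂ (r - a')) * e₂ (r - a)| with ht₂
  set t₃ : ℤ → ℤ → ℤ → ℤ → ℝ := fun a a' _ _ =>
    |∑ r ∈ S, (e₂ (r - a) - β₂) * (β₁ ^ 2) * e₂ (r - a')| with ht₃
  set t₄ : ℤ → ℤ → ℤ → ℤ → ℝ := fun a a' _ _ =>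
    |∑ r ∈ S, (e₂ (r - a') - β₂) * (β₁ ^ 2 * β₂) * 1| with ht₄
  have hpt : ∀ a a' b b' : ℤ,
      |∑ r ∈ S, e₁ (r - b) * e₁ (r - b') * (e₂ (r - a) * e₂ (r - a')) - (β₁ * β₂) ^ 2 * #S|
      ≤ t₁ a a' b b' + t₂ a a' b b' + t₃ a a' b b' + t₄ a a' b b' := by
    intro a a' b b'
    have e : ∑ r ∈ S, e₁ (r - b) * e₁ (r - b') * (e₂ (r - a) * e₂ (r - a')) - (β₁ * β₂) ^ 2 * #S
        = ∑ r ∈ S, (e₁ (r - b) - β₁) * (e₂ (r - a) * e₂ (r - a')) * e₁ (r - b')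
          + ∑ r ∈ S, (e₁ (r - b') - β₁) * (β₁ * e₂ (r - a')) * e₂ (r - a)
          + ∑ r ∈ S, (e₂ (r - a) - β₂) * (β₁ ^ 2) * e₂ (r - a')
          + ∑ r ∈ S, (e₂ (r - a') - β₂) * (β₁ ^ 2 * β₂) * 1 := by
      have : (β₁ * β₂) ^ 2 * (#S : ℝ) = ∑ r ∈ S, (β₁ * β₂) ^ 2 := by simp [mul_comm]
      rw [this, ← Finset.sum_sub_distrib, ← Finset.sum_add_distrib, ← Finset.sum_add_distrib,
        ← Finset.sum_add_distrib]
      exact Finset.sum_congr rfl fun r _ => by ring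
    rw [e]
    refine (abs_add_le _ _).trans (add_le_add ((abs_add_le _ _).trans (add_le_add
      (abs_add_le _ _) le_rfl)) le_rfl)
  refine (Finset.sum_le_sum fun a _ => Finset.sum_le_sum fun a' _ => Finset.sum_le_sum fun b _ =>
    Finset.sum_le_sum fun b' _ => hpt a a' b b').trans ?_
  simp only [Finset.sum_add_distrib]
  have bound : ∀ F : ℤ → ℤ → ℝ, (∀ x ∈ K, ∀ y ∈ K, F x y ≤ ξ * (#K : ℝ) ^ 2 * #S) →
      ∑ x ∈ K, ∑ y ∈ K, F x y ≤ ξ * (#K : ℝ) ^ 4 * #S := by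
    intro F hF
    refine (Finset.sum_le_sum fun x hx => Finset.sum_le_card_nsmul K _ _ (hF x hx)).trans ?_
    simp only [Finset.sum_const, nsmul_eq_mul]
    exact le_of_eq (by ring)
  have h1 : ∑ a ∈ K, ∑ a' ∈ K, ∑ b ∈ K, ∑ b' ∈ K, t₁ a a' b b' ≤ ξ * (#K : ℝ) ^ 4 * #S := by
    refine bound _ fun a _ a' _ => ?_
    refine h₁.correlation (fun r => e₂ (r - a) * e₂ (r - a')) e₁ (fun n => ?_) a₁
    rw [abs_mul]; exact mul_le_one₀ (a₂ _) (abs_nonneg _) (a₂ _)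
  have h2 : ∑ a ∈ K, ∑ a' ∈ K, ∑ b ∈ K, ∑ b' ∈ K, t₂ a a' b b' ≤ ξ * (#K : ℝ) ^ 4 * #S := by
    have : ∑ a ∈ K, ∑ a' ∈ K, ∑ b ∈ K, ∑ b' ∈ K, t₂ a a' b b'
        = ∑ a' ∈ K, ∑ b ∈ K, ∑ b' ∈ K, ∑ a ∈ K, t₂ a a' b b' := by
      rw [Finset.sum_comm]
      refine Finset.sum_congr rfl fun a' _ => ?_
      rw [Finset.sum_comm]
      exact Finset.sum_congr rfl fun b _ => Finset.sum_comm
    rw [this]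
    refine bound _ fun a' _ b _ => ?_
    refine h₁.correlation (fun r => β₁ * e₂ (r - a')) e₂ (fun n => ?_) a₂
    rw [abs_mul]; exact mul_le_one₀ b₁ (abs_nonneg _) (a₂ _)
  have h3 : ∑ a ∈ K, ∑ a' ∈ K, ∑ b ∈ K, ∑ b' ∈ K, t₃ a a' b b' ≤ ξ * (#K : ℝ) ^ 4 * #S := by
    have h := h₂.correlation (fun _ => β₁ ^ 2) e₂ (fun n => by
      rw [abs_pow]; exact pow_le_one₀ (abs_nonneg _) b₁) a₂
    simp only [ht₃, Finset.sum_const, nsmul_eq_mul, ← Finset.mul_sum]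
    have h' := mul_le_mul_of_nonneg_left h (by positivity : (0 : ℝ) ≤ (#K : ℝ) ^ 2)
    linarith
  have h4 : ∑ a ∈ K, ∑ a' ∈ K, ∑ b ∈ K, ∑ b' ∈ K, t₄ a a' b b' ≤ ξ * (#K : ℝ) ^ 4 * #S := by
    have h := h₂.correlation (fun _ => β₁ ^ 2 * β₂) 1 (fun n => by
      rw [abs_mul, abs_pow]
      exact mul_le_one₀ (pow_le_one₀ (abs_nonneg _) b₁) (abs_nonneg _) b₂) (by simp)
    rw [Finset.sum_comm] at h
    simp only [ht₄, Finset.sum_const, nsmul_eq_mul, ← Finset.mul_sum]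
    simp only [Finset.sum_const, nsmul_eq_mul, Pi.one_apply] at h
    have h' := mul_le_mul_of_nonneg_left h (by positivity : (0 : ℝ) ≤ (#K : ℝ) ^ 2)
    linarith
  linarith

end Weights

/-- The number of points of `A`, recentred at a cell, that lie on the antidiagonals `x + y = r` with
`r ∈ S`, both coordinates being in `K`. -/
def stripSum (K S : Finset ℤ) (A : ℤ → ℤ → ℝ) : ℝ :=
  ∑ r ∈ S, ∑ x ∈ K with x - r ∈ K, A x (r - x)

/-- The main term: two points of `A` on one antidiagonal span a corner, so that the
Cauchy–Schwarz inequality bounds their number from below. -/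
theorem stripSum_sq_le (K S : Finset ℤ) (hK : ∀ a ∈ K, -a ∈ K) {A : ℤ → ℤ → ℝ}
    (hA0 : ∀ x y, 0 ≤ A x y) :
    stripSum K S A ^ 2 ≤ #S * ∑ a ∈ K, ∑ b ∈ K, ∑ r ∈ S, A (r - b) b * A a (r - a) := by
  have h1 : ∑ a ∈ K, ∑ b ∈ K, ∑ r ∈ S, A (r - b) b * A a (r - a)
      = ∑ r ∈ S, (∑ b ∈ K, A (r - b) b) * ∑ a ∈ K, A a (r - a) := by
    simp_rw [Finset.sum_mul_sum]
    simp_rw [Finset.sum_comm (s := K) (t := S)]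
    exact Finset.sum_congr rfl fun r _ => Finset.sum_comm
  rw [h1, stripSum]
  refine sq_sum_le_card_mul_sum_sq.trans ?_
  refine mul_le_mul_of_nonneg_left (Finset.sum_le_sum fun r _ => ?_) (Nat.cast_nonneg _)
  rw [sq]
  have h0 : 0 ≤ ∑ x ∈ K with x - r ∈ K, A x (r - x) := Finset.sum_nonneg fun _ _ => hA0 _ _
  refine mul_le_mul ?_ ?_ h0 (Finset.sum_nonneg fun _ _ => hA0 _ _)
  · rw [← Finset.sum_image (f := fun b => A (r - b) b) (g := fun x => r - x)
      (s := {x ∈ K | x - r ∈ K}) (fun a _ b _ h => by simpa using h) |>.trans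
      (Finset.sum_congr rfl fun x _ => by rw [sub_sub_cancel])]
    refine Finset.sum_le_sum_of_subset_of_nonneg ?_ fun _ _ _ => hA0 _ _
    intro b hb
    obtain ⟨x, hx, rfl⟩ := Finset.mem_image.1 hb
    have := hK _ (Finset.mem_filter.1 hx).2
    rwa [neg_sub] at this
  · exact Finset.sum_le_sum_of_subset_of_nonneg (Finset.filter_subset _ _) fun _ _ _ => hA0 _ _

/-- In a corner-free set only the trivial corners are counted. -/
theorem cornerSum_le_of_cornerFree (K S : Finset ℤ) {A : ℤ → ℤ → ℝ}
    (hA : ∀ x y, A x y = 0 ∨ A x y = 1)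
    (hfree : ∀ x y d, A x y = 1 → A (x + d) y = 1 → A x (y + d) = 1 → d = 0) :
    ∑ a ∈ K, ∑ b ∈ K, ∑ r ∈ S, A a b * A (r - b) b * A a (r - a) ≤ #K * #S := by
  have hpt : ∀ a b r, A a b * A (r - b) b * A a (r - a) ≤ if b = r - a then 1 else 0 := by
    intro a b r
    have l : ∀ x y, 0 ≤ A x y ∧ A x y ≤ 1 := fun x y => by rcases hA x y with h | h <;> simp [h]
    split_ifs with hb
    · exact mul_le_one₀ (mul_le_one₀ (l _ _).2 (l _ _).1 (l _ _).2) (l _ _).1 (l _ _).2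
    · rcases hA a b with h1 | h1 <;> rcases hA (r - b) b with h2 | h2 <;>
        rcases hA a (r - a) with h3 | h3 <;> simp only [h1, h2, h3] <;> norm_num
      have := hfree a b (r - a - b) h1 (by rw [← h2]; congr 1; ring) (by rw [← h3]; congr 1; ring)
      exact absurd (by linarith) hb
  calc _ ≤ ∑ a ∈ K, ∑ b ∈ K, ∑ r ∈ S, (if b = r - a then (1 : ℝ) else 0) :=
        Finset.sum_le_sum fun a _ => Finset.sum_le_sum fun b _ => Finset.sum_le_sum fun r _ =>
          hpt a b r
    _ = ∑ a ∈ K, ∑ r ∈ S, ∑ b ∈ K, (if b = r - a then (1 : ℝ) else 0) :=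
        Finset.sum_congr rfl fun a _ => Finset.sum_comm
    _ ≤ ∑ a ∈ K, ∑ r ∈ S, (1 : ℝ) := by
        refine Finset.sum_le_sum fun a _ => Finset.sum_le_sum fun r _ => ?_
        rw [Finset.sum_ite_eq']
        split_ifs <;> norm_num
    _ = _ := by simp

/-- For indicator functions `e₁`, `e₂`, the box sum of the balanced function of `A` over the whole cell
is the one over the sides of the rectangle, on which the balancing term is constant. -/
theorem boxSum_filter_eq (K : Finset ℤ) {e₁ e₂ : ℤ → ℝ} {A : ℤ → ℤ → ℝ} {δ : ℝ}
    (he₁ : ∀ n, e₁ n = 0 ∨ e₁ n = 1) (he₂ : ∀ n, e₂ n = 0 ∨ e₂ n = 1)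
    (hA : ∀ x y, A x y = 0 ∨ A x y = 1) (hAe : ∀ x y, A x y ≤ e₁ x * e₂ y) :
    boxSum {a ∈ K | e₁ a = 1} {b ∈ K | e₂ b = 1} (fun x y => A x y - δ)
      = boxSum K K (fun x y => A x y - δ * (e₁ x * e₂ y)) := by
  have h0 : ∀ x y, e₁ x = 0 ∨ e₂ y = 0 → A x y - δ * (e₁ x * e₂ y) = 0 := by
    intro x y h
    have h1 := hAe x y
    have h2 : e₁ x * e₂ y = 0 := by rcases h with h | h <;> simp [h]
    rw [h2] at h1 ⊢
    rcases hA x y with h3 | h3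
    · rw [h3]; ring
    · rw [h3] at h1; norm_num at h1
  simp only [boxSum, Finset.sum_filter]
  refine Finset.sum_congr rfl fun a _ => ?_
  rcases he₁ a with ha | ha
  · rw [if_neg (by rw [ha]; norm_num)]
    symm
    refine Finset.sum_eq_zero fun a' _ => Finset.sum_eq_zero fun b _ =>
      Finset.sum_eq_zero fun b' _ => ?_
    rw [h0 a b (Or.inl ha)]; ring
  rw [if_pos ha]
  refine Finset.sum_congr rfl fun a' _ => ?_
  rcases he₁ a' with ha' | ha'
  · rw [if_neg (by rw [ha']; norm_num)]
    symm
    refine Finset.sum_eq_zero fun b _ => Finset.sum_eq_zero fun b' _ => ?_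
    rw [h0 a' b (Or.inl ha')]; ring
  rw [if_pos ha']
  refine Finset.sum_congr rfl fun b _ => ?_
  rcases he₂ b with hb | hb
  · rw [if_neg (by rw [hb]; norm_num)]
    symm
    refine Finset.sum_eq_zero fun b' _ => ?_
    rw [h0 a b (Or.inr hb)]; ring
  rw [if_pos hb]
  refine Finset.sum_congr rfl fun b' _ => ?_
  rcases he₂ b' with hb' | hb'
  · rw [if_neg (by rw [hb']; norm_num), h0 a b' (Or.inr hb')]; ring
  rw [if_pos hb', ha, ha', hb, hb']; ring

theorem card_filter_eq_one {K : Finset ℤ} {e : ℤ → ℝ} (he : ∀ n, e n = 0 ∨ e n = 1) :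
    (#{a ∈ K | e a = 1} : ℝ) = ∑ a ∈ K, e a := by
  rw [Finset.card_filter]
  push_cast
  refine Finset.sum_congr rfl fun a _ => ?_
  rcases he a with h | h <;> simp [h]

/-- Both sets have nearly the expected number of elements in a pseudorandom cell. -/
theorem Pseudorandom.card_mul_card_bounds {K S : Finset ℤ} {e₁ e₂ : ℤ → ℝ} {β₁ β₂ ξ : ℝ}
    (he₁ : ∀ n, e₁ n = 0 ∨ e₁ n = 1) (he₂ : ∀ n, e₂ n = 0 ∨ e₂ n = 1)
    (hβ₁ : 0 < β₁) (hβ₁' : β₁ ≤ 1) (hβ₂ : 0 < β₂) (hβ₂' : β₂ ≤ 1) (hξ : 0 ≤ ξ)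
    (hξβ : 64 * ξ ≤ (β₁ * β₂) ^ 2)
    (h₁ : Pseudorandom K S (fun n => e₁ n - β₁) ξ) (h₂ : Pseudorandom K S (fun n => e₂ n - β₂) ξ) :
    (#{a ∈ K | e₁ a = 1} : ℝ) * #{b ∈ K | e₂ b = 1} ≤ (β₁ * β₂ + 8 * ξ) * (#K : ℝ) ^ 2 ∧
      (β₁ * β₂ - 8 * ξ) * (#K : ℝ) ^ 2 ≤ (#{a ∈ K | e₁ a = 1} : ℝ) * #{b ∈ K | e₂ b = 1} := by
  rw [card_filter_eq_one he₁, card_filter_eq_one he₂]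
  obtain ⟨u1, l1⟩ := sum_eq_of_mean h₁.mean
  obtain ⟨u2, l2⟩ := sum_eq_of_mean h₂.mean
  set s₁ := ∑ a ∈ K, e₁ a
  set s₂ := ∑ a ∈ K, e₂ a
  have hβ : (β₁ * β₂) ^ 2 ≤ β₁ * β₂ := by
    have : β₁ * β₂ ≤ 1 := mul_le_one₀ hβ₁' hβ₂.le hβ₂'
    nlinarith [mul_pos hβ₁ hβ₂]
  have hb1 : β₁ * β₂ ≤ β₁ := mul_le_of_le_one_right hβ₁.le hβ₂'
  have hb2 : β₁ * β₂ ≤ β₂ := mul_le_of_le_one_left hβ₂.le hβ₁'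
  have hK : (0 : ℝ) ≤ #K := Nat.cast_nonneg _
  have n1 : 0 ≤ (β₁ - 2 * ξ) * #K := mul_nonneg (by linarith) hK
  have n2 : 0 ≤ (β₂ - 2 * ξ) * #K := mul_nonneg (by linarith) hK
  have s2 : 0 ≤ s₂ := n2.trans l2
  constructor
  · calc s₁ * s₂ ≤ ((β₁ + 2 * ξ) * #K) * ((β₂ + 2 * ξ) * #K) :=
          mul_le_mul u1 u2 s2 (mul_nonneg (by linarith) hK)
      _ = ((β₁ + 2 * ξ) * (β₂ + 2 * ξ)) * (#K : ℝ) ^ 2 := by ring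
      _ ≤ _ := by
        refine mul_le_mul_of_nonneg_right ?_ (by positivity)
        nlinarith
  · calc (β₁ * β₂ - 8 * ξ) * (#K : ℝ) ^ 2 ≤ ((β₁ - 2 * ξ) * (β₂ - 2 * ξ)) * (#K : ℝ) ^ 2 := by
          refine mul_le_mul_of_nonneg_right ?_ (by positivity)
          nlinarith [sq_nonneg ξ]
      _ = ((β₁ - 2 * ξ) * #K) * ((β₂ - 2 * ξ) * #K) := by ring
      _ ≤ s₁ * s₂ := mul_le_mul l1 l2 n2 (n1.trans l1)

/-- The numerical conclusion of the Cauchy–Schwarz argument; `k = |K|`, `s = |S|`. -/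
theorem boxSum_lower_of_bounds {k s β δ ξ P Q R B : ℝ} (hk : 0 < k) (hs : 0 < s) (hβ : 0 < β)
    (hδ : 0 < δ) (hξ : 0 ≤ ξ) (hξs : 2 ^ 20 * ξ ≤ δ ^ 12 * β ^ 4) (hξβ : 2 ^ 20 * ξ ≤ β ^ 2)
    (hβ2 : β ^ 2 ≤ β) (hP0 : 0 ≤ P) (hQ0 : 0 ≤ Q) (hP : P ≤ (β + 3 * ξ) * k * s)
    (hQ : Q ≤ (β ^ 2 + 10 * ξ) * k ^ 2 * s) (hR : R ≤ β ^ 2 * s * B + 4 * ξ * k ^ 4 * s)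
    (hT : (δ ^ 3 * β ^ 2 / 8 * (k ^ 2 * s)) ^ 4 ≤ P ^ 2 * Q * R) :
    δ ^ 12 * β ^ 2 / 2 ^ 16 * k ^ 4 ≤ B := by
  have hPle : P ≤ 2 * β * (k * s) := by
    refine hP.trans ?_
    rw [mul_assoc]
    refine mul_le_mul_of_nonneg_right ?_ (by positivity)
    linarith
  have hQle : Q ≤ 2 * β ^ 2 * (k ^ 2 * s) := by
    refine hQ.trans ?_
    rw [mul_assoc]
    refine mul_le_mul_of_nonneg_right ?_ (by positivity)
    linarith
  have h1 : 0 < P ^ 2 * Q * R := lt_of_lt_of_le (by positivity) hT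
  have hPQ : 0 ≤ P ^ 2 * Q := by positivity
  have hRpos : 0 < R := by
    by_contra h
    exact absurd h1 (not_lt.2 (mul_nonpos_of_nonneg_of_nonpos hPQ (not_lt.1 h)))
  have h2 : P ^ 2 * Q * R ≤ (2 * β * (k * s)) ^ 2 * (2 * β ^ 2 * (k ^ 2 * s)) *
      (β ^ 2 * s * B + 4 * ξ * k ^ 4 * s) := by
    refine mul_le_mul ?_ hR hRpos.le (by positivity)
    exact mul_le_mul (by gcongr) hQle hQ0 (by positivity)
  have h3 := hT.trans h2
  -- cancel the common positive factor `8 β ^ 4 k ^ 4 s ^ 4`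
  have h4 : (8 * β ^ 4 * k ^ 4 * s ^ 4) * (δ ^ 12 * β ^ 4 / 2 ^ 15 * k ^ 4) ≤
      (8 * β ^ 4 * k ^ 4 * s ^ 4) * (β ^ 2 * B + 4 * ξ * k ^ 4) := by
    refine le_trans (le_of_eq ?_) (h3.trans (le_of_eq ?_)) <;> ring
  have h5 := le_of_mul_le_mul_left h4 (by positivity)
  have h6 : 2 ^ 20 * ξ * k ^ 4 ≤ δ ^ 12 * β ^ 4 * k ^ 4 := by gcongr
  have h7 : β ^ 2 * (δ ^ 12 * β ^ 2 / 2 ^ 16 * k ^ 4) ≤ β ^ 2 * B := by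
    have : 0 ≤ δ ^ 12 * β ^ 4 * k ^ 4 := by positivity
    linarith
  exact le_of_mul_le_mul_left h7 (by positivity)

/-- The conclusion of `exists_subrectangle_of_boxSum` with the box sum normalized by the cell, of side
`k`, instead of by the rectangle, whose relative density is about `β`. -/
theorem exists_increment_of_boxSum {X Y : Finset ℤ} {A : ℤ → ℤ → ℝ} {k β δ ξ : ℝ}
    (hA : ∀ x y, A x y = 0 ∨ A x y = 1) (hδ : 0 < δ) (hδ1 : δ ≤ 1) (hβ : 0 < β) (hξ : 0 ≤ ξ)
    (hξβ : 64 * ξ ≤ β) (hXY : (#X : ℝ) * #Y ≤ (β + 8 * ξ) * k ^ 2)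
    (hbig : δ ^ 12 * β ^ 2 / 2 ^ 16 * k ^ 4 ≤ boxSum X Y fun x y => A x y - δ)
    (hmean : |∑ a ∈ X, ∑ b ∈ Y, (A a b - δ)| ≤ δ ^ 12 / 2 ^ 20 * (#X * #Y)) :
    ∃ U ⊆ X, ∃ V ⊆ Y, δ ^ 12 / 2 ^ 22 * (#X * #Y) ≤ ∑ a ∈ U, ∑ b ∈ V, (A a b - δ) := by
  have hXYle : ((#X : ℝ) * #Y) ^ 2 ≤ 2 * β ^ 2 * k ^ 4 := by
    have h1 : (β + 8 * ξ) ^ 2 ≤ 2 * β ^ 2 := by nlinarith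
    calc ((#X : ℝ) * #Y) ^ 2 ≤ ((β + 8 * ξ) * k ^ 2) ^ 2 := by gcongr
      _ = (β + 8 * ξ) ^ 2 * k ^ 4 := by ring
      _ ≤ _ := by gcongr
  have hbox : δ ^ 12 / 2 ^ 17 * (#X : ℝ) ^ 2 * (#Y : ℝ) ^ 2 ≤ boxSum X Y fun x y => A x y - δ := by
    refine le_trans ?_ hbig
    calc δ ^ 12 / 2 ^ 17 * (#X : ℝ) ^ 2 * (#Y : ℝ) ^ 2 = δ ^ 12 / 2 ^ 17 * ((#X : ℝ) * #Y) ^ 2 := by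
          ring
      _ ≤ δ ^ 12 / 2 ^ 17 * (2 * β ^ 2 * k ^ 4) := by gcongr
      _ = _ := by ring
  obtain ⟨U, hU, V, hV, hUV⟩ := exists_subrectangle_of_boxSum hA hδ.le hδ1 (by positivity) hbox
    (hmean.trans (le_of_eq (by ring)))
  refine ⟨U, hU, V, hV, le_trans ?_ hUV⟩
  have : 0 ≤ δ ^ 12 * ((#X : ℝ) * #Y) := by positivity
  linarith

set_option maxHeartbeats 400000 in
/-- In a pseudorandom cell in which a corner-free set has density close to `δ` and many points on the
central antidiagonals, some subrectangle of the cell carries a density increment. -/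
theorem exists_increment_of_pseudorandom {K S : Finset ℤ} {e₁ e₂ : ℤ → ℝ} {A : ℤ → ℤ → ℝ}
    {β₁ β₂ δ ξ : ℝ} (hK : ∀ a ∈ K, -a ∈ K) (hSpos : 0 < #S)
    (he₁ : ∀ n, e₁ n = 0 ∨ e₁ n = 1) (he₂ : ∀ n, e₂ n = 0 ∨ e₂ n = 1)
    (hA : ∀ x y, A x y = 0 ∨ A x y = 1) (hAe : ∀ x y, A x y ≤ e₁ x * e₂ y)
    (hfree : ∀ x y d, A x y = 1 → A (x + d) y = 1 → A x (y + d) = 1 → d = 0)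
    (hβ₁ : 0 < β₁) (hβ₁' : β₁ ≤ 1) (hβ₂ : 0 < β₂) (hβ₂' : β₂ ≤ 1) (hδ : 0 < δ) (hδ1 : δ ≤ 1)
    (hξ : 0 ≤ ξ) (hξs : 2 ^ 20 * ξ ≤ δ ^ 12 * (β₁ * β₂) ^ 4)
    (h₁ : Pseudorandom K S (fun n => e₁ n - β₁) ξ) (h₂ : Pseudorandom K S (fun n => e₂ n - β₂) ξ)
    (hKlarge : 8 ≤ δ ^ 3 * (β₁ * β₂) ^ 2 * #K)
    (hstrip : δ * (β₁ * β₂) / 2 * (#K * #S) ≤ stripSum K S A)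
    (hmean : |∑ a ∈ K with e₁ a = 1, ∑ b ∈ K with e₂ b = 1, (A a b - δ)|
      ≤ δ ^ 12 / 2 ^ 20 * (#{a ∈ K | e₁ a = 1} * #{b ∈ K | e₂ b = 1})) :
    ∃ U ⊆ {a ∈ K | e₁ a = 1}, ∃ V ⊆ {b ∈ K | e₂ b = 1},
      δ ^ 12 / 2 ^ 22 * (#{a ∈ K | e₁ a = 1} * #{b ∈ K | e₂ b = 1})
        ≤ ∑ a ∈ U, ∑ b ∈ V, (A a b - δ) := by
  set β := β₁ * β₂ with hβdef
  have hβ : 0 < β := mul_pos hβ₁ hβ₂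
  have hβ1 : β ≤ 1 := mul_le_one₀ hβ₁' hβ₂.le hβ₂'
  have hS : (0 : ℝ) < #S := by exact_mod_cast hSpos
  have hKpos : (0 : ℝ) < #K := by
    by_contra h
    have h0 : (#K : ℝ) = 0 := le_antisymm (not_lt.1 h) (Nat.cast_nonneg _)
    rw [h0] at hKlarge; norm_num at hKlarge
  have hδ12 : δ ^ 12 ≤ 1 := pow_le_one₀ hδ.le hδ1
  have hβ2 : β ^ 2 ≤ 1 := pow_le_one₀ hβ.le hβ1
  have hβ4 : β ^ 4 ≤ β ^ 2 := pow_le_pow_of_le_one hβ.le hβ1 (by norm_num)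
  have hβ2' : β ^ 2 ≤ β := by nlinarith
  have hξβ : 2 ^ 20 * ξ ≤ β ^ 2 := by
    have : δ ^ 12 * β ^ 4 ≤ 1 * β ^ 2 := mul_le_mul hδ12 hβ4 (by positivity) zero_le_one
    linarith
  have n₁ : ∀ n, 0 ≤ e₁ n := fun n => by rcases he₁ n with h | h <;> simp [h]
  have n₂ : ∀ n, 0 ≤ e₂ n := fun n => by rcases he₂ n with h | h <;> simp [h]
  have l₁ : ∀ n, e₁ n ≤ 1 := fun n => by rcases he₁ n with h | h <;> simp [h]
  have l₂ : ∀ n, e₂ n ≤ 1 := fun n => by rcases he₂ n with h | h <;> simp [h]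
  have hA0 : ∀ x y, 0 ≤ A x y := fun x y => by rcases hA x y with h | h <;> simp [h]
  set f : ℤ → ℤ → ℝ := fun x y => A x y - δ * (e₁ x * e₂ y) with hf
  have hf1 : ∀ x y, |f x y| ≤ 1 := by
    intro x y
    have h0 : 0 ≤ e₁ x * e₂ y := mul_nonneg (n₁ x) (n₂ y)
    have h1 : e₁ x * e₂ y ≤ 1 := mul_le_one₀ (l₁ x) (n₂ y) (l₂ y)
    have h2 : δ * (e₁ x * e₂ y) ≤ 1 := mul_le_one₀ hδ1 h0 h1
    have h3 : 0 ≤ δ * (e₁ x * e₂ y) := mul_nonneg hδ.le h0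
    rw [abs_le]
    constructor
    · have := hA0 x y; simp only [hf]; linarith
    · have := hAe x y; simp only [hf]; linarith
  set T := ∑ a ∈ K, ∑ b ∈ K, ∑ r ∈ S, f a b * A (r - b) b * A a (r - a) with hT
  -- the count with `A` at the corner point splits into the main term and `T`
  have hsplit : ∑ a ∈ K, ∑ b ∈ K, ∑ r ∈ S, A a b * A (r - b) b * A a (r - a)
      = δ * ∑ a ∈ K, ∑ b ∈ K, ∑ r ∈ S, A (r - b) b * A a (r - a) + T := by
    have habs : ∀ a b r, e₁ a * e₂ b * (A (r - b) b * A a (r - a)) = A (r - b) b * A a (r - a) := by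
      intro a b r
      have h1 := hAe (r - b) b
      have h2 := hAe a (r - a)
      rcases he₁ a with ha | ha <;> rcases he₂ b with hb | hb
      · rw [ha, zero_mul] at h2
        rw [le_antisymm h2 (hA0 _ _)]; ring
      · rw [ha, zero_mul] at h2
        rw [le_antisymm h2 (hA0 _ _)]; ring
      · rw [hb, mul_zero] at h1
        rw [le_antisymm h1 (hA0 _ _)]; ring
      · rw [ha, hb]; ring
    rw [hT]
    simp only [Finset.mul_sum, ← Finset.sum_add_distrib]
    refine Finset.sum_congr rfl fun a _ => Finset.sum_congr rfl fun b _ =>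
      Finset.sum_congr rfl fun r _ => ?_
    rw [← habs a b r]
    simp only [hf]
    rcases he₁ a with ha | ha <;> rcases he₂ b with hb | hb <;> rw [ha, hb]
    · have : A a b = 0 := le_antisymm (by have := hAe a b; rw [ha, zero_mul] at this; exact this)
        (hA0 _ _)
      rw [this]; ring
    · have : A a b = 0 := le_antisymm (by have := hAe a b; rw [ha, zero_mul] at this; exact this)
        (hA0 _ _)
      rw [this]; ring
    · have : A a b = 0 := le_antisymm (by have := hAe a b; rw [hb, mul_zero] at this; exact this)
        (hA0 _ _)
      rw [this]; ring
    · ring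
  have hmain := stripSum_sq_le K S hK hA0
  have htriv := cornerSum_le_of_cornerFree K S hA hfree
  set M := ∑ a ∈ K, ∑ b ∈ K, ∑ r ∈ S, A (r - b) b * A a (r - a)
  have hM : (δ * β / 2) ^ 2 * ((#K : ℝ) ^ 2 * #S) ≤ M := by
    have h1 : (δ * β / 2 * (#K * #S)) ^ 2 ≤ stripSum K S A ^ 2 := by gcongr
    have h2 : #S * ((δ * β / 2) ^ 2 * ((#K : ℝ) ^ 2 * #S)) ≤ #S * M := by
      refine le_trans (le_of_eq ?_) (h1.trans hmain); ring
    exact le_of_mul_le_mul_left h2 hS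
  -- without nontrivial corners the count is negligible, so `T` must cancel the main term `δ M`
  have hTneg : δ ^ 3 * β ^ 2 / 8 * ((#K : ℝ) ^ 2 * #S) ≤ -T := by
    have h1 : δ * ((δ * β / 2) ^ 2 * ((#K : ℝ) ^ 2 * #S)) ≤ δ * M := by gcongr
    have h2 : 8 * ((#K : ℝ) * #S) ≤ δ ^ 3 * β ^ 2 * #K * (#K * #S) := by gcongr
    rw [hsplit] at htriv
    linarith
  have hT4 : (δ ^ 3 * β ^ 2 / 8 * ((#K : ℝ) ^ 2 * #S)) ^ 4 ≤ T ^ 4 := by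
    have : (-T) ^ 4 = T ^ 4 := by ring
    rw [← this]
    gcongr
  have hCS := cornerSum_pow_four_le K S (f := f) he₁ he₂ hA0 hAe
  have hP := h₁.sum_mul_le n₁ l₁ hβ₂.le hβ₂' hξ h₂
  have hQ := h₁.sum_weight_le n₁ l₁ n₂ l₂ hβ₁.le hβ₁' hβ₂.le hβ₂' hξ (by linarith) h₂
  have hW := h₁.sum_abs_weight_sub_le n₁ l₁ n₂ l₂ hβ₁.le hβ₁' hβ₂.le hβ₂' h₂
  set P := ∑ a ∈ K, ∑ r ∈ S, e₁ a * e₂ (r - a)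
  set Q := ∑ b ∈ K, ∑ b' ∈ K, ∑ r ∈ S, e₁ (r - b) * e₁ (r - b') * (e₂ b * e₂ b')
  set W : ℤ → ℤ → ℤ → ℤ → ℝ := fun a a' b b' =>
    ∑ r ∈ S, e₁ (r - b) * e₁ (r - b') * (e₂ (r - a) * e₂ (r - a')) with hWdef
  set R := ∑ a ∈ K, ∑ a' ∈ K, ∑ b ∈ K, ∑ b' ∈ K, f a b * f a b' * f a' b * f a' b' *
          ∑ r ∈ S, e₁ (r - b) * e₁ (r - b') * (e₂ (r - a) * e₂ (r - a')) with hR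
  have hP0 : 0 ≤ P := Finset.sum_nonneg fun a _ => Finset.sum_nonneg fun r _ =>
    mul_nonneg (n₁ _) (n₂ _)
  have hQ0 : 0 ≤ Q := Finset.sum_nonneg fun a _ => Finset.sum_nonneg fun r _ =>
    Finset.sum_nonneg fun _ _ => mul_nonneg (mul_nonneg (n₁ _) (n₁ _)) (mul_nonneg (n₂ _) (n₂ _))
  have hRle : R ≤ β ^ 2 * #S * boxSum K K f + 4 * ξ * (#K : ℝ) ^ 4 * #S := by
    have h1 : R - β ^ 2 * #S * boxSum K K f
        ≤ ∑ a ∈ K, ∑ a' ∈ K, ∑ b ∈ K, ∑ b' ∈ K, |W a a' b b' - β ^ 2 * #S| := by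
      rw [hR, boxSum]
      simp only [Finset.mul_sum, ← Finset.sum_sub_distrib]
      simp only [← Finset.mul_sum]
      refine Finset.sum_le_sum fun a _ => Finset.sum_le_sum fun a' _ => Finset.sum_le_sum fun b _ =>
        Finset.sum_le_sum fun b' _ => ?_
      have e : f a b * f a b' * f a' b * f a' b' *
          (∑ r ∈ S, e₁ (r - b) * e₁ (r - b') * (e₂ (r - a) * e₂ (r - a')))
          - β ^ 2 * #S * (f a b * f a b' * f a' b * f a' b')
          = (f a b * f a b' * f a' b * f a' b') * (W a a' b b' - β ^ 2 * #S) := by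
        simp only [hWdef]; ring
      rw [e]
      refine (le_abs_self _).trans ?_
      rw [abs_mul]
      refine mul_le_of_le_one_left (abs_nonneg _) ?_
      rw [abs_mul, abs_mul, abs_mul]
      exact mul_le_one₀ (mul_le_one₀ (mul_le_one₀ (hf1 _ _) (abs_nonneg _) (hf1 _ _))
        (abs_nonneg _) (hf1 _ _)) (abs_nonneg _) (hf1 _ _)
    linarith
  have hbig : δ ^ 12 * β ^ 2 / 2 ^ 16 * (#K : ℝ) ^ 4 ≤ boxSum K K f :=
    boxSum_lower_of_bounds hKpos hS hβ hδ hξ hξs hξβ hβ2' hP0 hQ0 hP hQ hRle (hT4.trans hCS)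
  have hXY := (Pseudorandom.card_mul_card_bounds he₁ he₂ hβ₁ hβ₁' hβ₂ hβ₂' hξ
    (by linarith) h₁ h₂).1
  rw [← boxSum_filter_eq K he₁ he₂ hA hAe] at hbig
  exact exists_increment_of_boxSum hA hδ hδ1 hβ hξ (by linarith) hXY hbig hmean

/-! ### Choosing a good cell -/

/-- The indicator function of a finite planar set, with the origin moved to `(i, j)`. -/
def cellInd (A : Finset (ℤ × ℤ)) (i j x y : ℤ) : ℝ := if (i + x, j + y) ∈ A then 1 else 0

/-- The indicator function of a finite set of integers. -/
def ind (E : Finset ℤ) (n : ℤ) : ℝ := if n ∈ E then 1 else 0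

theorem ind_eq (E : Finset ℤ) (n : ℤ) : ind E n = 0 ∨ ind E n = 1 := by
  unfold ind; split_ifs <;> simp

theorem ind_nonneg (E : Finset ℤ) (n : ℤ) : 0 ≤ ind E n := by
  rcases ind_eq E n with h | h <;> simp [h]

theorem ind_le_one (E : Finset ℤ) (n : ℤ) : ind E n ≤ 1 := by
  rcases ind_eq E n with h | h <;> simp [h]

theorem abs_ind_sub_le {E : Finset ℤ} {β : ℝ} (h0 : 0 ≤ β) (h1 : β ≤ 1) (n : ℤ) :
    |ind E n - β| ≤ 1 := by
  rw [abs_le]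
  rcases ind_eq E n with h | h <;> rw [h] <;> constructor <;> linarith

theorem cellInd_eq (A : Finset (ℤ × ℤ)) (i j x y : ℤ) :
    cellInd A i j x y = 0 ∨ cellInd A i j x y = 1 := by
  unfold cellInd; split_ifs <;> simp

theorem cellInd_nonneg (A : Finset (ℤ × ℤ)) (i j x y : ℤ) : 0 ≤ cellInd A i j x y := by
  rcases cellInd_eq A i j x y with h | h <;> simp [h]

theorem cellInd_le_one (A : Finset (ℤ × ℤ)) (i j x y : ℤ) : cellInd A i j x y ≤ 1 := by
  rcases cellInd_eq A i j x y with h | h <;> simp [h]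

theorem NearlyInvariant.card_sub_le {L S : Finset ℤ} {κ : ℝ} (h : NearlyInvariant L S κ)
    (hS : ∀ s ∈ S, -s ∈ S) {s : ℤ} (hs : s ∈ S) : (#{m ∈ L | m - s ∉ L} : ℝ) ≤ κ * #L :=
  h (-s) (hS s hs)

open Classical in
/-- Markov's inequality: if `g` is locally uniform at scale `S` on `I`, it is so on most of the cells
`i + K`. -/
theorem LocallyUniform.card_bad_cells_le {I K S : Finset ℤ} {g : ℤ → ℝ} {α κ ω : ℝ}
    (h : LocallyUniform I S g α α) (hinv : NearlyInvariant I K κ) (hKpos : 0 < #K) :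
    (#{i ∈ I | ¬ LocallyUniform K S (fun n => g (i + n)) α ω} : ℝ) * ω ≤ (α + κ) * #I := by
  set bad : ℤ → Prop := fun m => ¬ ∀ x, ‖trigPoly S (fun r => g (m + r)) x‖ ≤ α * #S with hbad
  have hKR : (0 : ℝ) < #K := by exact_mod_cast hKpos
  have h1 : ∑ i ∈ I, (#{a ∈ K | bad (i + a)} : ℝ) ≤ #K * ((α + κ) * #I) := by
    have e : ∑ i ∈ I, (#{a ∈ K | bad (i + a)} : ℝ) = ∑ a ∈ K, (#{i ∈ I | bad (i + a)} : ℝ) := by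
      simp only [Finset.card_filter]
      push_cast
      exact Finset.sum_comm
    rw [e]
    refine (Finset.sum_le_card_nsmul K _ ((α + κ) * #I) fun a ha => ?_).trans (by simp)
    have hsub : {i ∈ I | bad (i + a)} ⊆
        ({m ∈ I | bad m}.image fun m => m - a) ∪ {i ∈ I | i + a ∉ I} := by
      intro i hi
      rw [Finset.mem_filter] at hi
      by_cases hia : i + a ∈ I
      · exact Finset.mem_union_left _ (Finset.mem_image.2
          ⟨i + a, Finset.mem_filter.2 ⟨hia, hi.2⟩, by ring⟩)
      · exact Finset.mem_union_right _ (Finset.mem_filter.2 ⟨hi.1, hia⟩)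
    have h2 := (Finset.card_le_card hsub).trans ((Finset.card_union_le _ _).trans
      (Nat.add_le_add_right Finset.card_image_le _))
    have h3 : (#{i ∈ I | bad (i + a)} : ℝ) ≤ #{m ∈ I | bad m} + #{i ∈ I | i + a ∉ I} := by
      exact_mod_cast h2
    have h4 : (#{m ∈ I | bad m} : ℝ) ≤ α * #I := h
    have h5 := hinv a ha
    linarith
  have h2 : (#{i ∈ I | ¬ LocallyUniform K S (fun n => g (i + n)) α ω} : ℝ) * (ω * #K)
      ≤ ∑ i ∈ I, (#{a ∈ K | bad (i + a)} : ℝ) := by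
    refine le_trans ?_ (Finset.sum_le_sum_of_subset_of_nonneg
      (Finset.filter_subset (fun i => ¬ LocallyUniform K S (fun n => g (i + n)) α ω) I)
      fun _ _ _ => Nat.cast_nonneg _)
    rw [← nsmul_eq_mul]
    refine Finset.card_nsmul_le_sum _ _ _ fun i hi => ?_
    have h3 := (Finset.mem_filter.1 hi).2
    rw [LocallyUniform, not_le] at h3
    refine h3.le.trans (le_of_eq ?_)
    congr 2
    ext a
    simp only [hbad, add_assoc]
  have h3 := h2.trans h1
  have h4 : #K * ((#{i ∈ I | ¬ LocallyUniform K S (fun n => g (i + n)) α ω} : ℝ) * ω)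
      ≤ #K * ((α + κ) * #I) := by linarith
  exact le_of_mul_le_mul_left h4 hKR

/-- A translate of `A` by `-(u, v)` still has most of its points in `I₁ × I₂`, if the sides are nearly
invariant. -/
theorem card_le_sum_cellInd (A : Finset (ℤ × ℤ)) {I₁ I₂ : Finset ℤ} (hA : A ⊆ I₁ ×ˢ I₂) (u v : ℤ) :
    (#A : ℝ) - #{p ∈ I₁ | p - u ∉ I₁} * #I₂ - #I₁ * #{q ∈ I₂ | q - v ∉ I₂}
      ≤ ∑ i ∈ I₁, ∑ j ∈ I₂, cellInd A i j u v := by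
  have e : ∑ i ∈ I₁, ∑ j ∈ I₂, cellInd A i j u v
      = #{p ∈ I₁ ×ˢ I₂ | (p.1 + u, p.2 + v) ∈ A} := by
    rw [Finset.card_filter, ← Finset.sum_product']
    push_cast
    rfl
  have hsub : A ⊆ ({p ∈ I₁ ×ˢ I₂ | (p.1 + u, p.2 + v) ∈ A}.image fun p => (p.1 + u, p.2 + v)) ∪
      ({p ∈ I₁ | p - u ∉ I₁} ×ˢ I₂ ∪ I₁ ×ˢ {q ∈ I₂ | q - v ∉ I₂}) := by
    rintro ⟨x, y⟩ hp
    have hp' := Finset.mem_product.1 (hA hp)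
    simp only [Finset.mem_union, Finset.mem_image, Finset.mem_filter, Finset.mem_product,
      Prod.mk.injEq, Prod.exists]
    by_cases h1 : x - u ∈ I₁
    · by_cases h2 : y - v ∈ I₂
      · left
        exact ⟨x - u, y - v, ⟨⟨h1, h2⟩, by simpa using hp⟩, by ring, by ring⟩
      · right; right; exact ⟨hp'.1, hp'.2, h2⟩
    · right; left; exact ⟨⟨hp'.1, h1⟩, hp'.2⟩
  have h := (Finset.card_le_card hsub).trans ((Finset.card_union_le _ _).trans
    (Nat.add_le_add Finset.card_image_le (Finset.card_union_le _ _)))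
  rw [Finset.card_product, Finset.card_product] at h
  rw [e]
  have h' : (#A : ℝ) ≤ #{p ∈ I₁ ×ˢ I₂ | (p.1 + u, p.2 + v) ∈ A} +
      (#{p ∈ I₁ | p - u ∉ I₁} * #I₂ + #I₁ * #{q ∈ I₂ | q - v ∉ I₂}) := by exact_mod_cast h
  linarith

/-- Averaged over all cells, the strip density is at least the density of `A`, up to a small error. -/
theorem sum_stripSum_ge {I₁ I₂ K S : Finset ℤ} {A : Finset (ℤ × ℤ)} {n κ : ℝ}
    (hA : A ⊆ I₁ ×ˢ I₂) (hI₁ : (#I₁ : ℝ) = n) (hI₂ : (#I₂ : ℝ) = n)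
    (hK : ∀ a ∈ K, -a ∈ K) (hS : ∀ s ∈ S, -s ∈ S) (h₁K : NearlyInvariant I₁ K κ)
    (h₂K : NearlyInvariant I₂ K κ) (h₂S : NearlyInvariant I₂ S κ) (hKS : NearlyInvariant K S κ)
    (hnn : 0 ≤ (#A : ℝ) - 3 * κ * n ^ 2) :
    (1 - κ) * (#K * #S) * ((#A : ℝ) - 3 * κ * n ^ 2)
      ≤ ∑ i ∈ I₁, ∑ j ∈ I₂, stripSum K S (cellInd A i j) := by
  have e : ∑ i ∈ I₁, ∑ j ∈ I₂, stripSum K S (cellInd A i j)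
      = ∑ r ∈ S, ∑ x ∈ K with x - r ∈ K, ∑ i ∈ I₁, ∑ j ∈ I₂, cellInd A i j x (r - x) := by
    simp only [stripSum]
    simp_rw [Finset.sum_comm (s := I₂) (t := S)]
    rw [Finset.sum_comm]
    refine Finset.sum_congr rfl fun r _ => ?_
    simp_rw [Finset.sum_comm (s := I₂)]
    rw [Finset.sum_comm]
  have hn : 0 ≤ n := hI₁ ▸ Nat.cast_nonneg _
  have hpt : ∀ r ∈ S, ∀ x ∈ ({x ∈ K | x - r ∈ K} : Finset ℤ), (#A : ℝ) - 3 * κ * n ^ 2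
      ≤ ∑ i ∈ I₁, ∑ j ∈ I₂, cellInd A i j x (r - x) := by
    intro r hr x hx
    have hx := (Finset.mem_filter.1 hx).1
    have h1 := h₁K.card_sub_le hK hx
    have h2 : (#{q ∈ I₂ | q - (r - x) ∉ I₂} : ℝ) ≤ 2 * κ * #I₂ := by
      have hsub : {q ∈ I₂ | q - (r - x) ∉ I₂} ⊆
          {q ∈ I₂ | q + x ∉ I₂} ∪ ({q ∈ I₂ | q - r ∉ I₂}.image fun q => q - x) := by
        intro q hq
        rw [Finset.mem_filter] at hq
        by_cases h : q + x ∈ I₂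
        · refine Finset.mem_union_right _ (Finset.mem_image.2 ⟨q + x, Finset.mem_filter.2
            ⟨h, ?_⟩, by ring⟩)
          rw [show q + x - r = q - (r - x) by ring]; exact hq.2
        · exact Finset.mem_union_left _ (Finset.mem_filter.2 ⟨hq.1, h⟩)
      have h := (Finset.card_le_card hsub).trans ((Finset.card_union_le _ _).trans
        (Nat.add_le_add_left Finset.card_image_le _))
      have h' : (#{q ∈ I₂ | q - (r - x) ∉ I₂} : ℝ) ≤
          #{q ∈ I₂ | q + x ∉ I₂} + #{q ∈ I₂ | q - r ∉ I₂} := by exact_mod_cast h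
      have h3 := h₂K x hx
      have h4 := h₂S.card_sub_le hS hr
      linarith
    have h3 := card_le_sum_cellInd A hA x (r - x)
    rw [hI₁] at h1
    rw [hI₂] at h2
    rw [hI₁, hI₂] at h3
    have h4 := mul_le_mul_of_nonneg_right h1 hn
    have h5 := mul_le_mul_of_nonneg_left h2 hn
    linarith
  have hcount : ∀ r ∈ S, (1 - κ) * #K ≤ (#{x ∈ K | x - r ∈ K} : ℝ) := by
    intro r hr
    have h1 := hKS.card_sub_le hS hr
    have h2 := Finset.card_filter_add_card_filter_not (s := K) (fun x => x - r ∈ K)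
    have h3 : (#{x ∈ K | x - r ∈ K} : ℝ) + #{x ∈ K | x - r ∉ K} = #K := by exact_mod_cast h2
    linarith
  rw [e]
  calc (1 - κ) * (#K * #S) * ((#A : ℝ) - 3 * κ * n ^ 2)
      = ∑ r ∈ S, (1 - κ) * #K * ((#A : ℝ) - 3 * κ * n ^ 2) := by
        rw [Finset.sum_const, nsmul_eq_mul]; ring
    _ ≤ ∑ r ∈ S, (#{x ∈ K | x - r ∈ K} : ℝ) * ((#A : ℝ) - 3 * κ * n ^ 2) :=
        Finset.sum_le_sum fun r hr => mul_le_mul_of_nonneg_right (hcount r hr) hnn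
    _ ≤ _ := by
        refine Finset.sum_le_sum fun r hr => ?_
        rw [← nsmul_eq_mul]
        exact Finset.card_nsmul_le_sum _ _ _ (hpt r hr)

/-- Averaged over all cells, the density in the cell is at least that of `A`, up to a small error. -/
theorem sum_cellSum_ge {I₁ I₂ K : Finset ℤ} {A : Finset (ℤ × ℤ)} {n κ : ℝ}
    (hA : A ⊆ I₁ ×ˢ I₂) (hI₁ : (#I₁ : ℝ) = n) (hI₂ : (#I₂ : ℝ) = n)
    (hK : ∀ a ∈ K, -a ∈ K) (h₁K : NearlyInvariant I₁ K κ) (h₂K : NearlyInvariant I₂ K κ) :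
    (#K : ℝ) ^ 2 * ((#A : ℝ) - 2 * κ * n ^ 2)
      ≤ ∑ i ∈ I₁, ∑ j ∈ I₂, ∑ x ∈ K, ∑ y ∈ K, cellInd A i j x y := by
  have e : ∑ i ∈ I₁, ∑ j ∈ I₂, ∑ x ∈ K, ∑ y ∈ K, cellInd A i j x y
      = ∑ x ∈ K, ∑ y ∈ K, ∑ i ∈ I₁, ∑ j ∈ I₂, cellInd A i j x y := by
    have := Finset.sum_comm (s := I₁ ×ˢ I₂) (t := K ×ˢ K)
      (f := fun p q => cellInd A p.1 p.2 q.1 q.2)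
    simpa only [Finset.sum_product] using this
  have hn : 0 ≤ n := hI₁ ▸ Nat.cast_nonneg _
  have hpt : ∀ x ∈ K, ∀ y ∈ K, (#A : ℝ) - 2 * κ * n ^ 2
      ≤ ∑ i ∈ I₁, ∑ j ∈ I₂, cellInd A i j x y := by
    intro x hx y hy
    have h1 := h₁K.card_sub_le hK hx
    have h2 := h₂K.card_sub_le hK hy
    have h3 := card_le_sum_cellInd A hA x y
    rw [hI₁] at h1
    rw [hI₂] at h2
    rw [hI₁, hI₂] at h3
    have h4 := mul_le_mul_of_nonneg_right h1 hn
    have h5 := mul_le_mul_of_nonneg_left h2 hn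
    linarith
  rw [e]
  calc (#K : ℝ) ^ 2 * ((#A : ℝ) - 2 * κ * n ^ 2)
      = ∑ x ∈ K, ∑ y ∈ K, ((#A : ℝ) - 2 * κ * n ^ 2) := by
        simp only [Finset.sum_const, nsmul_eq_mul]; ring
    _ ≤ _ := Finset.sum_le_sum fun x hx => Finset.sum_le_sum fun y hy => hpt x hx y hy

theorem stripSum_le (K S : Finset ℤ) {e₁ e₂ : ℤ → ℝ} {A : ℤ → ℤ → ℝ}
    (he₁ : ∀ n, 0 ≤ e₁ n) (he₂ : ∀ n, 0 ≤ e₂ n) (hAe : ∀ x y, A x y ≤ e₁ x * e₂ y) :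
    stripSum K S A ≤ ∑ a ∈ K, ∑ r ∈ S, e₁ a * e₂ (r - a) := by
  rw [Finset.sum_comm]
  refine Finset.sum_le_sum fun r _ => (Finset.sum_le_sum fun x _ => hAe x (r - x)).trans ?_
  exact Finset.sum_le_sum_of_subset_of_nonneg (Finset.filter_subset _ _)
    fun _ _ _ => mul_nonneg (he₁ _) (he₂ _)

/-- Averaging over all cells produces one in which both sets are locally uniform and a prescribed
combination of the strip density and the density of `A` is almost as large as on average. -/
theorem exists_good_cell {I₁ I₂ K S : Finset ℤ} {A : Finset (ℤ × ℤ)} {g₁ g₂ : ℤ → ℝ}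
    {n κ α ω C z : ℝ} (hA : A ⊆ I₁ ×ˢ I₂) (hI₁ : (#I₁ : ℝ) = n) (hI₂ : (#I₂ : ℝ) = n)
    (hn : 0 < n) (hKpos : 0 < #K) (hSpos : 0 < #S)
    (hK : ∀ a ∈ K, -a ∈ K) (hS : ∀ s ∈ S, -s ∈ S) (h₁K : NearlyInvariant I₁ K κ)
    (h₂K : NearlyInvariant I₂ K κ) (h₂S : NearlyInvariant I₂ S κ) (hKS : NearlyInvariant K S κ)
    (hu₁ : LocallyUniform I₁ S g₁ α α) (hu₂ : LocallyUniform I₂ S g₂ α α)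
    (hω : 0 < ω) (hC : 0 ≤ C) (hz : 0 ≤ z) (hnn : 3 * κ * n ^ 2 ≤ #A)
    (hlt : z * n ^ 2 + 2 * ((α + κ) / ω) * (1 + C) * n ^ 2
      < (1 - κ) * ((#A : ℝ) - 3 * κ * n ^ 2) + C * ((#A : ℝ) - 2 * κ * n ^ 2)) :
    ∃ i ∈ I₁, ∃ j ∈ I₂, LocallyUniform K S (fun m => g₁ (i + m)) α ω ∧
      LocallyUniform K S (fun m => g₂ (j + m)) α ω ∧
      z ≤ stripSum K S (cellInd A i j) / (#K * #S)
        + C * ((∑ x ∈ K, ∑ y ∈ K, cellInd A i j x y) / (#K : ℝ) ^ 2) := by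
  classical
  by_contra hcon
  push Not at hcon
  have hk : (0 : ℝ) < #K := by exact_mod_cast hKpos
  have hs : (0 : ℝ) < #S := by exact_mod_cast hSpos
  set Z : ℤ → ℤ → ℝ := fun i j => stripSum K S (cellInd A i j) / (#K * #S)
        + C * ((∑ x ∈ K, ∑ y ∈ K, cellInd A i j x y) / (#K : ℝ) ^ 2) with hZ
  set B₁ : ℤ → Prop := fun i => ¬ LocallyUniform K S (fun m => g₁ (i + m)) α ω
  set B₂ : ℤ → Prop := fun j => ¬ LocallyUniform K S (fun m => g₂ (j + m)) α ω
  have hZle : ∀ i j, Z i j ≤ 1 + C := by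
    intro i j
    have h1 : stripSum K S (cellInd A i j) ≤ #K * #S := by
      have := stripSum_le K S (e₁ := 1) (e₂ := 1) (A := cellInd A i j) (by simp) (by simp)
        (fun x y => by simpa using cellInd_le_one A i j x y)
      simpa using this
    have h2 : ∑ x ∈ K, ∑ y ∈ K, cellInd A i j x y ≤ (#K : ℝ) ^ 2 := by
      refine (Finset.sum_le_sum fun x _ => Finset.sum_le_sum fun y _ =>
        cellInd_le_one A i j x y).trans (le_of_eq ?_)
      simp [sq]
    have h3 := (div_le_one (by positivity)).2 h1
    have h4 := (div_le_one (by positivity : (0 : ℝ) < (#K : ℝ) ^ 2)).2 h2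
    have h5 := mul_le_mul_of_nonneg_left h4 hC
    simp only [hZ]; linarith
  have hpt : ∀ i ∈ I₁, ∀ j ∈ I₂, Z i j ≤ z + (1 + C) * (if B₁ i then 1 else 0)
      + (1 + C) * (if B₂ j then 1 else 0) := by
    intro i hi j hj
    have h1 := hZle i j
    by_cases hb1 : B₁ i
    · rw [if_pos hb1]; split_ifs <;> linarith
    · by_cases hb2 : B₂ j
      · rw [if_pos hb2, if_neg hb1]; linarith
      · rw [if_neg hb1, if_neg hb2]
        have := (hcon i hi j hj (not_not.1 hb1) (not_not.1 hb2)).le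
        simp only [hZ]; linarith
  have hsum := Finset.sum_le_sum fun i hi => Finset.sum_le_sum fun j hj => hpt i hi j hj
  have hrhs : ∑ i ∈ I₁, ∑ j ∈ I₂, (z + (1 + C) * (if B₁ i then (1 : ℝ) else 0)
      + (1 + C) * (if B₂ j then 1 else 0))
      = z * n ^ 2 + (1 + C) * #{i ∈ I₁ | B₁ i} * n + (1 + C) * n * #{j ∈ I₂ | B₂ j} := by
    have c1 : (#{i ∈ I₁ | B₁ i} : ℝ) = ∑ i ∈ I₁, if B₁ i then (1 : ℝ) else 0 := by
      rw [Finset.card_filter]; push_cast; rfl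
    have c2 : (#{j ∈ I₂ | B₂ j} : ℝ) = ∑ j ∈ I₂, if B₂ j then (1 : ℝ) else 0 := by
      rw [Finset.card_filter]; push_cast; rfl
    rw [c1, c2]
    simp only [Finset.sum_add_distrib, Finset.sum_const, nsmul_eq_mul, ← Finset.mul_sum, hI₁, hI₂]
    ring
  have hlhs : ∑ i ∈ I₁, ∑ j ∈ I₂, Z i j
      = (∑ i ∈ I₁, ∑ j ∈ I₂, stripSum K S (cellInd A i j)) / (#K * #S)
        + C * ((∑ i ∈ I₁, ∑ j ∈ I₂, ∑ x ∈ K, ∑ y ∈ K, cellInd A i j x y) / (#K : ℝ) ^ 2) := by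
    simp only [hZ, Finset.sum_add_distrib, ← Finset.mul_sum, ← Finset.sum_div]
  have hst := sum_stripSum_ge hA hI₁ hI₂ hK hS h₁K h₂K h₂S hKS (by linarith)
  have hcs := sum_cellSum_ge hA hI₁ hI₂ hK h₁K h₂K
  have hst' : (1 - κ) * ((#A : ℝ) - 3 * κ * n ^ 2)
      ≤ (∑ i ∈ I₁, ∑ j ∈ I₂, stripSum K S (cellInd A i j)) / (#K * #S) := by
    rw [le_div_iff₀ (by positivity)]; linarith
  have hcs' : (#A : ℝ) - 2 * κ * n ^ 2
      ≤ (∑ i ∈ I₁, ∑ j ∈ I₂, ∑ x ∈ K, ∑ y ∈ K, cellInd A i j x y) / (#K : ℝ) ^ 2 := by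
    rw [le_div_iff₀ (by positivity)]; linarith
  have hb1 := hu₁.card_bad_cells_le h₁K hKpos (ω := ω)
  have hb2 := hu₂.card_bad_cells_le h₂K hKpos (ω := ω)
  rw [← le_div_iff₀ hω] at hb1 hb2
  rw [hI₁] at hb1
  rw [hI₂] at hb2
  rw [hrhs, hlhs] at hsum
  have hcs'' := mul_le_mul_of_nonneg_left hcs' hC
  have hC1 : 0 ≤ 1 + C := by linarith
  have k1 := mul_le_mul_of_nonneg_right (mul_le_mul_of_nonneg_left hb1 hC1) hn.le
  have k2 := mul_le_mul_of_nonneg_left hb2 (mul_nonneg hC1 hn.le)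
  have e1 : (1 + C) * ((α + κ) * n / ω) * n + (1 + C) * n * ((α + κ) * n / ω)
      = 2 * ((α + κ) / ω) * (1 + C) * n ^ 2 := by ring
  have hb1' : (1 + C) * #{i ∈ I₁ | B₁ i} * n ≤ (1 + C) * ((α + κ) * n / ω) * n := k1
  have hb2' : (1 + C) * n * #{j ∈ I₂ | B₂ j} ≤ (1 + C) * n * ((α + κ) * n / ω) := k2
  linarith

theorem NearlyInvariant.nonneg {L S : Finset ℤ} {κ : ℝ} (h : NearlyInvariant L S κ)
    (hL : 0 < #L) (hS : S.Nonempty) : 0 ≤ κ := by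
  obtain ⟨s, hs⟩ := hS
  have h1 := (Nat.cast_nonneg (α := ℝ) _).trans (h s hs)
  have h2 : (0 : ℝ) < #L := by exact_mod_cast hL
  exact nonneg_of_mul_nonneg_left h1 h2

/-- Smallness relations between the powers of `b = δ² β / 2⁴¹` and the constant `C = 2²⁴ / δ¹²`
that weighs the two densities in the choice of the cell. -/
theorem smallness_bounds {δ β b C : ℝ} (hδ : 0 < δ) (hδ1 : δ ≤ 1) (hβ : 0 < β) (hβ1 : β ≤ 1)
    (hb : b = δ ^ 2 * β / 2 ^ 41) (hC : C = 2 ^ 24 / δ ^ 12) :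
    0 < b ∧ b ≤ 1 / 2 ^ 41 ∧ 1 ≤ C ∧ C * b ^ 7 ≤ δ * β / 2 ^ 100 ∧
      2 ^ 20 * b ^ 7 ≤ δ ^ 12 * β ^ 4 := by
  have hb0 : 0 < b := by rw [hb]; positivity
  have hδ2 : δ ^ 2 ≤ 1 := pow_le_one₀ hδ.le hδ1
  have hδβ : δ ^ 2 * β ≤ δ * β := by
    have : δ ^ 2 ≤ δ := by nlinarith
    gcongr
  have hδβ1 : δ * β ≤ 1 := mul_le_one₀ hδ1 hβ.le hβ1
  have hb1 : b ≤ δ * β / 2 ^ 41 := by rw [hb]; gcongr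
  have hδ12 : δ ^ 12 ≤ 1 := pow_le_one₀ hδ.le hδ1
  have hb6 : b ^ 6 = δ ^ 12 * β ^ 6 / 2 ^ 246 := by rw [hb]; ring
  have hβ6 : β ^ 6 ≤ 1 := pow_le_one₀ hβ.le hβ1
  refine ⟨hb0, hb1.trans (by gcongr), ?_, ?_, ?_⟩
  · rw [hC, le_div_iff₀ (by positivity)]; linarith
  · have e : C * b ^ 7 = (β ^ 6 / 2 ^ 222) * b := by
      rw [show b ^ 7 = b ^ 6 * b by ring, hb6, hC]; field_simp
    rw [e]
    calc (β ^ 6 / 2 ^ 222) * b ≤ (1 / 2 ^ 222) * (δ * β / 2 ^ 41) := by gcongr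
      _ ≤ δ * β / 2 ^ 100 := by
        have : 0 < δ * β := by positivity
        rw [div_mul_div_comm, one_mul]
        gcongr
        norm_num
  · have h1 : β ^ 6 ≤ β ^ 4 := pow_le_pow_of_le_one hβ.le hβ1 (by norm_num)
    have h2 : b ≤ 1 := hb1.trans (by linarith)
    calc 2 ^ 20 * b ^ 7 = 2 ^ 20 * (b ^ 6 * b) := by ring
      _ ≤ 2 ^ 20 * (b ^ 6 * 1) := by gcongr
      _ = δ ^ 12 * β ^ 6 / 2 ^ 226 := by rw [hb6]; ring
      _ ≤ δ ^ 12 * β ^ 4 / 1 := by gcongr; norm_num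
      _ = _ := by ring

/-- The deviation `m` of the mass of `A` in the cell and the strip density `st` are under control if
the weighted density is nearly maximal and the whole cell carries no increment. Here `w` is the
number of points of the cell and `k = |K|²`. -/
theorem cell_density_bounds {δ β σ ξ C z k w m st : ℝ} (hδ : 0 < δ) (hδ1 : δ ≤ 1) (hβ : 0 < β)
    (hξ0 : 0 < ξ) (hC : C = 2 ^ 24 / δ ^ 12) (hCpos : 0 < C) (hCξ : C * ξ ≤ δ * β / 2 ^ 100)
    (hξδβ : ξ ≤ δ * β / 2 ^ 100) (hz : z = δ * β * (1 + C) - δ * β / 4) (hk : 0 < k)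
    (hσ : σ ≤ δ ^ 25 / 2 ^ 40) (hup : w ≤ (β + 8 * ξ) * k)
    (hlow : (β - 8 * ξ) * k ≤ w) (hno : m - σ * w < δ ^ 25 * β / 2 ^ 40 * k)
    (hst2 : st ≤ 2 * β) (hZ : z ≤ st + C * ((m + δ * w) / k)) :
    β / 2 * k ≤ w ∧ -(δ ^ 12 / 2 ^ 20 * w) ≤ m ∧ m ≤ δ ^ 12 / 2 ^ 20 * w ∧ δ * β / 2 ≤ st := by
  have hδβle : δ * β ≤ β := mul_le_of_le_one_left hβ.le hδ1
  have hξβ : ξ ≤ β / 2 ^ 100 := hξδβ.trans (by gcongr)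
  have hwlow : β / 2 * k ≤ w := by
    refine le_trans ?_ hlow
    gcongr
    linarith
  have hw0 : 0 ≤ w := le_trans (by positivity) hwlow
  have hδ12 : δ ^ 25 ≤ δ ^ 12 := pow_le_pow_of_le_one hδ.le hδ1 (by norm_num)
  have hy0 : δ ^ 25 * β / 2 ^ 40 * k ≤ δ ^ 12 / 2 ^ 39 * w := by
    calc δ ^ 25 * β / 2 ^ 40 * k ≤ δ ^ 12 * β / 2 ^ 40 * k := by gcongr
      _ = δ ^ 12 / 2 ^ 39 * (β / 2 * k) := by ring
      _ ≤ _ := by gcongr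
  have hσw : σ * w ≤ δ ^ 12 / 2 ^ 40 * w := by
    refine mul_le_mul_of_nonneg_right (hσ.trans ?_) hw0
    gcongr
  have hδw : 0 ≤ δ ^ 12 * w := by positivity
  have hCδ : C * δ ^ 12 = 2 ^ 24 := by rw [hC]; field_simp
  have hZk : z * k ≤ st * k + C * (m + δ * w) := by
    have h1 := mul_le_mul_of_nonneg_right hZ hk.le
    have e : (st + C * ((m + δ * w) / k)) * k = st * k + C * (m + δ * w) := by field_simp
    rwa [e] at h1
  have hCw : C * (δ * w) ≤ C * (δ * β * k) + δ * β / 2 ^ 97 * k := by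
    have h1 : C * (δ * w) ≤ C * (δ * ((β + 8 * ξ) * k)) := by gcongr
    have h2 : C * ξ * (8 * δ * k) ≤ δ * β / 2 ^ 100 * (8 * δ * k) := by gcongr
    have h3 : δ * (δ * β * k) ≤ 1 * (δ * β * k) := by gcongr
    linarith
  have hδβk : 0 < δ * β * k := by positivity
  rw [hz] at hZk
  refine ⟨hwlow, ?_, by linarith, ?_⟩
  · have hst2k : st * k ≤ 2 * β * k := by gcongr
    have h7 : C * (-(δ ^ 12 / 2 ^ 20 * w)) ≤ C * m := by
      have e : C * (-(δ ^ 12 / 2 ^ 20 * w)) = -(16 * w) := by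
        rw [show C * (-(δ ^ 12 / 2 ^ 20 * w)) = -(C * δ ^ 12 / 2 ^ 20 * w) by ring, hCδ]; ring
      rw [e]
      linarith
    exact le_of_mul_le_mul_left h7 hCpos
  · have h1 : δ * β / 2 * k ≤ st * k := by
      have hwk : w ≤ 2 * β * k := hup.trans (by gcongr; linarith)
      have h25 : δ ^ 25 ≤ δ ^ 13 := pow_le_pow_of_le_one hδ.le hδ1 (by norm_num)
      have h6 : C * m ≤ δ * β / 2 ^ 14 * k := by
        have h7 : m ≤ δ ^ 13 * (β * k) / 2 ^ 38 := by
          have a0 : σ * w ≤ δ ^ 25 / 2 ^ 40 * w := mul_le_mul_of_nonneg_right hσ hw0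
          have a1 : δ ^ 25 / 2 ^ 40 * w ≤ δ ^ 25 / 2 ^ 40 * (2 * β * k) := by gcongr
          have a2 : δ ^ 25 * (β * k) ≤ δ ^ 13 * (β * k) := by gcongr
          have a3 : 0 < δ ^ 13 * (β * k) := by positivity
          linarith
        calc C * m ≤ C * (δ ^ 13 * (β * k) / 2 ^ 38) := by gcongr
          _ = (C * δ ^ 12) * δ * (β * k) / 2 ^ 38 := by ring
          _ = δ * β / 2 ^ 14 * k := by rw [hCδ]; ring
      linarith
    exact le_of_mul_le_mul_right h1 hk

/-- The increment on a subrectangle of size `v ≤ w` exceeds what is allowed when no subrectangle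
has density `δ + σ` with room to spare. -/
theorem not_lt_of_increment {δ β k w v M σ : ℝ} (hδ : 0 < δ) (hδ1 : δ ≤ 1) (hβ : 0 < β)
    (hk : 0 < k) (hσ0 : 0 ≤ σ) (hσ : σ ≤ δ ^ 25 / 2 ^ 40) (hwlow : β / 2 * k ≤ w) (hv : v ≤ w)
    (hM : δ ^ 12 / 2 ^ 22 * w ≤ M) (h : M - σ * v < δ ^ 25 * β / 2 ^ 40 * k) : False := by
  have hw0 : 0 < w := lt_of_lt_of_le (by positivity) hwlow
  have hδ12 : δ ^ 25 ≤ δ ^ 12 := pow_le_pow_of_le_one hδ.le hδ1 (by norm_num)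
  have hy0 : δ ^ 25 * β / 2 ^ 40 * k ≤ δ ^ 12 / 2 ^ 39 * w := by
    calc δ ^ 25 * β / 2 ^ 40 * k ≤ δ ^ 12 * β / 2 ^ 40 * k := by gcongr
      _ = δ ^ 12 / 2 ^ 39 * (β / 2 * k) := by ring
      _ ≤ _ := by gcongr
  have hσw : σ * w ≤ δ ^ 12 / 2 ^ 40 * w := by
    refine mul_le_mul_of_nonneg_right (hσ.trans ?_) hw0.le
    gcongr
  have h3 : σ * v ≤ σ * w := by gcongr
  have h4 : 0 < δ ^ 12 * w := by positivity
  linarith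

set_option maxHeartbeats 1000000 in
/-- The density increment for a corner-free set in the product of two locally uniform sets: some
subrectangle of some cell carries density larger than `δ + σ`, with room to spare. The corner count
needs a cell in which the density is close to `δ` and the strip density is not small. Suppose that
there is no increment. Then the density of no cell exceeds `δ` by much, and a cell where the strip
density plus a large multiple `C` of the density is almost maximal has both properties. -/
theorem exists_increment_cell {I₁ I₂ K S Y E₁ E₂ : Finset ℤ} {A : Finset (ℤ × ℤ)}
    {β₁ β₂ δ κ α σ n b : ℝ} (hE₁ : E₁ ⊆ I₁) (hE₂ : E₂ ⊆ I₂) (hA : A ⊆ E₁ ×ˢ E₂)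
    (hfree : CornerFree A) (hI₁ : (#I₁ : ℝ) = n) (hI₂ : (#I₂ : ℝ) = n) (hn : 0 < n)
    (hAcard : (#A : ℝ) = δ * (β₁ * β₂) * n ^ 2)
    (hβ₁ : 0 < β₁) (hβ₁' : β₁ ≤ 1) (hβ₂ : 0 < β₂) (hβ₂' : β₂ ≤ 1) (hδ : 0 < δ) (hδ1 : δ ≤ 1)
    (hK : ∀ a ∈ K, -a ∈ K) (hS : ∀ s ∈ S, -s ∈ S) (hSne : S.Nonempty)
    (h₁K : NearlyInvariant I₁ K κ) (h₂K : NearlyInvariant I₂ K κ) (h₂S : NearlyInvariant I₂ S κ)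
    (hKS : NearlyInvariant K S κ) (hY : ∀ s ∈ S, ∀ k ∈ K, s - k ∈ Y) (hYK : (#Y : ℝ) ≤ 2 * #K)
    (hu₁ : LocallyUniform I₁ S (fun m => ind E₁ m - β₁) α α)
    (hu₂ : LocallyUniform I₂ S (fun m => ind E₂ m - β₂) α α)
    (hb : b = δ ^ 2 * (β₁ * β₂) / 2 ^ 41) (hκb : κ ≤ b ^ 48) (hα0 : 0 ≤ α) (hαb : α ≤ b ^ 48)
    (hKlarge : 8 ≤ δ ^ 3 * (β₁ * β₂) ^ 2 * #K) (hσ0 : 0 ≤ σ) (hσ : σ ≤ δ ^ 25 / 2 ^ 40) :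
    ∃ i j : ℤ, ∃ U ⊆ K, ∃ V ⊆ K, (∀ u ∈ U, i + u ∈ E₁) ∧ (∀ v ∈ V, j + v ∈ E₂) ∧
      δ ^ 25 * (β₁ * β₂) / 2 ^ 40 * (#K : ℝ) ^ 2
        ≤ ∑ u ∈ U, ∑ v ∈ V, (cellInd A i j u v - (δ + σ)) := by
  by_contra hcon
  push Not at hcon
  set β := β₁ * β₂ with hβdef
  have hβ : 0 < β := mul_pos hβ₁ hβ₂
  have hβ1 : β ≤ 1 := mul_le_one₀ hβ₁' hβ₂.le hβ₂'
  obtain ⟨C, hC⟩ : ∃ C : ℝ, C = 2 ^ 24 / δ ^ 12 := ⟨_, rfl⟩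
  obtain ⟨hb0, hb1, hC1, hCb, hbs⟩ := smallness_bounds hδ hδ1 hβ hβ1 hb hC
  have hKpos : 0 < #K := by
    rcases Nat.eq_zero_or_pos #K with h | h
    · rw [h] at hKlarge; norm_num at hKlarge
    · exact h
  have hk : (0 : ℝ) < #K := by exact_mod_cast hKpos
  have hSpos : 0 < #S := hSne.card_pos
  have hs : (0 : ℝ) < #S := by exact_mod_cast hSpos
  have hκ0 : 0 ≤ κ := hKS.nonneg hKpos hSne
  set ξ := b ^ 7 with hξ
  have hξ0 : 0 < ξ := by positivity
  have hδβ : 0 < δ * β := by positivity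
  have hδβ1 : δ * β ≤ 1 := mul_le_one₀ hδ1 hβ.le hβ1
  have hδβle : δ * β ≤ β := mul_le_of_le_one_left hβ.le hδ1
  have hξδβ : ξ ≤ δ * β / 2 ^ 100 := le_trans (le_mul_of_one_le_left hξ0.le hC1) hCb
  have hb1' : b ≤ 1 := hb1.trans (by norm_num)
  have hbpow : ∀ m : ℕ, 0 < b ^ m := fun m => by positivity
  have h48 : b ^ 48 ≤ ξ / 2 ^ 41 := by
    calc b ^ 48 = b ^ 7 * (b ^ 40 * b) := by ring
      _ ≤ b ^ 7 * (1 * (1 / 2 ^ 41)) := by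
        gcongr
        exact pow_le_one₀ hb0.le hb1'
      _ = ξ / 2 ^ 41 := by rw [hξ]; ring
  have hCpos : 0 < C := by linarith
  -- the exceptional cells have proportion at most `2 b ^ 19`
  have hν : (α + κ) / b ^ 29 ≤ 2 * b ^ 19 := by
    rw [div_le_iff₀ (hbpow 29)]
    calc α + κ ≤ b ^ 48 + b ^ 48 := add_le_add hαb hκb
      _ = 2 * b ^ 19 * b ^ 29 := by ring
  have hν0 : 0 ≤ (α + κ) / b ^ 29 := by positivity
  have h19 : b ^ 19 ≤ ξ := pow_le_pow_of_le_one hb0.le hb1' (by norm_num)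
  obtain ⟨z, hz⟩ : ∃ z : ℝ, z = δ * β * (1 + C) - δ * β / 4 := ⟨_, rfl⟩
  have hz0 : 0 ≤ z := by rw [hz]; nlinarith
  have hκξ : κ ≤ ξ := hκb.trans (h48.trans (by linarith))
  have hCξ : C * ξ ≤ δ * β / 2 ^ 100 := hCb
  have hlt : z * n ^ 2 + 2 * ((α + κ) / b ^ 29) * (1 + C) * n ^ 2
      < (1 - κ) * ((#A : ℝ) - 3 * κ * n ^ 2) + C * ((#A : ℝ) - 2 * κ * n ^ 2) := by
    have hn2 : 0 < n ^ 2 := by positivity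
    have h1 : z + 2 * ((α + κ) / b ^ 29) * (1 + C)
        < (1 - κ) * (δ * β - 3 * κ) + C * (δ * β - 2 * κ) := by
      have k1 : (α + κ) / b ^ 29 * (1 + C) ≤ 2 * ξ * (1 + C) := by gcongr; linarith
      have k2 : C * κ ≤ C * ξ := by gcongr
      have k3 : κ * (δ * β) ≤ κ * 1 := by gcongr
      have k4 : 0 ≤ κ * κ := by positivity
      rw [hz]
      linarith
    rw [hAcard]
    have := mul_lt_mul_of_pos_right h1 hn2
    linarith
  have hnn : 3 * κ * n ^ 2 ≤ #A := by
    rw [hAcard]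
    have : 3 * κ ≤ δ * β := by linarith
    gcongr
  obtain ⟨i, _, j, _, hc₁, hc₂, hZ⟩ := exists_good_cell (hA.trans (Finset.product_subset_product
    hE₁ hE₂)) hI₁ hI₂ hn hKpos hSpos hK hS h₁K h₂K h₂S hKS hu₁ hu₂ (hbpow 29) hCpos.le hz0 hnn hlt
  have hξ4 : 2 * (α ^ 2 + b ^ 29) ≤ ξ ^ 4 := by
    have e : ξ ^ 4 = b ^ 28 := by rw [hξ]; ring
    have h1 : α ^ 2 ≤ b ^ 29 := by
      calc α ^ 2 ≤ (b ^ 48) ^ 2 := by gcongr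
        _ = b ^ 96 := by ring
        _ ≤ b ^ 29 := pow_le_pow_of_le_one hb0.le hb1' (by norm_num)
    have h2 : b ^ 29 ≤ b ^ 28 / 4 := by
      calc b ^ 29 = b ^ 28 * b := by ring
        _ ≤ b ^ 28 * (1 / 4) := by gcongr; linarith
        _ = _ := by ring
    rw [e]; linarith
  have hκ2 : 2 * κ ≤ ξ := by linarith [h48, hκb]
  have hp₁ : Pseudorandom K S (fun m => ind E₁ (i + m) - β₁) ξ := hc₁.pseudorandom hK hKpos hSpos
    hKS hκ2 hY (fun m => abs_ind_sub_le hβ₁.le hβ₁' _) hYK (hbpow 29).le hξ0.le hξ4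
  have hp₂ : Pseudorandom K S (fun m => ind E₂ (j + m) - β₂) ξ := hc₂.pseudorandom hK hKpos hSpos
    hKS hκ2 hY (fun m => abs_ind_sub_le hβ₂.le hβ₂' _) hYK (hbpow 29).le hξ0.le hξ4
  set e₁ : ℤ → ℝ := fun m => ind E₁ (i + m) with he₁
  set e₂ : ℤ → ℝ := fun m => ind E₂ (j + m) with he₂
  have hev₁ : ∀ m, e₁ m = 0 ∨ e₁ m = 1 := fun m => ind_eq _ _
  have hev₂ : ∀ m, e₂ m = 0 ∨ e₂ m = 1 := fun m => ind_eq _ _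
  have hen₁ : ∀ m, 0 ≤ e₁ m := fun m => ind_nonneg _ _
  have hen₂ : ∀ m, 0 ≤ e₂ m := fun m => ind_nonneg _ _
  have hAe : ∀ x y, cellInd A i j x y ≤ e₁ x * e₂ y := by
    intro x y
    by_cases h : (i + x, j + y) ∈ A
    · have h' := Finset.mem_product.1 (hA h)
      simp only [cellInd, he₁, he₂, ind, if_pos h, if_pos h'.1, if_pos h'.2]; norm_num
    · simp only [cellInd, if_neg h]; exact mul_nonneg (hen₁ x) (hen₂ y)
  have hfree' : ∀ x y d, cellInd A i j x y = 1 → cellInd A i j (x + d) y = 1 →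
      cellInd A i j x (y + d) = 1 → d = 0 := by
    intro x y d h1 h2 h3
    have hm : ∀ u v, cellInd A i j u v = 1 → (i + u, j + v) ∈ A := fun u v h => by
      by_contra h'; simp [cellInd, h'] at h
    by_contra hd
    refine hfree (i + x) (j + y) d hd ⟨hm _ _ h1, ?_, ?_⟩
    · rw [add_assoc]; exact hm _ _ h2
    · rw [add_assoc]; exact hm _ _ h3
  have hbnd := Pseudorandom.card_mul_card_bounds hev₁ hev₂ hβ₁ hβ₁' hβ₂ hβ₂' hξ0.le (by
    have : δ ^ 12 * β ^ 4 ≤ 1 * β ^ 2 := mul_le_mul (pow_le_one₀ hδ.le hδ1)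
      (pow_le_pow_of_le_one hβ.le hβ1 (by norm_num)) (by positivity) zero_le_one
    linarith) hp₁ hp₂
  have hstle : stripSum K S (cellInd A i j) ≤ 2 * β * (#K * #S) := by
    refine (stripSum_le K S hen₁ hen₂ hAe).trans ?_
    refine (hp₁.sum_mul_le hen₁ (fun m => ind_le_one _ _) hβ₂.le hβ₂' hξ0.le hp₂).trans ?_
    rw [mul_assoc]
    refine mul_le_mul_of_nonneg_right ?_ (by positivity)
    linarith
  have hinc := exists_increment_of_pseudorandom hK hSpos hev₁ hev₂ (cellInd_eq A i j) hAe hfree'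
    hβ₁ hβ₁' hβ₂ hβ₂' hδ hδ1 hξ0.le hbs hp₁ hp₂ hKlarge
  have hmemX : ∀ U, U ⊆ {a ∈ K | e₁ a = 1} → U ⊆ K ∧ ∀ u ∈ U, i + u ∈ E₁ := by
    intro U hU
    refine ⟨hU.trans (Finset.filter_subset _ _), fun u hu => ?_⟩
    by_contra h
    have := (Finset.mem_filter.1 (hU hu)).2
    simp [he₁, ind, h] at this
  have hmemY : ∀ V, V ⊆ {b ∈ K | e₂ b = 1} → V ⊆ K ∧ ∀ v ∈ V, j + v ∈ E₂ := by
    intro V hV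
    refine ⟨hV.trans (Finset.filter_subset _ _), fun v hv => ?_⟩
    by_contra h
    have := (Finset.mem_filter.1 (hV hv)).2
    simp [he₂, ind, h] at this
  set X := {a ∈ K | e₁ a = 1}
  set Y' := {b ∈ K | e₂ b = 1}
  have hno : ∀ U ⊆ X, ∀ V ⊆ Y', ∑ u ∈ U, ∑ v ∈ V, (cellInd A i j u v - δ) - σ * (#U * #V)
      < δ ^ 25 * β / 2 ^ 40 * (#K : ℝ) ^ 2 := by
    intro U hU V hV
    have h := hcon i j U (hmemX U hU).1 V (hmemY V hV).1 (hmemX U hU).2 (hmemY V hV).2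
    refine lt_of_le_of_lt (le_of_eq ?_) h
    simp only [Finset.sum_sub_distrib, Finset.sum_const, nsmul_eq_mul]
    ring
  have hsumK : ∑ x ∈ K, ∑ y ∈ K, cellInd A i j x y
      = ∑ x ∈ X, ∑ y ∈ Y', (cellInd A i j x y - δ) + δ * (#X * #Y') := by
    have h0 : ∀ x y, e₁ x ≠ 1 ∨ e₂ y ≠ 1 → cellInd A i j x y = 0 := by
      intro x y h
      have h1 := hAe x y
      have h2 : e₁ x * e₂ y = 0 := by
        rcases h with h | h
        · rw [(hev₁ x).resolve_right h, zero_mul]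
        · rw [(hev₂ y).resolve_right h, mul_zero]
      rw [h2] at h1
      exact le_antisymm h1 (cellInd_nonneg A i j x y)
    have h1 : ∑ x ∈ K, ∑ y ∈ K, cellInd A i j x y = ∑ x ∈ X, ∑ y ∈ Y', cellInd A i j x y := by
      rw [Finset.sum_filter]
      refine Finset.sum_congr rfl fun x _ => ?_
      rw [Finset.sum_filter]
      split_ifs with hx
      · refine Finset.sum_congr rfl fun y _ => ?_
        split_ifs with hy
        · rfl
        · exact h0 x y (Or.inr hy)
      · exact Finset.sum_eq_zero fun y _ => h0 x y (Or.inl hx)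
    rw [h1]
    simp only [Finset.sum_sub_distrib, Finset.sum_const, nsmul_eq_mul]
    ring
  rw [hsumK] at hZ
  have hnoXY := hno X subset_rfl Y' subset_rfl
  set m := ∑ x ∈ X, ∑ y ∈ Y', (cellInd A i j x y - δ)
  obtain ⟨w, hw⟩ : ∃ w : ℝ, w = (#X : ℝ) * #Y' := ⟨_, rfl⟩
  obtain ⟨k, hkdef⟩ : ∃ k : ℝ, k = (#K : ℝ) ^ 2 := ⟨_, rfl⟩
  obtain ⟨st, hst⟩ : ∃ st : ℝ, st = stripSum K S (cellInd A i j) / (#K * #S) := ⟨_, rfl⟩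
  have hkpos : 0 < k := by rw [hkdef]; positivity
  rw [← hw, ← hkdef] at hbnd hZ hnoXY
  rw [← hst] at hZ
  have hst2 : st ≤ 2 * β := by rw [hst, div_le_iff₀ (by positivity)]; exact hstle
  obtain ⟨hwlow, hmlow, hmup, hst3⟩ := cell_density_bounds hδ hδ1 hβ hξ0 hC hCpos hCξ hξδβ hz hkpos
    hσ hbnd.1 hbnd.2 hnoXY hst2 hZ
  have hstrip : δ * β / 2 * (#K * #S) ≤ stripSum K S (cellInd A i j) := by
    rw [hst, le_div_iff₀ (by positivity)] at hst3
    exact hst3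
  rw [← hw] at hinc
  obtain ⟨U, hU, V, hV, hUV⟩ := hinc hstrip (abs_le.2 ⟨hmlow, hmup⟩)
  have h1 := hno U hU V hV
  rw [← hkdef] at h1
  have hc₁' : (#U : ℝ) ≤ #X := Nat.cast_le.2 (Finset.card_le_card hU)
  have hc₂' : (#V : ℝ) ≤ #Y' := Nat.cast_le.2 (Finset.card_le_card hV)
  have h2 : (#U : ℝ) * #V ≤ w :=
    (mul_le_mul hc₁' hc₂' (Nat.cast_nonneg _) (Nat.cast_nonneg _)).trans_eq hw.symm
  exact not_lt_of_increment hδ hδ1 hβ hkpos hσ0 hσ hwlow h2 hUV h1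

/-! ### Uniformity in terms of trigonometric polynomials -/

theorem card_shift (t : ℤ) (S : Finset ℤ) : #(shift t S) = #S :=
  Finset.card_image_of_injective _ (add_left_injective t)

theorem shift_zero (S : Finset ℤ) : shift 0 S = S := by
  ext n; simp [shift]

theorem mem_shift {t n : ℤ} {S : Finset ℤ} : n ∈ shift t S ↔ n - t ∈ S := by
  rw [shift, Finset.mem_image]
  constructor
  · rintro ⟨a, ha, rfl⟩; simpa using ha
  · intro h; exact ⟨n - t, h, by ring⟩

theorem balancedFourier_eq_trigPoly (Q M : Finset ℤ) (ρ x : ℝ) :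
    balancedFourier Q M ρ x = trigPoly M (fun s => ind Q s - ρ) x := rfl

theorem norm_balancedFourier_shift (Q M : Finset ℤ) (m : ℤ) (ρ x : ℝ) :
    ‖balancedFourier Q (shift m M) ρ x‖ = ‖trigPoly M (fun r => ind Q (m + r) - ρ) x‖ := by
  have h : balancedFourier Q (shift m M) ρ x
      = negChar m x * trigPoly M (fun r => ind Q (m + r) - ρ) x := by
    rw [balancedFourier_eq_trigPoly, trigPoly, trigPoly, shift,
      Finset.sum_image (fun a _ b _ hab => add_left_injective m hab), Finset.mul_sum]
    refine Finset.sum_congr rfl fun s _ => ?_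
    rw [negChar_add, add_comm m s]
    ring
  rw [h, norm_mul, norm_negChar, one_mul]

theorem balancedFourierSup_le {Q M : Finset ℤ} {ρ c : ℝ}
    (h : ∀ x, ‖trigPoly M (fun s => ind Q s - ρ) x‖ ≤ c) : balancedFourierSup Q M ρ ≤ c :=
  ciSup_le h

theorem balancedFourierSup_shift (Q M : Finset ℤ) (m : ℤ) (ρ : ℝ) :
    balancedFourierSup Q (shift m M) ρ = ⨆ x, ‖trigPoly M (fun r => ind Q (m + r) - ρ) x‖ := by
  unfold balancedFourierSup
  simp only [norm_balancedFourier_shift]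

theorem sum_ind (M Q : Finset ℤ) : ∑ m ∈ M, ind Q m = #(Q ∩ M) := by
  simp only [ind]
  rw [Finset.sum_boole, Finset.filter_mem_eq_inter, Finset.inter_comm]

theorem relDensity_nonneg (M Q : Finset ℤ) : 0 ≤ relDensity M Q := by
  unfold relDensity; positivity

theorem relDensity_le_one (M Q : Finset ℤ) : relDensity M Q ≤ 1 := by
  unfold relDensity
  refine div_le_one_of_le₀ ?_ (Nat.cast_nonneg _)
  exact_mod_cast Finset.card_le_card Finset.inter_subset_right

theorem relDensity_eq_of_subset {M Q : Finset ℤ} (h : Q ⊆ M) :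
    relDensity M Q = (#Q : ℝ) / #M := by
  rw [relDensity, Finset.inter_eq_left.2 h]

/-- The first of the conditions of uniformity is local uniformity of the balanced function. -/
theorem UniformWith.locallyUniform {M S Q : Finset ℤ} {α : ℝ} (h : UniformWith M S Q α) :
    LocallyUniform M S (fun m => ind Q m - relDensity M Q) α α := by
  classical
  refine le_trans ?_ h.1
  refine Nat.cast_le.2 (Finset.card_le_card fun m hm => ?_)
  rw [Finset.mem_filter] at hm ⊢
  refine ⟨hm.1, ?_⟩
  obtain ⟨x, hx⟩ := not_forall.1 hm.2
  rw [balancedFourierSup_shift]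
  refine (not_le.1 hx).le.trans (le_ciSup (f := fun x => ‖trigPoly S _ x‖) ?_ x)
  exact ⟨#S, by
    rintro _ ⟨y, rfl⟩
    exact norm_trigPoly_le
      (fun n => abs_ind_sub_le (relDensity_nonneg M Q) (relDensity_le_one M Q) _) y⟩

theorem relDensity_shift_sub {S Q : Finset ℤ} (hS : 0 < #S) (m : ℤ) (ρ : ℝ) :
    |relDensity (shift m S) Q - ρ| = ‖trigPoly S (fun r => ind Q (m + r) - ρ) 0‖ / #S := by
  have hs : (0 : ℝ) < #S := by exact_mod_cast hS
  have h1 : trigPoly S (fun r => ind Q (m + r) - ρ) 0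
      = ((∑ r ∈ S, (ind Q (m + r) - ρ) : ℝ) : ℂ) := by
    simp only [trigPoly, negChar_zero_right, mul_one]
    push_cast
    rfl
  have h2 : ∑ r ∈ S, ind Q (m + r) = #(Q ∩ shift m S) := by
    rw [← sum_ind, shift, Finset.sum_image (fun a _ b _ hab => add_left_injective m hab)]
    exact Finset.sum_congr rfl fun s _ => by rw [add_comm]
  rw [h1, Complex.norm_real, Real.norm_eq_abs, Finset.sum_sub_distrib, h2, Finset.sum_const,
    nsmul_eq_mul, relDensity, card_shift, ← abs_of_pos hs, ← abs_div, abs_of_pos hs]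
  congr 1
  field_simp

/-- Local uniformity with smaller parameters implies all three conditions of uniformity: the value
of the local Fourier transforms at `0` controls the local densities, and averaging them over a
nearly invariant set controls the global Fourier transform. -/
theorem LocallyUniform.uniformWith {M S Q : Finset ℤ} {α κ : ℝ} (hM : 0 < #M) (hS : 0 < #S)
    (hα : 0 < α) (hα1 : α ≤ 1) (hκ : κ ≤ α / 4) (hMS : NearlyInvariant M S κ)
    (h : LocallyUniform M S (fun m => ind Q m - relDensity M Q) (α / 4) (α ^ 2 / 4)) :
    UniformWith M S Q α := by
  classical
  have hm : (0 : ℝ) < #M := by exact_mod_cast hM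
  have hs : (0 : ℝ) < #S := by exact_mod_cast hS
  set γ := relDensity M Q
  have hg : ∀ n, |ind Q n - γ| ≤ 1 :=
    abs_ind_sub_le (relDensity_nonneg M Q) (relDensity_le_one M Q)
  set bad : ℤ → Prop := fun m => ¬ ∀ x, ‖trigPoly S (fun r => ind Q (m + r) - γ) x‖ ≤ α / 4 * #S
  have hbad : (#{m ∈ M | bad m} : ℝ) ≤ α ^ 2 / 4 * #M := h
  have hα2 : α ^ 2 ≤ α := by nlinarith
  have htriv : ∀ m x, ‖trigPoly S (fun r => ind Q (m + r) - γ) x‖ ≤ #S :=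
    fun m x => norm_trigPoly_le (fun n => hg _) x
  refine ⟨?_, ?_, ?_⟩
  · refine le_trans ?_ (hbad.trans (mul_le_mul_of_nonneg_right (by linarith) hm.le))
    refine Nat.cast_le.2 (Finset.card_le_card fun m hm' => ?_)
    rw [Finset.mem_filter] at hm' ⊢
    refine ⟨hm'.1, fun hgood => ?_⟩
    have h1 := hm'.2
    rw [balancedFourierSup_shift] at h1
    have h2 := h1.trans (ciSup_le hgood)
    nlinarith
  · rw [one_div, inv_mul_le_iff₀ hm]
    have hpt : ∀ m ∈ M, |relDensity (shift m S) Q - γ| ^ 2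
        ≤ α ^ 2 / 16 + if bad m then 1 else 0 := by
      intro m _
      rw [relDensity_shift_sub hS]
      split_ifs with hb
      · have : ‖trigPoly S (fun r => ind Q (m + r) - γ) 0‖ / #S ≤ 1 := by
          rw [div_le_one hs]; exact htriv m 0
        have := pow_le_one₀ (n := 2) (by positivity) this
        nlinarith
      · have h1 : ‖trigPoly S (fun r => ind Q (m + r) - γ) 0‖ / #S ≤ α / 4 := by
          rw [div_le_iff₀ hs]; exact not_not.1 hb 0
        have := pow_le_pow_left₀ (by positivity) h1 2
        linarith
    refine (Finset.sum_le_sum hpt).trans ?_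
    rw [Finset.sum_add_distrib, Finset.sum_const, nsmul_eq_mul, Finset.sum_boole]
    nlinarith
  · refine balancedFourierSup_le fun x => ?_
    set f : ℤ → ℂ := fun n => ((ind Q n - γ : ℝ) : ℂ) * negChar n x
    have hf : ∀ n, ‖f n‖ ≤ 1 := fun n => by
      simp only [f, norm_mul, norm_negChar, mul_one, Complex.norm_real]; exact hg n
    have h1 : ‖∑ s ∈ S, (∑ m ∈ M, f (m + s) - ∑ m ∈ M, f m)‖ ≤ 2 * κ * #M * #S := by
      refine (norm_sum_le_of_le S fun s hs' =>
        hMS.norm_sum_translate_sub_le hs' f hf).trans (le_of_eq ?_)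
      rw [Finset.sum_const, nsmul_eq_mul]; ring
    have h2 : ‖∑ s ∈ S, ∑ m ∈ M, f (m + s)‖ ≤ (α / 4 + α ^ 2 / 4) * #M * #S := by
      rw [Finset.sum_comm]
      have hpt : ∀ m ∈ M, ‖∑ s ∈ S, f (m + s)‖ ≤ α / 4 * #S + if bad m then (#S : ℝ) else 0 := by
        intro m _
        have e : ∑ s ∈ S, f (m + s)
            = negChar m x * trigPoly S (fun r => ind Q (m + r) - γ) x := by
          rw [trigPoly, Finset.mul_sum]
          refine Finset.sum_congr rfl fun s _ => ?_
          simp only [f]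
          rw [negChar_add]; ring
        rw [e, norm_mul, norm_negChar, one_mul]
        split_ifs with hb
        · have := htriv m x
          have : 0 ≤ α / 4 * #S := by positivity
          linarith
        · rw [add_zero]; exact not_not.1 hb x
      refine (norm_sum_le_of_le M hpt).trans ?_
      rw [Finset.sum_add_distrib, Finset.sum_const, nsmul_eq_mul, ← Finset.sum_filter,
        Finset.sum_const, nsmul_eq_mul]
      have := mul_le_mul_of_nonneg_right hbad hs.le
      linarith
    have h3 : (#S : ℂ) * ∑ m ∈ M, f m = ∑ s ∈ S, ∑ m ∈ M, f (m + s)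
        - ∑ s ∈ S, (∑ m ∈ M, f (m + s) - ∑ m ∈ M, f m) := by
      rw [Finset.sum_sub_distrib, Finset.sum_const, nsmul_eq_mul]; ring
    have h4 : (#S : ℝ) * ‖∑ m ∈ M, f m‖ ≤ #S * (α * #M) := by
      have e : (#S : ℝ) * ‖∑ m ∈ M, f m‖ = ‖(#S : ℂ) * ∑ m ∈ M, f m‖ := by
        rw [norm_mul, Complex.norm_natCast]
      rw [e, h3]
      refine (norm_sub_le _ _).trans ?_
      have h5 : α / 4 + α ^ 2 / 4 + 2 * κ ≤ α := by linarith
      have h6 : 0 < (#M : ℝ) * #S := mul_pos hm hs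
      nlinarith
    exact le_of_mul_le_mul_left h4 hs

/-! ### Averages over translates -/

/-- The mean of `h` over the translate `a + T`. -/
def localMean (T : Finset ℤ) (h : ℤ → ℝ) (a : ℤ) : ℝ := (∑ t ∈ T, h (a + t)) / #T

theorem localMean_sub_const {T : Finset ℤ} (hT : T.Nonempty) (h : ℤ → ℝ) (c : ℝ) (a : ℤ) :
    localMean T (fun n => h n - c) a = localMean T h a - c := by
  have ht : (0 : ℝ) < #T := by exact_mod_cast hT.card_pos
  rw [localMean, localMean, Finset.sum_sub_distrib, Finset.sum_const, nsmul_eq_mul]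
  field_simp

theorem NearlyInvariant.abs_sum_localMean_sub_le {L T : Finset ℤ} {κ C : ℝ}
    (h : NearlyInvariant L T κ) (hT : T.Nonempty) (b : ℤ) (f : ℤ → ℝ) (hf : ∀ n, |f n| ≤ C) :
    |∑ m ∈ L, localMean T f (b + m) - ∑ m ∈ L, f (b + m)| ≤ 2 * C * κ * #L := by
  have ht : (0 : ℝ) < #T := by exact_mod_cast hT.card_pos
  have e : ∑ m ∈ L, localMean T f (b + m) - ∑ m ∈ L, f (b + m)
      = (∑ t ∈ T, (∑ m ∈ L, f (b + (m + t)) - ∑ m ∈ L, f (b + m))) / #T := by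
    simp only [localMean]
    rw [← Finset.sum_div, Finset.sum_comm, Finset.sum_sub_distrib, Finset.sum_const, nsmul_eq_mul]
    simp only [add_assoc]
    field_simp
  rw [e, abs_div, Nat.abs_cast, div_le_iff₀ ht]
  refine (Finset.abs_sum_le_sum_abs _ _).trans ((Finset.sum_le_sum fun t ht' =>
    h.norm_sum_translate_sub_le ht' (fun m => f (b + m)) fun n => hf _).trans ?_)
  rw [Finset.sum_const, nsmul_eq_mul, mul_comm]

/-- A large Fourier coefficient of `g` on `m + S` forces the means of `g` over the translates of
`T` inside `m + S` to be large in mean square, if the character is nearly constant on `T`. -/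
theorem sum_sq_localMean_ge {S T : Finset ℤ} {g : ℤ → ℝ} {m : ℤ} {x α κ τ : ℝ}
    (hT : T.Nonempty) (hα : 0 ≤ α) (hg : ∀ n, |g n| ≤ 1) (hST : NearlyInvariant S T κ)
    (hx : α / 4 * #S ≤ ‖trigPoly S (fun r => g (m + r)) x‖)
    (hτ : ∀ n ∈ T, ‖negChar n x - 1‖ ≤ τ) (hsmall : 2 * κ + τ ≤ α / 8) :
    (α / 8) ^ 2 * #S ≤ ∑ s ∈ S, localMean T g (m + s) ^ 2 := by
  have ht : (0 : ℝ) < #T := by exact_mod_cast hT.card_pos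
  set f : ℤ → ℂ := fun s => (g (m + s) : ℂ) * negChar s x
  have hf : ∀ n, ‖f n‖ ≤ 1 := fun n => by
    simp only [f, norm_mul, norm_negChar, mul_one, Complex.norm_real]; exact hg _
  have hA : ‖∑ n ∈ T, (∑ s ∈ S, f (s + n) - ∑ s ∈ S, f s)‖ ≤ 2 * κ * #S * #T := by
    refine (norm_sum_le_of_le T fun n hn => hST.norm_sum_translate_sub_le hn f hf).trans
      (le_of_eq ?_)
    rw [Finset.sum_const, nsmul_eq_mul]; ring
  have hB : ‖∑ n ∈ T, ∑ s ∈ S, (g (m + s + n) : ℂ) * negChar s x * (negChar n x - 1)‖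
      ≤ τ * #S * #T := by
    refine (norm_sum_le_of_le T (n := fun _ => τ * #S) fun n hn => ?_).trans (le_of_eq ?_)
    · refine (norm_sum_le_of_le S (n := fun _ => τ) fun s _ => ?_).trans (le_of_eq ?_)
      · rw [norm_mul, norm_mul, norm_negChar, mul_one, Complex.norm_real]
        exact (mul_le_mul (hg _) (hτ n hn) (norm_nonneg _) zero_le_one).trans_eq (one_mul _)
      · rw [Finset.sum_const, nsmul_eq_mul]; ring
    · rw [Finset.sum_const, nsmul_eq_mul]; ring
  have hC : ‖∑ s ∈ S, negChar s x * ((#T * localMean T g (m + s) : ℝ) : ℂ)‖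
      ≤ #T * ∑ s ∈ S, |localMean T g (m + s)| := by
    rw [Finset.mul_sum]
    refine norm_sum_le_of_le S fun s _ => ?_
    rw [norm_mul, norm_negChar, one_mul, Complex.norm_real, norm_mul, Real.norm_natCast,
      Real.norm_eq_abs]
  have hkey : (#T : ℂ) * ∑ s ∈ S, f s
      = ∑ s ∈ S, negChar s x * ((#T * localMean T g (m + s) : ℝ) : ℂ)
        + ∑ n ∈ T, ∑ s ∈ S, (g (m + s + n) : ℂ) * negChar s x * (negChar n x - 1)
        - ∑ n ∈ T, (∑ s ∈ S, f (s + n) - ∑ s ∈ S, f s) := by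
    have e1 : ∑ s ∈ S, negChar s x * ((#T * localMean T g (m + s) : ℝ) : ℂ)
        = ∑ n ∈ T, ∑ s ∈ S, (g (m + s + n) : ℂ) * negChar s x := by
      rw [Finset.sum_comm]
      refine Finset.sum_congr rfl fun s _ => ?_
      have : (#T : ℝ) * localMean T g (m + s) = ∑ n ∈ T, g (m + s + n) := by
        rw [localMean]; field_simp
      rw [this]
      push_cast
      rw [Finset.mul_sum]
      exact Finset.sum_congr rfl fun n _ => mul_comm _ _
    rw [e1, ← Finset.sum_add_distrib, Finset.sum_sub_distrib, Finset.sum_const, nsmul_eq_mul]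
    have e2 : ∑ n ∈ T, (∑ s ∈ S, (g (m + s + n) : ℂ) * negChar s x
        + ∑ s ∈ S, (g (m + s + n) : ℂ) * negChar s x * (negChar n x - 1))
        = ∑ n ∈ T, ∑ s ∈ S, f (s + n) := by
      refine Finset.sum_congr rfl fun n _ => ?_
      rw [← Finset.sum_add_distrib]
      refine Finset.sum_congr rfl fun s _ => ?_
      simp only [f]
      rw [negChar_add, ← add_assoc m s n]; ring
    rw [e2]; ring
  have hmain : α / 8 * #S ≤ ∑ s ∈ S, |localMean T g (m + s)| := by
    have h1 : (#T : ℝ) * (α / 4 * #S) ≤ ‖(#T : ℂ) * ∑ s ∈ S, f s‖ := by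
      rw [norm_mul, Complex.norm_natCast]
      exact mul_le_mul_of_nonneg_left hx ht.le
    rw [hkey] at h1
    have h2 := h1.trans (norm_sub_le _ _)
    have h3 := norm_add_le (∑ s ∈ S, negChar s x * ((#T * localMean T g (m + s) : ℝ) : ℂ))
      (∑ n ∈ T, ∑ s ∈ S, (g (m + s + n) : ℂ) * negChar s x * (negChar n x - 1))
    have h4 : (2 * κ + τ) * (#S * #T) ≤ α / 8 * (#S * #T) := by gcongr
    refine le_of_mul_le_mul_left ?_ ht
    linarith
  have hcs : (∑ s ∈ S, |localMean T g (m + s)|) ^ 2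
      ≤ #S * ∑ s ∈ S, localMean T g (m + s) ^ 2 := by
    refine sq_sum_le_card_mul_sum_sq.trans (le_of_eq ?_)
    simp only [sq_abs]
  rcases S.eq_empty_or_nonempty with rfl | hS
  · simp
  · have hs : (0 : ℝ) < #S := by exact_mod_cast hS.card_pos
    have h1 : (α / 8 * #S) ^ 2 ≤ (∑ s ∈ S, |localMean T g (m + s)|) ^ 2 := by gcongr
    refine le_of_mul_le_mul_left ?_ hs
    calc #S * ((α / 8) ^ 2 * #S) = (α / 8 * #S) ^ 2 := by ring
      _ ≤ _ := h1.trans hcs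

/-- Averaging a function of two variables over translates of `T m × T m` contained in `L × L`
preserves its mean. -/
theorem sum_localMean_localMean_ge {L S : Finset ℤ} {T : ℤ → Finset ℤ} {G : ℤ → ℤ → ℝ} {κ : ℝ}
    (hT : ∀ m ∈ L, (T m).Nonempty) (hS : S.Nonempty) (hLT : ∀ m ∈ L, NearlyInvariant L (T m) κ)
    (hST : ∀ m ∈ L, NearlyInvariant S (T m) κ) (hLS : NearlyInvariant L S κ)
    (hG : ∀ a b, |G a b| ≤ 2) :
    (#L * #S * #L) * ((∑ a ∈ L, ∑ b ∈ L, G a b) / (#L : ℝ) ^ 2 - 12 * κ)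
      ≤ ∑ m ∈ L, ∑ s ∈ S, ∑ n ∈ L,
        localMean (T m) (fun a => localMean (T m) (G a) n) (m + s) := by
  rcases L.eq_empty_or_nonempty with rfl | hL
  · simp
  have hl : (0 : ℝ) < #L := by exact_mod_cast hL.card_pos
  have hs : (0 : ℝ) < #S := by exact_mod_cast hS.card_pos
  set H : ℤ → ℝ := fun a => ∑ b ∈ L, G a b
  have hH : ∀ a, |H a| ≤ 2 * #L := fun a => by
    refine (Finset.abs_sum_le_sum_abs _ _).trans ((Finset.sum_le_sum fun b _ => hG a b).trans ?_)
    rw [Finset.sum_const, nsmul_eq_mul, mul_comm]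
  have h1 : ∀ m ∈ L, ∀ s ∈ S, localMean (T m) H (m + s) - 4 * κ * #L
      ≤ ∑ n ∈ L, localMean (T m) (fun a => localMean (T m) (G a) n) (m + s) := by
    intro m hm s _
    have ht : (0 : ℝ) < #(T m) := by exact_mod_cast (hT m hm).card_pos
    have e : ∑ n ∈ L, localMean (T m) (fun a => localMean (T m) (G a) n) (m + s)
        = (∑ u ∈ T m, ∑ n ∈ L, localMean (T m) (G (m + s + u)) n) / #(T m) := by
      have e' : ∀ n, localMean (T m) (fun a => localMean (T m) (G a) n) (m + s)
          = (∑ u ∈ T m, localMean (T m) (G (m + s + u)) n) / #(T m) := fun n => rfl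
      simp only [e']
      rw [← Finset.sum_div, Finset.sum_comm]
    rw [e, localMean, le_div_iff₀ ht, sub_mul, div_mul_cancel₀ _ ht.ne']
    have h2 : ∀ u ∈ T m, H (m + s + u) - 4 * κ * #L
        ≤ ∑ n ∈ L, localMean (T m) (G (m + s + u)) n := by
      intro u _
      have := (abs_le.1 ((hLT m hm).abs_sum_localMean_sub_le (hT m hm) 0 (G (m + s + u))
        (hG (m + s + u)))).1
      simp only [zero_add] at this
      linarith
    refine le_trans (le_of_eq ?_) (Finset.sum_le_sum h2)
    rw [Finset.sum_sub_distrib, Finset.sum_const, nsmul_eq_mul]; ring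
  have h2 : ∀ m ∈ L, ∑ s ∈ S, H (m + s) - 4 * κ * #L * #S
      ≤ ∑ s ∈ S, localMean (T m) H (m + s) := by
    intro m hm
    have := (abs_le.1 ((hST m hm).abs_sum_localMean_sub_le (hT m hm) m H hH)).1
    linarith
  have h3 : #S * (∑ a ∈ L, H a) - 4 * κ * #L * #L * #S ≤ ∑ m ∈ L, ∑ s ∈ S, H (m + s) := by
    have := (abs_le.1 (hLS.abs_sum_localMean_sub_le hS 0 H hH)).1
    simp only [zero_add, localMean] at this
    rw [← Finset.sum_div, neg_le_sub_iff_le_add, ← sub_le_iff_le_add, le_div_iff₀ hs] at this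
    linarith
  have h4 : ∑ m ∈ L, ∑ s ∈ S, (localMean (T m) H (m + s) - 4 * κ * #L)
      ≤ ∑ m ∈ L, ∑ s ∈ S, ∑ n ∈ L,
        localMean (T m) (fun a => localMean (T m) (G a) n) (m + s) :=
    Finset.sum_le_sum fun m hm => Finset.sum_le_sum fun s hs' => h1 m hm s hs'
  have h5 := Finset.sum_le_sum h2
  simp only [Finset.sum_sub_distrib, Finset.sum_const, nsmul_eq_mul] at h4 h5
  have e : (#L * #S * #L : ℝ) * ((∑ a ∈ L, ∑ b ∈ L, G a b) / (#L : ℝ) ^ 2 - 12 * κ)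
      = #S * (∑ a ∈ L, H a) - 12 * κ * #L * #L * #S := by
    simp only [H]; field_simp
  rw [e]
  linarith

/-- Averaging over translates of `T` does not decrease the mean square of a function. -/
theorem NearlyInvariant.sum_sq_localMean_ge {L T : Finset ℤ} {κ γ : ℝ} {f : ℤ → ℝ}
    (h : NearlyInvariant L T κ) (hT : T.Nonempty) (hκ : 0 ≤ κ) (hf : ∀ n, |f n| ≤ 1) (hγ0 : 0 ≤ γ)
    (hγ1 : γ ≤ 1) (hγ : ∑ m ∈ L, f m = γ * #L) :
    (γ ^ 2 - 4 * κ) * #L ≤ ∑ n ∈ L, localMean T f n ^ 2 := by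
  have h1 : ∀ n ∈ L, 2 * γ * localMean T f n - γ ^ 2 ≤ localMean T f n ^ 2 := fun n _ => by
    nlinarith [sq_nonneg (localMean T f n - γ)]
  refine le_trans ?_ (Finset.sum_le_sum h1)
  rw [Finset.sum_sub_distrib, ← Finset.mul_sum, Finset.sum_const, nsmul_eq_mul]
  have h2 := (abs_le.1 (h.abs_sum_localMean_sub_le hT 0 f hf)).1
  simp only [zero_add] at h2
  rw [hγ] at h2
  have h3 : γ * (γ * #L - 2 * κ * #L) ≤ γ * ∑ m ∈ L, localMean T f m :=
    mul_le_mul_of_nonneg_left (by linarith) hγ0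
  have h4 : γ * (κ * #L) ≤ 1 * (κ * #L) := by gcongr
  linarith

/-- The mean square of the local densities exceeds the square of the global density if the local
densities deviate from it in mean square on many of the translates `m + S`. -/
theorem sum_sq_localMean_ge_of_deviation {L S B : Finset ℤ} {T : ℤ → Finset ℤ} {κ γ ν ζ : ℝ}
    {f : ℤ → ℝ}
    (hT : ∀ m ∈ L, (T m).Nonempty) (hS : S.Nonempty) (hST : ∀ m ∈ L, NearlyInvariant S (T m) κ)
    (hLS : NearlyInvariant L S κ) (hκ : 0 ≤ κ) (hf : ∀ n, |f n| ≤ 1) (hγ0 : 0 ≤ γ) (hγ1 : γ ≤ 1)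
    (hγ : ∑ m ∈ L, f m = γ * #L) (hB : B ⊆ L) (hBcard : ν * #L ≤ #B) (hζ : 0 ≤ ζ)
    (hdev : ∀ m ∈ B, ζ * #S ≤ ∑ s ∈ S, (localMean (T m) f (m + s) - γ) ^ 2) :
    (γ ^ 2 - 8 * κ + ν * ζ) * (#L * #S) ≤ ∑ m ∈ L, ∑ s ∈ S, localMean (T m) f (m + s) ^ 2 := by
  have hs : (0 : ℝ) < #S := by exact_mod_cast hS.card_pos
  have e : ∑ m ∈ L, ∑ s ∈ S, localMean (T m) f (m + s) ^ 2
      = ∑ m ∈ L, ∑ s ∈ S, (localMean (T m) f (m + s) - γ) ^ 2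
        + 2 * γ * (∑ m ∈ L, ∑ s ∈ S, localMean (T m) f (m + s)) - γ ^ 2 * (#L * #S) := by
    have e1 : ∀ m s, localMean (T m) f (m + s) ^ 2 = (localMean (T m) f (m + s) - γ) ^ 2
        + 2 * γ * localMean (T m) f (m + s) - γ ^ 2 := fun m s => by ring
    simp only [e1, Finset.sum_sub_distrib, Finset.sum_add_distrib, Finset.mul_sum,
      Finset.sum_const, nsmul_eq_mul]
    ring
  have h1 : ν * ζ * (#L * #S) ≤ ∑ m ∈ L, ∑ s ∈ S, (localMean (T m) f (m + s) - γ) ^ 2 := by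
    refine le_trans ?_ (Finset.sum_le_sum_of_subset_of_nonneg hB fun m _ _ =>
      Finset.sum_nonneg fun s _ => sq_nonneg _)
    refine le_trans ?_ (Finset.sum_le_sum hdev)
    rw [Finset.sum_const, nsmul_eq_mul]
    have := mul_le_mul_of_nonneg_right hBcard (mul_nonneg hζ hs.le)
    linarith
  have h2 : ∀ m ∈ L, ∑ s ∈ S, f (m + s) - 2 * κ * #S ≤ ∑ s ∈ S, localMean (T m) f (m + s) := by
    intro m hm
    have := (abs_le.1 ((hST m hm).abs_sum_localMean_sub_le (hT m hm) m f hf)).1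
    linarith
  have h3 : (γ - 2 * κ) * (#L * #S) ≤ ∑ m ∈ L, ∑ s ∈ S, f (m + s) := by
    have := (abs_le.1 (hLS.abs_sum_localMean_sub_le hS 0 f hf)).1
    simp only [zero_add, localMean] at this
    rw [← Finset.sum_div, neg_le_sub_iff_le_add, ← sub_le_iff_le_add, le_div_iff₀ hs, hγ] at this
    linarith
  have h4 := Finset.sum_le_sum h2
  rw [Finset.sum_sub_distrib, Finset.sum_const, nsmul_eq_mul] at h4
  have h5 : γ * ((γ - 4 * κ) * (#L * #S)) ≤ γ * ∑ m ∈ L, ∑ s ∈ S, localMean (T m) f (m + s) := by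
    refine mul_le_mul_of_nonneg_left ?_ hγ0
    linarith
  have h6 : γ * (κ * (#L * #S)) ≤ 1 * (κ * (#L * #S)) := by gcongr
  rw [e]
  linarith

/-- If the local densities of `F₁` deviate from its density, passing to a suitable translate of some
`T m × T m` preserves the mean of `G` and increases the sum of the squares of the densities. -/
theorem exists_localMean_increment {L S B F₁ F₂ : Finset ℤ} {T : ℤ → Finset ℤ} {G : ℤ → ℤ → ℝ}
    {κ ν ζ γ₁ γ₂ lam : ℝ} (hL : L.Nonempty) (hT : ∀ m ∈ L, (T m).Nonempty) (hS : S.Nonempty)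
    (hLT : ∀ m ∈ L, NearlyInvariant L (T m) κ) (hST : ∀ m ∈ L, NearlyInvariant S (T m) κ)
    (hLS : NearlyInvariant L S κ) (hG : ∀ a b, |G a b| ≤ 2)
    (hγ₁ : ∑ m ∈ L, ind F₁ m = γ₁ * #L) (hγ₂ : ∑ m ∈ L, ind F₂ m = γ₂ * #L)
    (hB : B ⊆ L) (hBcard : ν * #L ≤ #B) (hζ : 0 ≤ ζ) (hlam : 0 ≤ lam)
    (hdev : ∀ m ∈ B, ζ * #S ≤ ∑ s ∈ S, (localMean (T m) (ind F₁) (m + s) - γ₁) ^ 2) :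
    ∃ m ∈ L, ∃ a b : ℤ,
      (∑ x ∈ L, ∑ y ∈ L, G x y) / (#L : ℝ) ^ 2 + lam * (γ₁ ^ 2 + γ₂ ^ 2)
          + lam * (ν * ζ) - 12 * (1 + lam) * κ
        ≤ localMean (T m) (fun x => localMean (T m) (G x) b) a
          + lam * (localMean (T m) (ind F₁) a ^ 2 + localMean (T m) (ind F₂) b ^ 2) := by
  have hl : (0 : ℝ) < #L := by exact_mod_cast hL.card_pos
  have hs : (0 : ℝ) < #S := by exact_mod_cast hS.card_pos
  have hκ : 0 ≤ κ := hLS.nonneg hL.card_pos hS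
  have habs : ∀ F n, |ind F n| ≤ 1 := fun F n => by
    rw [abs_of_nonneg (ind_nonneg F n)]; exact ind_le_one F n
  have hγbd : ∀ F γ, ∑ m ∈ L, ind F m = γ * #L → 0 ≤ γ ∧ γ ≤ 1 := by
    intro F γ h
    constructor
    · refine nonneg_of_mul_nonneg_left (h ▸ Finset.sum_nonneg fun m _ => ind_nonneg F m) hl
    · refine le_of_mul_le_mul_right (h ▸ (Finset.sum_le_sum fun m _ => ind_le_one F m).trans ?_) hl
      simp
  by_contra hcon
  push Not at hcon
  set R := (∑ x ∈ L, ∑ y ∈ L, G x y) / (#L : ℝ) ^ 2 with hR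
  have h1 := sum_localMean_localMean_ge hT hS hLT hST hLS hG
  rw [← hR] at h1
  have h2 := sum_sq_localMean_ge_of_deviation hT hS hST hLS hκ (habs F₁) (hγbd _ _ hγ₁).1
    (hγbd _ _ hγ₁).2 hγ₁ hB hBcard hζ hdev
  have h3 : ∀ m ∈ L, (γ₂ ^ 2 - 4 * κ) * #L ≤ ∑ n ∈ L, localMean (T m) (ind F₂) n ^ 2 :=
    fun m hm => (hLT m hm).sum_sq_localMean_ge (hT m hm) hκ (habs F₂) (hγbd _ _ hγ₂).1
      (hγbd _ _ hγ₂).2 hγ₂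
  have h4 : (#L * #S : ℝ) * ((γ₂ ^ 2 - 4 * κ) * #L)
      ≤ ∑ m ∈ L, ∑ _s ∈ S, ∑ n ∈ L, localMean (T m) (ind F₂) n ^ 2 := by
    refine le_trans (le_of_eq ?_) (Finset.sum_le_sum fun m hm =>
      Finset.sum_le_sum fun s _ => h3 m hm)
    simp only [Finset.sum_const, nsmul_eq_mul]; ring
  have h5 : ∑ m ∈ L, ∑ s ∈ S, ∑ n ∈ L,
      (localMean (T m) (fun x => localMean (T m) (G x) n) (m + s)
        + lam * (localMean (T m) (ind F₁) (m + s) ^ 2 + localMean (T m) (ind F₂) n ^ 2))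
      < ∑ m ∈ L, ∑ s ∈ S, ∑ n ∈ L,
        (R + lam * (γ₁ ^ 2 + γ₂ ^ 2) + lam * (ν * ζ) - 12 * (1 + lam) * κ) :=
    Finset.sum_lt_sum_of_nonempty hL fun m hm => Finset.sum_lt_sum_of_nonempty hS fun s _ =>
      Finset.sum_lt_sum_of_nonempty hL fun n _ => hcon m hm (m + s) n
  simp only [Finset.sum_add_distrib, Finset.sum_const, nsmul_eq_mul, ← Finset.mul_sum] at h5
  have h6 := mul_le_mul_of_nonneg_left h2 hlam
  have h7 := mul_le_mul_of_nonneg_left h4 hlam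
  have h8 := mul_le_mul_of_nonneg_right h6 hl.le
  have e : ∑ m ∈ L, ∑ s ∈ S, (#L : ℝ) * localMean (T m) (ind F₁) (m + s) ^ 2
      = #L * ∑ m ∈ L, ∑ s ∈ S, localMean (T m) (ind F₁) (m + s) ^ 2 := by
    simp only [Finset.mul_sum]
  simp only [Finset.sum_const, nsmul_eq_mul, ← Finset.mul_sum] at h7
  linarith

/-! ### The energy increment for sets that are not uniform -/

/-- A character is nearly constant where its frequency, taken modulo one, is nearly annihilated. -/
theorem norm_negChar_sub_one_le {n : ℤ} {x r : ℝ} (h : ‖n • (x : UnitAddCircle)‖ ≤ r) :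
    ‖negChar n x - 1‖ ≤ 7 * r := by
  have e : n • (x : UnitAddCircle) = ((n * x : ℝ) : UnitAddCircle) := by
    rw [← zsmul_eq_mul]; rfl
  rw [e, UnitAddCircle.norm_eq] at h
  set k := round ((n : ℝ) * x)
  have e2 : negChar n x
      = Complex.exp (Complex.I * ((-(2 * Real.pi * (n * x - k)) : ℝ) : ℂ)) := by
    have e3 : Complex.I * ((-(2 * Real.pi * (n * x - k)) : ℝ) : ℂ)
        = -(2 * (Real.pi : ℂ) * Complex.I * (n : ℂ) * (x : ℂ))
          + (k : ℂ) * (2 * (Real.pi : ℂ) * Complex.I) := by push_cast; ring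
    rw [e3, Complex.exp_add, Complex.exp_int_mul_two_pi_mul_I, mul_one, negChar]
  rw [e2]
  refine Real.norm_exp_I_mul_ofReal_sub_one_le.trans ?_
  rw [norm_neg, norm_mul, Real.norm_eq_abs, Real.norm_eq_abs, abs_of_pos Real.two_pi_pos]
  have hpi : 2 * Real.pi ≤ 7 := by linarith [Real.pi_lt_d2]
  exact mul_le_mul hpi h (abs_nonneg _) (by norm_num)

/-- If the frequencies of `L'` extend those of `L`, then `L'` is contained in the Bohr set with the
frequencies of `L` and the radius and length of `L'`. -/
theorem BohrDatum.carrier_subset_of_extends {L L' : BohrDatum} {r : ℝ} {M : ℕ}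
    (h : ∃ h : L.dim ≤ L'.dim, ∀ j, L'.freq (Fin.castLE h j) = L.freq j)
    (hr : L'.radius ≤ r) (hM : L'.length ≤ M) : L'.carrier ⊆ bohrSet L.freq r M := by
  obtain ⟨hd, hf⟩ := h
  intro n hn
  rw [BohrDatum.carrier, mem_bohrSet] at hn
  rw [mem_bohrSet]
  refine ⟨hn.1.trans (by exact_mod_cast hM), fun j => ?_⟩
  rw [← hf j]
  exact (hn.2 _).trans_le hr

theorem BohrDatum.IsRegular.nearlyInvariant_of_extends {L L' : BohrDatum} (hL : L.IsRegular)
    {κ η : ℝ} (hκ : 0 < κ) (hκ1 : κ < 1) (hη : 0 ≤ η) (hηκ : 100 * L.dim * η < κ)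
    (h : ∃ h : L.dim ≤ L'.dim, ∀ j, L'.freq (Fin.castLE h j) = L.freq j)
    (hr : L'.radius ≤ η * L.radius) (hM : (L'.length : ℝ) ≤ η * L.length) :
    NearlyInvariant L.carrier L'.carrier κ :=
  hL.nearlyInvariant hκ hκ1 hη hηκ hM (BohrDatum.carrier_subset_of_extends h hr le_rfl)

/-- A set that is not locally uniform with respect to `S` can be localized to translates of Bohr
sets with one more frequency so that the energy increases. The new frequency, at which a local
Fourier transform is large, depends on the translate `m + S`; the average over all `m` still does not
decrease the mean of `G`, and one of the sets `L'` obtained is at least as good as the average. -/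
theorem exists_energy_increment {L S : BohrDatum} (hL : L.IsRegular) (hS : S.IsRegular)
    (hLr : L.radius ≤ 1) {F₁ F₂ : Finset ℤ} (hF₁ : F₁ ⊆ L.carrier) (hF₂ : F₂ ⊆ L.carrier)
    {G : ℤ → ℤ → ℝ} (hG : ∀ a b, |G a b| ≤ 2) {lam α η : ℝ} (hα : 0 < α) (hα1 : α ≤ 1)
    (hlam : 0 < lam) (hlam1 : lam ≤ 1) (hη : 0 < η)
    (hηs : 100 * L.dim * η < lam * α ^ 4 / 2 ^ 15) (hlen : 20 ≤ η ^ 2 * L.length)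
    (hdim : S.dim = L.dim)
    (hext : ∃ h : L.dim ≤ S.dim, ∀ j, S.freq (Fin.castLE h j) = L.freq j)
    (hr1 : η * L.radius / 2 ≤ S.radius) (hr2 : S.radius ≤ η * L.radius)
    (hn1 : η * L.length / 2 ≤ S.length) (hn2 : (S.length : ℝ) ≤ η * L.length)
    (hnot : ¬ LocallyUniform L.carrier S.carrier
      (fun m => ind F₁ m - relDensity L.carrier F₁) (α / 4) (α ^ 2 / 4)) :
    ∃ L' : BohrDatum, L'.IsRegular ∧ L'.dim = L.dim + 1 ∧ L'.radius ≤ 1 ∧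
      (η / 2) ^ 2 * L.radius ≤ L'.radius ∧ (η / 2) ^ 2 * L.length ≤ L'.length ∧
      ∃ a b : ℤ, (∑ x ∈ L.carrier, ∑ y ∈ L.carrier, G x y) / (#L.carrier : ℝ) ^ 2
          + lam * (relDensity L.carrier F₁ ^ 2 + relDensity L.carrier F₂ ^ 2) + lam * α ^ 4 / 2 ^ 9
        ≤ localMean L'.carrier (fun x => localMean L'.carrier (G x) b) a
          + lam * (localMean L'.carrier (ind F₁) a ^ 2 + localMean L'.carrier (ind F₂) b ^ 2) := by
  classical
  obtain ⟨κ, hκ⟩ : ∃ κ, κ = lam * α ^ 4 / 2 ^ 15 := ⟨_, rfl⟩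
  have hd := L.one_le_dim
  have hα4 : α ^ 4 ≤ α := by
    calc α ^ 4 ≤ α ^ 1 := pow_le_pow_of_le_one hα.le hα1 (by norm_num)
      _ = α := pow_one α
  have hlα : lam * α ^ 4 ≤ 1 * α := mul_le_mul hlam1 hα4 (by positivity) zero_le_one
  have hκ0 : 0 < κ := by rw [hκ]; positivity
  have hκα : κ ≤ α / 2 ^ 15 := by rw [hκ]; linarith
  have hκ1 : κ < 1 := by linarith
  rw [← hκ] at hηs
  have hηκ : 100 * η < κ := lt_of_le_of_lt (by nlinarith) hηs
  have hη1 : η ≤ 1 := by linarith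
  have hr0 := L.radius_pos
  have hηn : 20 ≤ η * S.length * 2 := by nlinarith
  -- the refinement of `S` by the frequency `x`
  have hrefine : ∀ x : ℝ, ∃ L' : BohrDatum, L'.IsRegular ∧ L'.dim = L.dim + 1 ∧ L'.radius ≤ 1 ∧
      (η / 2) ^ 2 * L.radius ≤ L'.radius ∧ (η / 2) ^ 2 * L.length ≤ L'.length ∧
      NearlyInvariant L.carrier L'.carrier κ ∧ NearlyInvariant S.carrier L'.carrier κ ∧
      ∀ n ∈ L'.carrier, ‖negChar n x - 1‖ ≤ 7 * η := by
    intro x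
    obtain ⟨r, n, hr, hn, hreg, h1, h2, h3, h4⟩ := exists_regular (Nat.succ_pos S.dim)
      (Fin.append S.freq (fun _ : Fin 1 => (x : UnitAddCircle)))
      (ρ := η * S.radius) (X := η * S.length) (mul_pos hη S.radius_pos) (by linarith)
    have hrL : r ≤ η * L.radius := by
      have : η * S.radius ≤ 1 * S.radius := by gcongr; exact S.radius_pos.le
      linarith
    have hnL : (n : ℝ) ≤ η * L.length := by
      have : η * S.length ≤ 1 * S.length := by gcongr
      linarith
    have hextS : ∃ h : S.dim ≤ S.dim + 1, ∀ j, (Fin.append S.freq (fun _ : Fin 1 =>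
        (x : UnitAddCircle))) (Fin.castLE h j) = S.freq j :=
      ⟨Nat.le_succ _, fun j => Fin.append_left S.freq _ j⟩
    have hextL : ∃ h : L.dim ≤ S.dim + 1, ∀ j, (Fin.append S.freq (fun _ : Fin 1 =>
        (x : UnitAddCircle))) (Fin.castLE h j) = L.freq j := by
      obtain ⟨hd1, hf1⟩ := hext
      refine ⟨hd1.trans (Nat.le_succ _), fun j => ?_⟩
      rw [← hf1 j]
      exact Fin.append_left S.freq _ (Fin.castLE hd1 j)
    have hηr : η * L.radius ≤ η := mul_le_of_le_one_right hη.le hLr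
    refine ⟨⟨S.dim + 1, Nat.succ_pos _, _, r, hr, n, hn⟩, hreg, by simp [hdim],
      (hrL.trans hηr).trans hη1, ?_, ?_, ?_, ?_, ?_⟩
    · have := mul_le_mul_of_nonneg_left hr1 hη.le
      simp only
      linarith
    · have := mul_le_mul_of_nonneg_left hn1 hη.le
      simp only
      linarith
    · exact hL.nearlyInvariant_of_extends hκ0 hκ1 hη.le hηs hextL hrL hnL
    · exact hS.nearlyInvariant_of_extends hκ0 hκ1 hη.le (by rw [hdim]; exact hηs) hextS h2 h4
    · intro m hm
      rw [BohrDatum.carrier, mem_bohrSet] at hm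
      have h5 : ‖m • (Fin.append S.freq (fun _ : Fin 1 => (x : UnitAddCircle)))
          (Fin.natAdd S.dim 0)‖ < r := hm.2 _
      rw [Fin.append_right] at h5
      exact norm_negChar_sub_one_le (h5.le.trans (hrL.trans hηr))
  set γ := relDensity L.carrier F₁
  set bad : ℤ → ℝ → Prop := fun m x =>
    α / 4 * #S.carrier ≤ ‖trigPoly S.carrier (fun r => ind F₁ (m + r) - γ) x‖
  have hfreq : ∀ m : ℤ, ∃ x : ℝ, (∃ y, bad m y) → bad m x := by
    intro m
    by_cases h : ∃ y, bad m y
    · exact ⟨h.choose, fun _ => h.choose_spec⟩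
    · exact ⟨0, fun h' => absurd h' h⟩
  choose x hx using hfreq
  choose T hTreg hTdim hTr hTr' hTn hLT hST hchar using hrefine
  have hTne : ∀ y, (T y).carrier.Nonempty := fun y => ⟨0, (T y).zero_mem⟩
  have hl : (0 : ℝ) < #L.carrier := by exact_mod_cast L.card_pos
  have hγ : ∀ F ⊆ L.carrier, ∑ m ∈ L.carrier, ind F m = relDensity L.carrier F * #L.carrier := by
    intro F hF
    rw [sum_ind, relDensity, div_mul_cancel₀ _ hl.ne']
  obtain ⟨m, -, a, b, hab⟩ := exists_localMean_increment (L := L.carrier) (S := S.carrier)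
    (B := {m ∈ L.carrier | ∃ y, bad m y}) (T := fun m => (T (x m)).carrier) (ν := α ^ 2 / 4)
    (ζ := (α / 8) ^ 2)
    ⟨0, L.zero_mem⟩ (fun m _ => hTne _) ⟨0, S.zero_mem⟩ (fun m _ => hLT _) (fun m _ => hST _)
    (hL.nearlyInvariant_of_extends hκ0 hκ1 hη.le hηs hext hr2 hn2) hG (hγ F₁ hF₁) (hγ F₂ hF₂)
    (Finset.filter_subset _ _)
    (by
      refine le_trans (not_le.1 hnot).le (Nat.cast_le.2 (Finset.card_le_card fun m hm => ?_))
      rw [Finset.mem_filter] at hm ⊢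
      obtain ⟨y, hy⟩ := not_forall.1 hm.2
      exact ⟨hm.1, y, (not_le.1 hy).le⟩)
    (by positivity) hlam.le
    (by
      intro m hm
      rw [Finset.mem_filter] at hm
      have h1 := sum_sq_localMean_ge (hTne (x m)) hα.le
        (abs_ind_sub_le (relDensity_nonneg L.carrier F₁) (relDensity_le_one L.carrier F₁))
        (hST (x m)) (hx m hm.2) (hchar (x m)) (by linarith)
      simpa only [localMean_sub_const (hTne (x m))] using h1)
  refine ⟨T (x m), hTreg _, hTdim _, hTr _, hTr' _, hTn _, a, b, le_trans ?_ hab⟩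
  have h1 : lam * κ ≤ 1 * κ := by gcongr
  have h2 : lam * (α ^ 2 / 4 * (α / 8) ^ 2) = lam * α ^ 4 / 2 ^ 8 := by ring
  have h3 : κ = lam * α ^ 4 / 2 ^ 9 / 2 ^ 6 := by rw [hκ]; ring
  have h4 : 0 < lam * α ^ 4 / 2 ^ 9 := by positivity
  rw [h2]
  linarith

/-- The excess of the number of points of `A` in the translated rectangle `F₁ × F₂` over the
proportion `c`, relative to `L × L`, plus `lam` times the energy of the two sides. -/
def potential (A : Finset (ℤ × ℤ)) (y₁ y₂ : ℤ) (c lam : ℝ) (L F₁ F₂ : Finset ℤ) : ℝ :=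
  (∑ u ∈ F₁, ∑ v ∈ F₂, (cellInd A y₁ y₂ u v - c)) / (#L : ℝ) ^ 2
    + lam * (((#F₁ : ℝ) / #L) ^ 2 + ((#F₂ : ℝ) / #L) ^ 2)

theorem card_filter_div_eq_localMean (T F : Finset ℤ) (a : ℤ) :
    (#{n ∈ T | a + n ∈ F} : ℝ) / #T = localMean T (ind F) a := by
  rw [localMean]
  simp only [ind]
  rw [Finset.sum_boole]

theorem potential_translate (A : Finset (ℤ × ℤ)) (y₁ y₂ a b : ℤ) (c lam : ℝ) (T F₁ F₂ : Finset ℤ) :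
    potential A (y₁ + a) (y₂ + b) c lam T {n ∈ T | a + n ∈ F₁} {n ∈ T | b + n ∈ F₂}
      = localMean T (fun x => localMean T
          (fun y => ind F₁ x * ind F₂ y * (cellInd A y₁ y₂ x y - c)) b) a
        + lam * (localMean T (ind F₁) a ^ 2 + localMean T (ind F₂) b ^ 2) := by
  rw [potential, card_filter_div_eq_localMean, card_filter_div_eq_localMean]
  congr 1
  rw [localMean]
  simp only [localMean]
  rw [← Finset.sum_div, div_div, ← pow_two, Finset.sum_filter]
  congr 1
  refine Finset.sum_congr rfl fun u _ => ?_
  rw [Finset.sum_filter]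
  split_ifs with hu
  · refine Finset.sum_congr rfl fun v _ => ?_
    split_ifs with hv
    · simp only [ind, if_pos hu, if_pos hv, cellInd, add_assoc, one_mul]
    · simp [ind, hv]
  · simp [ind, hu]

theorem potential_eq (A : Finset (ℤ × ℤ)) (y₁ y₂ : ℤ) (c lam : ℝ) {L F₁ F₂ : Finset ℤ}
    (hF₁ : F₁ ⊆ L) (hF₂ : F₂ ⊆ L) :
    potential A y₁ y₂ c lam L F₁ F₂
      = (∑ x ∈ L, ∑ y ∈ L, ind F₁ x * ind F₂ y * (cellInd A y₁ y₂ x y - c)) / (#L : ℝ) ^ 2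
        + lam * (relDensity L F₁ ^ 2 + relDensity L F₂ ^ 2) := by
  rw [potential, relDensity_eq_of_subset hF₁, relDensity_eq_of_subset hF₂]
  congr 2
  refine Finset.sum_subset_zero_on_sdiff hF₁ (fun x hx => ?_) fun x hx => ?_
  · refine Finset.sum_eq_zero fun y _ => ?_
    rw [ind, if_neg (Finset.mem_sdiff.1 hx).2]; ring
  · refine Finset.sum_subset_zero_on_sdiff hF₂ (fun y hy => ?_) fun y hy => ?_
    · rw [ind, ind, if_neg (Finset.mem_sdiff.1 hy).2]; ring
    · rw [ind, ind, if_pos hx, if_pos hy]; ring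

theorem localMean_comm (T : Finset ℤ) (G : ℤ → ℤ → ℝ) (a b : ℤ) :
    localMean T (fun x => localMean T (G x) b) a
      = localMean T (fun y => localMean T (fun x => G x y) a) b := by
  simp only [localMean]
  rw [← Finset.sum_div, ← Finset.sum_div, Finset.sum_comm]

/-- If the sides of a rectangle are not uniform, then the potential increases on a suitable
translate of a Bohr set with one more frequency. Failing uniformity, some side is not locally uniform
with respect to the attendant with the same frequencies, by `LocallyUniform.uniformWith`. -/
theorem exists_potential_increment {L : BohrDatum} (hL : L.IsRegular) (hLr : L.radius ≤ 1)
    {F₁ F₂ : Finset ℤ} (hF₁ : F₁ ⊆ L.carrier) (hF₂ : F₂ ⊆ L.carrier) (A : Finset (ℤ × ℤ))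
    (y₁ y₂ : ℤ) {c lam α η : ℝ} (hc0 : 0 ≤ c) (hc : c ≤ 2) (hα : 0 < α) (hα1 : α ≤ 1)
    (hlam : 0 < lam) (hlam1 : lam ≤ 1) (hη : 0 < η)
    (hηs : 100 * L.dim * η < lam * α ^ 4 / 2 ^ 15) (hlen : 20 ≤ η ^ 2 * L.length)
    (hnot : ¬ PairUniform L 0 0 F₁ F₂ α η) :
    ∃ L' : BohrDatum, L'.IsRegular ∧ L'.dim = L.dim + 1 ∧ L'.radius ≤ 1 ∧
      (η / 2) ^ 2 * L.radius ≤ L'.radius ∧ (η / 2) ^ 2 * L.length ≤ L'.length ∧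
      ∃ a b : ℤ, potential A y₁ y₂ c lam L.carrier F₁ F₂ + lam * α ^ 4 / 2 ^ 9
        ≤ potential A (y₁ + a) (y₂ + b) c lam L'.carrier {n ∈ L'.carrier | a + n ∈ F₁}
          {n ∈ L'.carrier | b + n ∈ F₂} := by
  have hd := L.one_le_dim
  have hκα : lam * α ^ 4 / 2 ^ 15 ≤ α / 2 ^ 15 := by
    have hα4 : α ^ 4 ≤ α := by
      calc α ^ 4 ≤ α ^ 1 := pow_le_pow_of_le_one hα.le hα1 (by norm_num)
        _ = α := pow_one α
    have : lam * α ^ 4 ≤ 1 * α := mul_le_mul hlam1 hα4 (by positivity) zero_le_one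
    linarith
  have hκ0 : 0 < lam * α ^ 4 / 2 ^ 15 := by positivity
  have hη1 : η ≤ 1 := by nlinarith
  have hηn : 20 ≤ η * L.length := by
    have : η ^ 2 * L.length ≤ η * L.length := by gcongr; nlinarith
    linarith
  obtain ⟨r, n, hr, hn, hreg, h1, h2, h3, h4⟩ := exists_regular L.dim_pos L.freq
      (ρ := η * L.radius) (X := η * L.length) (mul_pos hη L.radius_pos) (by linarith)
  set S : BohrDatum := ⟨L.dim, L.dim_pos, L.freq, r, hr, n, hn⟩ with hSdef
  have hext : ∃ h : L.dim ≤ S.dim, ∀ j, S.freq (Fin.castLE h j) = L.freq j :=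
    ⟨le_rfl, fun j => rfl⟩
  set G : ℤ → ℤ → ℝ := fun x y => ind F₁ x * ind F₂ y * (cellInd A y₁ y₂ x y - c) with hGdef
  have hG : ∀ x y, |G x y| ≤ 2 := by
    intro x y
    have h5 := cellInd_nonneg A y₁ y₂ x y
    have h6 := cellInd_le_one A y₁ y₂ x y
    have h7 : |cellInd A y₁ y₂ x y - c| ≤ 2 := by rw [abs_le]; constructor <;> linarith
    simp only [hGdef]
    rcases ind_eq F₁ x with h | h <;> rcases ind_eq F₂ y with h' | h' <;> simp [h, h', h7]
  have hcases : ¬ LocallyUniform L.carrier S.carrier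
        (fun m => ind F₁ m - relDensity L.carrier F₁) (α / 4) (α ^ 2 / 4) ∨
      ¬ LocallyUniform L.carrier S.carrier
        (fun m => ind F₂ m - relDensity L.carrier F₂) (α / 4) (α ^ 2 / 4) := by
    by_contra hcon
    push Not at hcon
    refine hnot ⟨S, ⟨hreg, hext, h1, h2, h3, h4⟩, ?_, ?_⟩ <;> rw [shift_zero]
    · exact hcon.1.uniformWith L.card_pos S.card_pos hα hα1 (by linarith)
        (hL.nearlyInvariant_of_extends hκ0 (by linarith) hη.le hηs hext h2 h4)
    · exact hcon.2.uniformWith L.card_pos S.card_pos hα hα1 (by linarith)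
        (hL.nearlyInvariant_of_extends hκ0 (by linarith) hη.le hηs hext h2 h4)
  rcases hcases with h | h
  · obtain ⟨L', hreg', hdim', hr1', hr', hn', a, b, hab⟩ := exists_energy_increment hL hreg hLr hF₁
      hF₂ hG hα hα1 hlam hlam1 hη hηs hlen rfl hext h1 h2 h3 h4 h
    refine ⟨L', hreg', hdim', hr1', hr', hn', a, b, ?_⟩
    rw [potential_translate, potential_eq A y₁ y₂ c lam hF₁ hF₂]
    exact hab
  · obtain ⟨L', hreg', hdim', hr1', hr', hn', b, a, hab⟩ := exists_energy_increment hL hreg hLr hF₂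
      hF₁ (G := fun y x => G x y) (fun a b => hG b a) hα hα1 hlam hlam1 hη hηs hlen rfl hext
      h1 h2 h3 h4 h
    refine ⟨L', hreg', hdim', hr1', hr', hn', a, b, ?_⟩
    rw [potential_translate, potential_eq A y₁ y₂ c lam hF₁ hF₂, localMean_comm]
    rw [Finset.sum_comm] at hab
    simp only [hGdef] at hab
    linarith

/-! ### The first density increment -/

/-- A corner-free subset of the product of two uniform sets has increased density on a rectangle in
a translate of the square of a smaller Bohr set with the same frequencies. -/
theorem exists_increment_bohr {Λ Λ' : BohrDatum} (hΛ : Λ.IsRegular) (hr : Λ.radius ≤ 1)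
    {s₁ s₂ : ℤ} {E₁ E₂ : Finset ℤ} {A : Finset (ℤ × ℤ)} {β₁ β₂ δ α η ε σ b : ℝ}
    (hE₁ : E₁ ⊆ shift s₁ Λ.carrier) (hE₂ : E₂ ⊆ shift s₂ Λ.carrier) (hA : A ⊆ E₁ ×ˢ E₂)
    (hfree : CornerFree A) (hE₁card : (#E₁ : ℝ) = β₁ * #Λ.carrier)
    (hE₂card : (#E₂ : ℝ) = β₂ * #Λ.carrier) (hAcard : (#A : ℝ) = δ * (#E₁ * #E₂))
    (hβ₁ : 0 < β₁) (hβ₂ : 0 < β₂) (hδ : 0 < δ) (hδ1 : δ ≤ 1)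
    (hatt : Λ'.IsAttendant η Λ) (hu₁ : UniformWith (shift s₁ Λ.carrier) Λ'.carrier E₁ α)
    (hu₂ : UniformWith (shift s₂ Λ.carrier) Λ'.carrier E₂ α)
    (hb : b = δ ^ 2 * (β₁ * β₂) / 2 ^ 41) (hα0 : 0 ≤ α) (hαb : α ≤ b ^ 48)
    (hε : 0 < ε) (hεb : 100 * Λ.dim * ε < b ^ 48) (hηε : η ≤ ε ^ 2 / 2)
    (hlen : 10 ≤ ε * Λ.length)
    (hbig : 8 ≤ δ ^ 3 * (β₁ * β₂) ^ 2 * (ε * Λ.length / 2 * (ε * Λ.radius / 6) ^ Λ.dim))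
    (hσ0 : 0 ≤ σ) (hσ : σ ≤ δ ^ 25 / 2 ^ 40) :
    ∃ K : BohrDatum, K.IsRegular ∧ K.dim = Λ.dim ∧ K.radius ≤ 1 ∧ ε / 2 * Λ.radius ≤ K.radius ∧
      ε / 2 * Λ.length ≤ K.length ∧
      ∃ i j : ℤ, ∃ U ⊆ K.carrier, ∃ V ⊆ K.carrier, (∀ u ∈ U, i + u ∈ E₁) ∧ (∀ v ∈ V, j + v ∈ E₂) ∧
        δ ^ 25 * (β₁ * β₂) / 2 ^ 40 * (#K.carrier : ℝ) ^ 2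
          ≤ ∑ u ∈ U, ∑ v ∈ V, (cellInd A i j u v - (δ + σ)) := by
  have hd := Λ.one_le_dim
  have hl : (0 : ℝ) < #Λ.carrier := by exact_mod_cast Λ.card_pos
  have hle1 : ∀ {E : Finset ℤ} {s : ℤ} {γ : ℝ}, E ⊆ shift s Λ.carrier →
      (#E : ℝ) = γ * #Λ.carrier → γ ≤ 1 := by
    intro E s γ hE h
    refine le_of_mul_le_mul_right ?_ hl
    rw [← h, one_mul, ← card_shift s Λ.carrier]
    exact_mod_cast Finset.card_le_card hE
  have hβ₁' := hle1 hE₁ hE₁card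
  have hβ₂' := hle1 hE₂ hE₂card
  have hβ : 0 < β₁ * β₂ := mul_pos hβ₁ hβ₂
  obtain ⟨hb0, hb1, -, -, -⟩ := smallness_bounds hδ hδ1 hβ (mul_le_one₀ hβ₁' hβ₂.le hβ₂') hb rfl
  have hb48 : 0 < b ^ 48 := by positivity
  have hb48' : b ^ 48 < 1 := pow_lt_one₀ hb0.le (hb1.trans_lt (by norm_num)) (by norm_num)
  have hε1 : ε ≤ 1 := by nlinarith
  have hr0 := Λ.radius_pos
  have hn0 : (0 : ℝ) < Λ.length := by exact_mod_cast Λ.length_pos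
  obtain ⟨-, hext, -, hr2, -, hn2⟩ := hatt
  obtain ⟨r, n, hr', hn', hreg, h1, h2, h3, h4⟩ := exists_regular Λ.dim_pos Λ.freq
      (ρ := ε * Λ.radius) (X := ε * Λ.length) (mul_pos hε hr0) hlen
  set K : BohrDatum := ⟨Λ.dim, Λ.dim_pos, Λ.freq, r, hr', n, hn'⟩ with hK
  have hr1 : r ≤ 1 := h2.trans (mul_le_one₀ hε1 hr0.le hr)
  have hηε' : η ≤ ε := by nlinarith
  have hΛ'r : Λ'.radius ≤ ε * r := by
    calc Λ'.radius ≤ ε ^ 2 / 2 * Λ.radius := hr2.trans (by gcongr)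
      _ = ε * (ε * Λ.radius / 2) := by ring
      _ ≤ _ := by gcongr
  have hΛ'n : (Λ'.length : ℝ) ≤ ε * n := by
    calc (Λ'.length : ℝ) ≤ ε ^ 2 / 2 * Λ.length := hn2.trans (by gcongr)
      _ = ε * (ε * Λ.length / 2) := by ring
      _ ≤ _ := by gcongr
  have hΛK : NearlyInvariant Λ.carrier K.carrier (b ^ 48) :=
    hΛ.nearlyInvariant_of_extends hb48 hb48' hε.le hεb ⟨le_rfl, fun j => rfl⟩ h2 h4
  have hΛS : NearlyInvariant Λ.carrier Λ'.carrier (b ^ 48) :=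
    hΛ.nearlyInvariant_of_extends hb48 hb48' hε.le hεb hext (hr2.trans (by gcongr))
      (hn2.trans (by gcongr))
  have hKS : NearlyInvariant K.carrier Λ'.carrier (b ^ 48) :=
    hreg.nearlyInvariant_of_extends hb48 hb48' hε.le hεb hext hΛ'r hΛ'n
  have hYcard := hreg.card_enlarge_lt hb48 hb48' hε.le hεb hΛ'n
  have hKcard := le_card_bohrSet Λ.freq hr' hr1 n
  have hKlarge : 8 ≤ δ ^ 3 * (β₁ * β₂) ^ 2 * (#K.carrier : ℝ) := by
    refine hbig.trans ?_
    refine mul_le_mul_of_nonneg_left (le_trans ?_ hKcard) (by positivity)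
    refine mul_le_mul h3 (pow_le_pow_left₀ (by positivity) ?_ _) (by positivity)
      (Nat.cast_nonneg _)
    linarith
  obtain ⟨i, j, U, hU, V, hV, hUE, hVE, h⟩ := exists_increment_cell (I₁ := shift s₁ Λ.carrier)
    (I₂ := shift s₂ Λ.carrier) (K := K.carrier) (S := Λ'.carrier) (n := #Λ.carrier)
    (β₁ := β₁) (β₂ := β₂) (κ := b ^ 48) (α := α)
    (Y := bohrSet K.freq (K.radius + ε * K.radius) (K.length + Λ'.length))
    hE₁ hE₂ hA hfree (by rw [card_shift]) (by rw [card_shift]) hl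
    (by rw [hAcard, hE₁card, hE₂card]; ring) hβ₁ hβ₁' hβ₂ hβ₂' hδ hδ1
    (fun a ha => K.neg_mem ha) (fun a ha => Λ'.neg_mem ha) ⟨0, Λ'.zero_mem⟩
    (hΛK.translate s₁) (hΛK.translate s₂) (hΛS.translate s₂) hKS
    (by
      intro s hs k hk
      have hs' : s ∈ bohrSet Λ.freq (ε * r) Λ'.length :=
        BohrDatum.carrier_subset_of_extends hext hΛ'r le_rfl hs
      have := add_mem_bohrSet (K.neg_mem hk) hs'
      rwa [neg_add_eq_sub] at this)
    (by
      refine hYcard.le.trans ?_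
      gcongr
      linarith)
    (by
      have := hu₁.locallyUniform
      rwa [relDensity_eq_of_subset hE₁, card_shift, hE₁card, mul_div_cancel_right₀ _ hl.ne']
        at this)
    (by
      have := hu₂.locallyUniform
      rwa [relDensity_eq_of_subset hE₂, card_shift, hE₂card, mul_div_cancel_right₀ _ hl.ne']
        at this)
    hb le_rfl hα0 hαb hKlarge hσ0 hσ
  refine ⟨K, hreg, rfl, hr1, ?_, ?_, i, j, U, hU, V, hV, hUE, hVE, h⟩
  · rw [div_mul_eq_mul_div]; exact h1
  · rw [div_mul_eq_mul_div]; exact h3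

/-- A corner-free subset of the square of an interval has density bounded away from one: each corner of
side one has a vertex outside the set, and every point is a vertex of at most three of them. -/
theorem card_le_of_cornerFree {A : Finset (ℤ × ℤ)} (hfree : CornerFree A) {N : ℕ} (hN : 0 < N)
    {s₁ s₂ : ℤ} (hA : A ⊆ shift s₁ (Finset.Icc (-(N : ℤ)) N) ×ˢ shift s₂ (Finset.Icc (-(N : ℤ)) N)) :
    27 * #A ≤ 23 * (2 * N + 1) ^ 2 := by
  classical
  set J := Finset.Icc (-(N : ℤ)) N
  set B : Finset (ℤ × ℤ) := shift s₁ (Finset.Ico (-(N : ℤ)) N) ×ˢ shift s₂ (Finset.Ico (-(N : ℤ)) N)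
  set M := (shift s₁ J ×ˢ shift s₂ J) \ A
  have hmiss : ∀ p ∈ B, ∃ q ∈ M, p = q ∨ p = (q.1 - 1, q.2) ∨ p = (q.1, q.2 - 1) := by
    rintro ⟨k, m⟩ hp
    simp only [B, Finset.mem_product, mem_shift, Finset.mem_Ico] at hp
    have hmem : ∀ q : ℤ × ℤ, q ∉ A → -(N : ℤ) ≤ q.1 - s₁ → q.1 - s₁ ≤ N → -(N : ℤ) ≤ q.2 - s₂ →
        q.2 - s₂ ≤ N → q ∈ M := by
      intro q hq h1 h2 h3 h4
      simp only [M, J, Finset.mem_sdiff, Finset.mem_product, mem_shift, Finset.mem_Icc]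
      exact ⟨⟨⟨h1, h2⟩, h3, h4⟩, hq⟩
    have := hfree k m 1 one_ne_zero
    by_cases h1 : (k, m) ∈ A
    · by_cases h2 : (k + 1, m) ∈ A
      · have h3 : (k, m + 1) ∉ A := fun h3 => this ⟨h1, h2, h3⟩
        refine ⟨(k, m + 1), hmem _ h3 ?_ ?_ ?_ ?_, Or.inr (Or.inr ?_)⟩ <;> simp <;> omega
      · refine ⟨(k + 1, m), hmem _ h2 ?_ ?_ ?_ ?_, Or.inr (Or.inl ?_)⟩ <;> simp <;> omega
    · refine ⟨(k, m), hmem _ h1 ?_ ?_ ?_ ?_, Or.inl rfl⟩ <;> simp <;> omega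
  have hcover : B ⊆ M.biUnion fun q => {q, (q.1 - 1, q.2), (q.1, q.2 - 1)} := by
    intro p hp
    obtain ⟨q, hq, h⟩ := hmiss p hp
    rw [Finset.mem_biUnion]
    exact ⟨q, hq, by simpa using h⟩
  have h1 : #B ≤ #M * 3 := (Finset.card_le_card hcover).trans
    (Finset.card_biUnion_le_card_mul _ _ _ fun q _ => Finset.card_le_three)
  have hJ : #J = 2 * N + 1 := by simp only [J, Int.card_Icc]; omega
  have hB : #B = (2 * N) ^ 2 := by
    simp only [B, Finset.card_product, card_shift, Int.card_Ico]
    have : ((N : ℤ) - -(N : ℤ)).toNat = 2 * N := by omega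
    rw [this, pow_two]
  have hM : #M + #A = (2 * N + 1) ^ 2 := by
    rw [Finset.card_sdiff_add_card_eq_card hA, Finset.card_product, card_shift, card_shift, hJ,
      pow_two]
  rw [hB] at h1
  nlinarith

/-- The logarithm in the lower bound for the length cannot be small: if the radius is larger than
`1 / 2` then the Bohr set is an interval. -/
theorem one_div_eight_le_log {Λ : BohrDatum} {s₁ s₂ : ℤ} {A : Finset (ℤ × ℤ)} {δβ : ℝ}
    (hA : A ⊆ shift s₁ Λ.carrier ×ˢ shift s₂ Λ.carrier) (hfree : CornerFree A)
    (hcard : (#A : ℝ) = δβ * (#Λ.carrier : ℝ) ^ 2) (hr : Λ.radius ≤ 1) (h0 : 0 < δβ)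
    (h1 : δβ ≤ 1) : 1 / 8 ≤ Real.log (1 / (δβ * Λ.radius)) := by
  have hr0 := Λ.radius_pos
  have key : δβ * Λ.radius ≤ 23 / 27 := by
    by_cases h : Λ.radius ≤ 1 / 2
    · nlinarith
    · have hJ : Λ.carrier = Finset.Icc (-(Λ.length : ℤ)) Λ.length := by
        ext n
        rw [BohrDatum.carrier, mem_bohrSet, Finset.mem_Icc, abs_le]
        refine and_iff_left fun j => lt_of_le_of_lt ?_ (not_le.1 h)
        have := AddCircle.norm_le_half_period (1 : ℝ) (x := n • Λ.freq j) one_ne_zero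
        simpa using this
      have h2 : (27 : ℝ) * #A ≤ 23 * (2 * Λ.length + 1) ^ 2 := by
        rw [hJ] at hA
        exact_mod_cast card_le_of_cornerFree hfree Λ.length_pos hA
      have h3 : (#Λ.carrier : ℝ) = 2 * Λ.length + 1 := by
        rw [hJ, Int.card_Icc]
        have : ((Λ.length : ℤ) + 1 - -(Λ.length : ℤ)).toNat = 2 * Λ.length + 1 := by omega
        rw [this]; push_cast; ring
      rw [hcard, h3] at h2
      have h4 : (0 : ℝ) < (2 * Λ.length + 1) ^ 2 := by positivity
      have h5 : δβ ≤ 23 / 27 := by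
        refine le_of_mul_le_mul_right ?_ h4
        linarith
      nlinarith
  have hpos : 0 < δβ * Λ.radius := mul_pos h0 hr0
  rw [one_div (δβ * Λ.radius), Real.log_inv]
  have := Real.log_le_sub_one_of_pos hpos
  linarith

/-! ### Iterating the energy increment -/

theorem card_div_mem_Icc {L F : Finset ℤ} (hF : F ⊆ L) :
    0 ≤ (#F : ℝ) / #L ∧ (#F : ℝ) / #L ≤ 1 :=
  ⟨by positivity, div_le_one_of_le₀ (by exact_mod_cast Finset.card_le_card hF) (Nat.cast_nonneg _)⟩

/-- The energy part of the potential is at most `2 lam`, so the rest is a positive excess. This keeps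
both the density above `c` and the sides large. -/
theorem le_excess_of_le_potential {A : Finset (ℤ × ℤ)} {y₁ y₂ : ℤ} {c lam x : ℝ}
    {L F₁ F₂ : Finset ℤ} (hF₁ : F₁ ⊆ L) (hF₂ : F₂ ⊆ L) (hlam : 0 ≤ lam)
    (h : x + 2 * lam ≤ potential A y₁ y₂ c lam L F₁ F₂) :
    x ≤ (∑ u ∈ F₁, ∑ v ∈ F₂, (cellInd A y₁ y₂ u v - c)) / (#L : ℝ) ^ 2 := by
  rw [potential] at h
  obtain ⟨h1, h2⟩ := card_div_mem_Icc hF₁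
  obtain ⟨h3, h4⟩ := card_div_mem_Icc hF₂
  have h5 := pow_le_one₀ (n := 2) h1 h2
  have h6 := pow_le_one₀ (n := 2) h3 h4
  nlinarith

/-- The excess bounds the product of the densities of the sides from below. -/
theorem excess_le {A : Finset (ℤ × ℤ)} {y₁ y₂ : ℤ} {c : ℝ} (hc : 0 ≤ c) (L F₁ F₂ : Finset ℤ) :
    (∑ u ∈ F₁, ∑ v ∈ F₂, (cellInd A y₁ y₂ u v - c)) / (#L : ℝ) ^ 2
      ≤ (#F₁ : ℝ) / #L * ((#F₂ : ℝ) / #L) := by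
  rw [div_mul_div_comm, ← pow_two]
  refine div_le_div_of_nonneg_right ?_ (by positivity)
  refine (Finset.sum_le_sum fun u _ => Finset.sum_le_sum (g := fun _ => (1 : ℝ)) fun v _ => ?_).trans
    (by simp)
  linarith [cellInd_le_one A y₁ y₂ u v]

/-- Repeated energy increments lead to a rectangle with uniform sides, whose parameters of
uniformity `a t`, `h t` may depend on the product `t` of the densities of the sides. The number `k`
bounds the remaining number of steps. -/
theorem exists_uniform_of_potential {A : Finset (ℤ × ℤ)} {c lam x₀ αmin ηmin Dmax : ℝ}
    {a h : ℝ → ℝ} (hc0 : 0 ≤ c) (hc : c ≤ 2) (hlam : 0 < lam) (hlam1 : lam ≤ 1) (hα : 0 < αmin)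
    (hη : 0 < ηmin) (hη1 : ηmin ≤ 1)
    (ha : ∀ t, x₀ ≤ t → t ≤ 1 → αmin ≤ a t ∧ a t ≤ 1)
    (hh : ∀ t, x₀ ≤ t → t ≤ 1 → ηmin ≤ h t ∧ 100 * Dmax * h t < lam * a t ^ 4 / 2 ^ 15) (k : ℕ) :
    ∀ (L : BohrDatum) (F₁ F₂ : Finset ℤ) (y₁ y₂ : ℤ), L.IsRegular → L.radius ≤ 1 →
      F₁ ⊆ L.carrier → F₂ ⊆ L.carrier →
      x₀ + 2 * lam ≤ potential A y₁ y₂ c lam L.carrier F₁ F₂ →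
      1 + 2 * lam < potential A y₁ y₂ c lam L.carrier F₁ F₂ + k * (lam * αmin ^ 4 / 2 ^ 9) →
      (L.dim : ℝ) + k ≤ Dmax → 10 ≤ ((ηmin / 2) ^ 2) ^ k * L.length →
      ∃ (L' : BohrDatum) (z₁ z₂ : ℤ) (F₁' F₂' : Finset ℤ), L'.IsRegular ∧ L'.radius ≤ 1 ∧
        F₁' ⊆ L'.carrier ∧ F₂' ⊆ L'.carrier ∧ L.dim ≤ L'.dim ∧ L'.dim ≤ L.dim + k ∧
        ((ηmin / 2) ^ 2) ^ k * L.radius ≤ L'.radius ∧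
        ((ηmin / 2) ^ 2) ^ k * L.length ≤ L'.length ∧
        (∀ u ∈ F₁', z₁ + u ∈ F₁) ∧ (∀ v ∈ F₂', z₂ + v ∈ F₂) ∧
        x₀ + 2 * lam ≤ potential A (y₁ + z₁) (y₂ + z₂) c lam L'.carrier F₁' F₂' ∧
        PairUniform L' 0 0 F₁' F₂' (a ((#F₁' : ℝ) / #L'.carrier * ((#F₂' : ℝ) / #L'.carrier)))
          (h ((#F₁' : ℝ) / #L'.carrier * ((#F₂' : ℝ) / #L'.carrier))) := by
  obtain ⟨q, hq⟩ : ∃ q, q = (ηmin / 2) ^ 2 := ⟨_, rfl⟩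
  have hq0 : 0 < q := by rw [hq]; positivity
  have hq1 : q ≤ 1 := by rw [hq]; nlinarith
  rw [← hq]
  induction k with
  | zero =>
    intro L F₁ F₂ y₁ y₂ _ _ hF₁ hF₂ _ hpot _ _
    exfalso
    rw [Nat.cast_zero, zero_mul, add_zero] at hpot
    have h1 := le_excess_of_le_potential (x := potential A y₁ y₂ c lam L.carrier F₁ F₂ - 2 * lam)
      hF₁ hF₂ hlam.le (by linarith)
    have h2 := h1.trans (excess_le hc0 L.carrier F₁ F₂)
    obtain ⟨h3, h4⟩ := card_div_mem_Icc hF₁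
    obtain ⟨h5, h6⟩ := card_div_mem_Icc hF₂
    have := mul_le_one₀ h4 h5 h6
    linarith
  | succ k ih =>
    intro L F₁ F₂ y₁ y₂ hL hLr hF₁ hF₂ hx hpot hdim hlen
    obtain ⟨h3, h4⟩ := card_div_mem_Icc hF₁
    obtain ⟨h5, h6⟩ := card_div_mem_Icc hF₂
    obtain ⟨t, ht⟩ : ∃ t, t = (#F₁ : ℝ) / #L.carrier * ((#F₂ : ℝ) / #L.carrier) := ⟨_, rfl⟩
    have hxt : x₀ ≤ t := ht ▸ (le_excess_of_le_potential hF₁ hF₂ hlam.le hx).trans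
      (excess_le hc0 L.carrier F₁ F₂)
    have ht1 : t ≤ 1 := ht ▸ mul_le_one₀ h4 h5 h6
    obtain ⟨ha1, ha2⟩ := ha t hxt ht1
    obtain ⟨hh1, hh2⟩ := hh t hxt ht1
    have hqk : q ^ (k + 1) ≤ q := by
      calc q ^ (k + 1) ≤ q ^ 1 := pow_le_pow_of_le_one hq0.le hq1 (by omega)
        _ = q := pow_one q
    have hqk1 : q ^ (k + 1) ≤ 1 := hqk.trans hq1
    push_cast at hdim
    by_cases hunif : PairUniform L 0 0 F₁ F₂ (a t) (h t)
    · refine ⟨L, 0, 0, F₁, F₂, hL, hLr, hF₁, hF₂, le_rfl, by omega, ?_, ?_, by simp, by simp, ?_,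
        ht ▸ hunif⟩
      · exact mul_le_of_le_one_left L.radius_pos.le hqk1
      · exact mul_le_of_le_one_left (Nat.cast_nonneg _) hqk1
      · simpa using hx
    · have hht : 0 < h t := hη.trans_le hh1
      have hat : 0 < a t := hα.trans_le ha1
      have hηsq : 4 * q ≤ h t ^ 2 := by
        rw [hq]
        have := pow_le_pow_left₀ hη.le hh1 2
        linarith
      have hlen1 : 10 ≤ q * L.length := hlen.trans (by gcongr)
      have hlen2 : 20 ≤ h t ^ 2 * L.length := by
        have : 4 * q * L.length ≤ h t ^ 2 * L.length := by gcongr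
        linarith
      have hdimk : (L.dim : ℝ) ≤ Dmax := by linarith [Nat.cast_nonneg (α := ℝ) k]
      have hsmall : 100 * L.dim * h t < lam * a t ^ 4 / 2 ^ 15 :=
        lt_of_le_of_lt (by gcongr) hh2
      obtain ⟨L', hL', hdim', hr', hrad, hlength, z₁, z₂, hinc⟩ := exists_potential_increment hL hLr
        hF₁ hF₂ A y₁ y₂ hc0 hc hat ha2 hlam hlam1 hht hsmall hlen2 hunif
      have hqh : q ≤ (h t / 2) ^ 2 := by rw [div_pow]; linarith
      have hrad' : q * L.radius ≤ L'.radius :=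
        le_trans (mul_le_mul_of_nonneg_right hqh L.radius_pos.le) hrad
      have hlength' : q * L.length ≤ L'.length :=
        le_trans (mul_le_mul_of_nonneg_right hqh (Nat.cast_nonneg _)) hlength
      have hgain : lam * αmin ^ 4 / 2 ^ 9 ≤ lam * a t ^ 4 / 2 ^ 9 := by gcongr
      have hgain0 : 0 < lam * αmin ^ 4 / 2 ^ 9 := by positivity
      push_cast at hpot
      obtain ⟨M, w₁, w₂, F₁', F₂', g1, g2, g3, g4, g5, g6, g7, g8, g9, g10, g11, g12⟩ := ih L'
        _ _ (y₁ + z₁) (y₂ + z₂) hL' hr' (Finset.filter_subset _ _) (Finset.filter_subset _ _)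
        (by linarith) (by linarith) (by rw [hdim']; push_cast; linarith) (by
          refine hlen.trans ?_
          rw [pow_succ, mul_assoc]
          gcongr)
      refine ⟨M, z₁ + w₁, z₂ + w₂, F₁', F₂', g1, g2, g3, g4, by omega, by omega, ?_, ?_, ?_, ?_, ?_,
        g12⟩
      · rw [pow_succ, mul_assoc]
        exact le_trans (by gcongr) g7
      · rw [pow_succ, mul_assoc]
        exact le_trans (by gcongr) g8
      · intro u hu
        have := (Finset.mem_filter.1 (g9 u hu)).2
        rwa [← add_assoc] at this
      · intro v hv
        have := (Finset.mem_filter.1 (g10 v hv)).2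
        rwa [← add_assoc] at this
      · rw [← add_assoc, ← add_assoc]; exact g11

/-! ### Choice of the parameters -/

theorem sum_cellInd_eq_card (A : Finset (ℤ × ℤ)) (y₁ y₂ : ℤ) (F₁ F₂ : Finset ℤ) :
    ∑ u ∈ F₁, ∑ v ∈ F₂, cellInd A y₁ y₂ u v = #(planarShift y₁ y₂ A ∩ F₁ ×ˢ F₂) := by
  rw [← Finset.sum_product']
  simp only [cellInd]
  rw [Finset.sum_boole]
  congr 2
  ext ⟨u, v⟩
  simp only [Finset.mem_filter, Finset.mem_inter, planarShift, Finset.mem_image, Prod.mk.injEq]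
  rw [and_comm]
  refine and_congr_left fun _ => ⟨fun h => ⟨_, h, by simp, by simp⟩, ?_⟩
  rintro ⟨⟨k, m⟩, h, rfl, rfl⟩
  simpa using h

/-- A positive excess means a density larger than `c`. -/
theorem le_relDensity_of_excess_pos {A : Finset (ℤ × ℤ)} {y₁ y₂ : ℤ} {c : ℝ} {L F₁ F₂ : Finset ℤ}
    (h : 0 < (∑ u ∈ F₁, ∑ v ∈ F₂, (cellInd A y₁ y₂ u v - c)) / (#L : ℝ) ^ 2) :
    c ≤ relDensity (F₁ ×ˢ F₂) (planarShift y₁ y₂ A) := by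
  have h1 : 0 < ∑ u ∈ F₁, ∑ v ∈ F₂, (cellInd A y₁ y₂ u v - c) := by
    by_contra hcon
    exact absurd h (not_lt.2 (div_nonpos_of_nonpos_of_nonneg (not_lt.1 hcon) (by positivity)))
  have h2 : F₁.Nonempty := Finset.nonempty_of_sum_ne_zero h1.ne'
  have h3 : F₂.Nonempty := by
    rw [Finset.sum_comm] at h1
    exact Finset.nonempty_of_sum_ne_zero h1.ne'
  simp only [Finset.sum_sub_distrib, Finset.sum_const, nsmul_eq_mul] at h1
  rw [sum_cellInd_eq_card] at h1
  have h4 : (0 : ℝ) < #(F₁ ×ˢ F₂) := by exact_mod_cast (h2.product h3).card_pos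
  rw [relDensity, le_div_iff₀ h4, Finset.card_product]
  push_cast
  linarith

/-- Lower bounds for the length that follow from the logarithmic one. -/
theorem length_bounds {D l ρ N : ℝ} {k d : ℕ} (hD : 2 ^ 10 ≤ D) (hk : 6 * (k : ℝ) + 2 ≤ D)
    (hd : (d : ℝ) ≤ D) (hd1 : 1 ≤ d) (hl : 1 / 8 ≤ l) (hρ : 0 < ρ) (hρl : -Real.log ρ ≤ l)
    (hN : 0 < N) (h : 16 * (D ^ 3 * l) ≤ Real.log N) :
    10 * D ^ (6 * k + 2) ≤ N ∧ D ^ (3 + 3 * d) ≤ N * ρ ^ d := by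
  have hD0 : 0 < D := by linarith
  have hlogD : Real.log D ≤ D := (Real.log_le_sub_one_of_pos hD0).trans (by linarith)
  have hlogD0 : 0 ≤ Real.log D := Real.log_nonneg (by linarith)
  have hD2 : 2 ^ 10 * D ^ 2 ≤ D ^ 3 := by
    calc 2 ^ 10 * D ^ 2 ≤ D * D ^ 2 := by gcongr
      _ = D ^ 3 := by ring
  have hDD : D ≤ D ^ 2 := by nlinarith
  have hD3 : 0 < D ^ 3 := by positivity
  have hl3 : D ^ 3 * (1 / 8) ≤ D ^ 3 * l := by gcongr
  constructor
  · rw [← Real.log_le_log_iff (by positivity) hN, Real.log_mul (by norm_num) (by positivity),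
      Real.log_pow]
    have h10 : Real.log 10 ≤ 10 := (Real.log_le_sub_one_of_pos (by norm_num)).trans (by norm_num)
    have h1 : ((6 * k + 2 : ℕ) : ℝ) * Real.log D ≤ D * D := by
      refine mul_le_mul (by push_cast; exact hk) hlogD hlogD0 hD0.le
    have h2 : D * D = D ^ 2 := by ring
    linarith
  · rw [← Real.log_le_log_iff (by positivity) (by positivity),
      Real.log_mul hN.ne' (by positivity), Real.log_pow, Real.log_pow]
    have h1 : ((3 + 3 * d : ℕ) : ℝ) * Real.log D ≤ (6 * D) * D := by
      refine mul_le_mul ?_ hlogD hlogD0 (by positivity)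
      push_cast
      have : (1 : ℝ) ≤ d := by exact_mod_cast hd1
      linarith
    have h2 : (d : ℝ) * (-Real.log ρ) ≤ D ^ 3 * l := by
      refine mul_le_mul_of_nonneg (hd.trans ?_) hρl (Nat.cast_nonneg _) (by linarith)
      linarith
    linarith

/-- Comparison of the monomials in `2`, `δ⁻¹` and `β⁻¹` by which all parameters are bounded. -/
theorem monomial_le_monomial {w u v : ℝ} (hw : 1 ≤ w) (hu : 1 ≤ u) (hv : 1 ≤ v)
    {a a' b b' c c' : ℕ} (ha : a ≤ a') (hb : b ≤ b') (hc : c ≤ c') :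
    w ^ a * u ^ b * v ^ c ≤ w ^ a' * u ^ b' * v ^ c' := by
  gcongr

/-- Bounds for the parameters of the iteration. The base `w` of the constants is kept as a variable
so that the large powers of two need not be evaluated. -/
theorem parameter_bounds {w δ β x₀ lam αmin α₀ W : ℝ} (hw : w = 2) (hδ : 0 < δ) (hδ1 : δ ≤ 1)
    (hβ : 0 < β) (hβ1 : β ≤ 1) (hx₀ : x₀ = δ ^ 25 * β / w ^ 41) (hlam : lam = δ ^ 25 * β / w ^ 42)
    (hαmin : αmin = (w ^ 2000)⁻¹ * δ ^ 96 * x₀ ^ 48)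
    (hα₀ : α₀ = (w ^ 2000)⁻¹ * δ ^ 96 * β ^ 48)
    (hW : W = w ^ 20000 * δ⁻¹ ^ 6000 * β⁻¹ ^ 200) :
    2 ^ 20 ≤ W ∧ lam⁻¹ ≤ W ∧ (lam * αmin ^ 4 / 2 ^ 9)⁻¹ ≤ W ∧ 2 ^ 225 * (αmin ^ 4)⁻¹ ≤ W ∧
      2 ^ 109 * (α₀ ^ 2)⁻¹ ≤ W ∧ 16 * (δ ^ 3 * β ^ 2)⁻¹ ≤ W := by
  have hw1 : 1 ≤ w := by rw [hw]; norm_num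
  have hu : 1 ≤ δ⁻¹ := (one_le_inv₀ hδ).2 hδ1
  have hv : 1 ≤ β⁻¹ := (one_le_inv₀ hβ).2 hβ1
  have hp : ∀ n : ℕ, (2 : ℝ) ^ n = w ^ n := fun n => by rw [hw]
  have hx₀' : x₀⁻¹ = w ^ 41 * δ⁻¹ ^ 25 * β⁻¹ := by
    rw [hx₀]; simp only [div_eq_mul_inv, mul_inv, inv_inv, inv_pow]; ring
  have hlam' : lam⁻¹ = w ^ 42 * δ⁻¹ ^ 25 * β⁻¹ := by
    rw [hlam]; simp only [div_eq_mul_inv, mul_inv, inv_inv, inv_pow]; ring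
  have hαmin' : αmin⁻¹ = w ^ 3968 * δ⁻¹ ^ 1296 * β⁻¹ ^ 48 := by
    rw [hαmin, mul_inv, mul_inv, inv_inv, ← inv_pow, ← inv_pow, hx₀', mul_pow, mul_pow, ← pow_mul,
      ← pow_mul]
    rw [show w ^ 3968 = w ^ 2000 * w ^ 1968 by rw [← pow_add],
      show δ⁻¹ ^ 1296 = δ⁻¹ ^ 96 * δ⁻¹ ^ 1200 by rw [← pow_add]]
    ring
  have hα₀' : α₀⁻¹ = w ^ 2000 * δ⁻¹ ^ 96 * β⁻¹ ^ 48 := by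
    rw [hα₀, mul_inv, mul_inv, inv_inv, ← inv_pow, ← inv_pow]
  have hα4 : (αmin ^ 4)⁻¹ = w ^ 15872 * δ⁻¹ ^ 5184 * β⁻¹ ^ 192 := by
    rw [← inv_pow, hαmin', mul_pow, mul_pow, ← pow_mul, ← pow_mul, ← pow_mul]
  have hα2 : (α₀ ^ 2)⁻¹ = w ^ 4000 * δ⁻¹ ^ 192 * β⁻¹ ^ 96 := by
    rw [← inv_pow, hα₀', mul_pow, mul_pow, ← pow_mul, ← pow_mul, ← pow_mul]
  have hmono : ∀ {a b c : ℕ}, a ≤ 20000 → b ≤ 6000 → c ≤ 200 →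
      w ^ a * δ⁻¹ ^ b * β⁻¹ ^ c ≤ W := fun ha hb hc => hW ▸ monomial_le_monomial hw1 hu hv ha hb hc
  refine ⟨?_, ?_, ?_, ?_, ?_, ?_⟩
  · have := hmono (a := 20) (b := 0) (c := 0) (by norm_num) (by norm_num) (by norm_num)
    rw [hp]; simpa using this
  · have := hmono (a := 42) (b := 25) (c := 1) (by norm_num) (by norm_num) (by norm_num)
    rw [hlam']; simpa only [pow_one] using this
  · have e : (lam * αmin ^ 4 / 2 ^ 9)⁻¹ = w ^ (9 + 42 + 15872) * δ⁻¹ ^ (25 + 5184)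
        * β⁻¹ ^ (1 + 192) := by
      rw [hp, div_eq_mul_inv, mul_inv, mul_inv, inv_inv, hlam', hα4, pow_add, pow_add, pow_add,
        pow_add, pow_one]
      generalize w ^ 15872 = p1
      generalize δ⁻¹ ^ 5184 = p2
      generalize β⁻¹ ^ 192 = p3
      ring
    rw [e]
    exact hmono (by norm_num) (by norm_num) (by norm_num)
  · have e : 2 ^ 225 * (αmin ^ 4)⁻¹ = w ^ (225 + 15872) * δ⁻¹ ^ 5184 * β⁻¹ ^ 192 := by
      rw [hp, hα4, pow_add, mul_assoc, mul_assoc, mul_assoc]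
    rw [e]
    exact hmono (by norm_num) (by norm_num) (by norm_num)
  · have e : 2 ^ 109 * (α₀ ^ 2)⁻¹ = w ^ (109 + 4000) * δ⁻¹ ^ 192 * β⁻¹ ^ 96 := by
      rw [hp, hα2, pow_add, mul_assoc, mul_assoc, mul_assoc]
    rw [e]
    exact hmono (by norm_num) (by norm_num) (by norm_num)
  · have e : 16 * (δ ^ 3 * β ^ 2)⁻¹ = w ^ 4 * δ⁻¹ ^ 3 * β⁻¹ ^ 2 := by
      rw [mul_inv, ← inv_pow, ← inv_pow, hw]; ring
    rw [e]
    exact hmono (by norm_num) (by norm_num) (by norm_num)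

/-- Bounds for the parameters of uniformity along the iteration, which are functions of the product
`t` of the densities. -/
theorem uniformity_bounds {C D W δ x₀ lam αmin ηmin : ℝ} {a e h : ℝ → ℝ} (hC : 0 < C) (hC1 : C ≤ 1)
    (hδ : 0 < δ) (hδ1 : δ ≤ 1) (hx₀ : 0 < x₀) (hx₀1 : x₀ ≤ 1) (hlam : 0 < lam)
    (ha : ∀ t, a t = C * δ ^ 96 * t ^ 48) (he : ∀ t, e t = a t ^ 2 / 2 ^ 100 / (100 * D))
    (hh : ∀ t, h t = e t ^ 2 / 2 ^ 10) (hαmin : αmin = a x₀) (hηmin : ηmin = h x₀)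
    (hW : 2 ^ 20 ≤ W) (hWD : W ≤ D) (h1 : lam⁻¹ ≤ W) (h2 : 2 ^ 225 * (αmin ^ 4)⁻¹ ≤ W) :
    0 < αmin ∧ 0 < ηmin ∧ ηmin ≤ 1 ∧ D⁻¹ ^ 3 ≤ ηmin / 2 ∧
      (∀ t, x₀ ≤ t → t ≤ 1 → αmin ≤ a t ∧ a t ≤ 1) ∧
      (∀ t, x₀ ≤ t → t ≤ 1 → ηmin ≤ h t ∧ 100 * D * h t < lam * a t ^ 4 / 2 ^ 15) ∧
      ∀ t, x₀ ≤ t → t ≤ 1 → 0 ≤ e t ^ 2 / 2 ^ 100 ∧ e t ^ 2 / 2 ^ 100 ≤ D⁻¹ ^ 2 := by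
  have hD0 : 0 < D := by linarith
  have hbnd : ∀ t, x₀ ≤ t → t ≤ 1 → αmin ≤ a t ∧ a t ≤ 1 := by
    intro t ht ht1
    have ht0 : 0 < t := hx₀.trans_le ht
    rw [hαmin, ha, ha]
    refine ⟨by gcongr, ?_⟩
    exact mul_le_one₀ (mul_le_one₀ hC1 (by positivity) (pow_le_one₀ hδ.le hδ1)) (by positivity)
      (pow_le_one₀ ht0.le ht1)
  have hαmin0 : 0 < αmin := by rw [hαmin, ha]; positivity
  have hh' : ∀ t, h t = a t ^ 4 / (2 ^ 210 * 10 ^ 4 * D ^ 2) := fun t => by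
    rw [hh, he]; field_simp; norm_num
  have hαmin1 : αmin ≤ 1 := (hbnd x₀ le_rfl hx₀1).1.trans (hbnd x₀ le_rfl hx₀1).2
  have hD1 : 1 ≤ D := by linarith
  have hη0 : 0 < ηmin := by
    rw [hηmin, hh', ← hαmin]; positivity
  have hmono : ∀ t, x₀ ≤ t → t ≤ 1 → ηmin ≤ h t := by
    intro t ht ht1
    have := (hbnd t ht ht1).1
    rw [hηmin, hh', hh', ← hαmin]
    gcongr
  refine ⟨hαmin0, hη0, ?_, ?_, hbnd, fun t ht ht1 => ⟨hmono t ht ht1, ?_⟩, fun t ht ht1 => ?_⟩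
  · rw [hηmin, hh', ← hαmin]
    refine div_le_one_of_le₀ ?_ (by positivity)
    have h3 : αmin ^ 4 ≤ 1 := pow_le_one₀ hαmin0.le hαmin1
    have h4 : 1 ≤ D ^ 2 := one_le_pow₀ hD1
    linarith
  · rw [hηmin, hh', ← hαmin]
    have h3 : 2 ^ 225 ≤ D * αmin ^ 4 := by
      have := h2.trans hWD
      rwa [← div_eq_mul_inv, div_le_iff₀ (by positivity)] at this
    rw [inv_pow, div_div, inv_eq_one_div, div_le_div_iff₀ (by positivity) (by positivity)]
    have h5 : 1 * (2 ^ 210 * 10 ^ 4 * D ^ 2 * 2) ≤ 2 ^ 225 * D ^ 2 := by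
      have : 0 < D ^ 2 := by positivity
      linarith
    calc 1 * (2 ^ 210 * 10 ^ 4 * D ^ 2 * 2) ≤ 2 ^ 225 * D ^ 2 := h5
      _ ≤ D * αmin ^ 4 * D ^ 2 := by gcongr
      _ = αmin ^ 4 * D ^ 3 := by ring
  · have hat : 0 < a t := hαmin0.trans_le (hbnd t ht ht1).1
    have h3 : 1 ≤ D * lam := by
      have := h1.trans hWD
      rwa [inv_eq_one_div, div_le_iff₀ hlam] at this
    rw [hh']
    have e1 : 100 * D * (a t ^ 4 / (2 ^ 210 * 10 ^ 4 * D ^ 2))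
        = 100 * a t ^ 4 / (2 ^ 210 * 10 ^ 4 * D) := by field_simp
    rw [e1, div_lt_div_iff₀ (by positivity) (by positivity)]
    have h4 : a t ^ 4 * 1 ≤ a t ^ 4 * (D * lam) := by gcongr
    have h5 : 0 < a t ^ 4 := by positivity
    linarith
  · refine ⟨by positivity, ?_⟩
    have hat : 0 < a t := hαmin0.trans_le (hbnd t ht ht1).1
    have h3 : e t ≤ D⁻¹ := by
      rw [he, inv_eq_one_div, div_div, div_le_div_iff₀ (by positivity) hD0]
      have h4 : a t ^ 2 ≤ 1 := pow_le_one₀ hat.le (hbnd t ht ht1).2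
      have h5 : a t ^ 2 * D ≤ 1 * D := by gcongr
      linarith
    have h0 : 0 ≤ e t := by rw [he]; positivity
    calc e t ^ 2 / 2 ^ 100 ≤ e t ^ 2 / 1 := by gcongr; norm_num
      _ = e t ^ 2 := div_one _
      _ ≤ _ := by gcongr

/-- Bounds for the ratio `ε` of the first localization, and the sizes it needs. -/
theorem initial_bounds {D W δ β α₀ ε ρ N : ℝ} {d k : ℕ} (hd : 1 ≤ d) (hdD : (d : ℝ) ≤ D)
    (hW : 2 ^ 20 ≤ W) (hWD : W ≤ D) (hδ : 0 < δ) (hβ : 0 < β) (hα₀ : 0 < α₀) (hρ : 0 < ρ)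
    (hN : 0 < N) (hε : ε = α₀ ^ 2 / 2 ^ 100 / (100 * d)) (h1 : 2 ^ 109 * (α₀ ^ 2)⁻¹ ≤ W)
    (h2 : 16 * (δ ^ 3 * β ^ 2)⁻¹ ≤ W) (h3 : 10 * D ^ (6 * k + 2) ≤ N)
    (h4 : D ^ (3 + 3 * d) ≤ N * ρ ^ d) :
    D⁻¹ ^ 2 ≤ ε / 2 ∧ 10 ≤ ε * N ∧ 8 ≤ δ ^ 3 * β ^ 2 * (ε * N / 2 * (ε * ρ / 6) ^ d) := by
  have hD0 : 0 < D := by linarith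
  have hD1 : 1 ≤ D := by linarith
  have hd0 : (0 : ℝ) < d := by exact_mod_cast hd
  have hα2 : 2 ^ 109 ≤ D * α₀ ^ 2 := by
    have := h1.trans hWD
    rwa [← div_eq_mul_inv, div_le_iff₀ (by positivity)] at this
  have hδβ : 16 ≤ D * (δ ^ 3 * β ^ 2) := by
    have := h2.trans hWD
    rwa [← div_eq_mul_inv, div_le_iff₀ (by positivity)] at this
  have hε2 : D⁻¹ ^ 2 ≤ ε / 2 := by
    rw [hε, inv_pow, div_div, div_div, inv_eq_one_div,
      div_le_div_iff₀ (by positivity) (by positivity)]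
    have h5 : 2 ^ 109 * (d : ℝ) ≤ D * α₀ ^ 2 * D := mul_le_mul hα2 hdD hd0.le (by positivity)
    linarith
  have hε0 : 0 < ε := by
    have : 0 < D⁻¹ ^ 2 := by positivity
    linarith
  refine ⟨hε2, ?_, ?_⟩
  · have h5 : D ^ 2 ≤ D ^ (6 * k + 2) := pow_le_pow_right₀ hD1 (by omega)
    have h6 : D⁻¹ ^ 2 * (10 * D ^ 2) ≤ ε * N := by
      refine mul_le_mul (by linarith) (by linarith) (by positivity) hε0.le
    calc (10 : ℝ) = D⁻¹ ^ 2 * (10 * D ^ 2) := by field_simp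
      _ ≤ ε * N := h6
  · have h5 : D⁻¹ ^ 3 * ρ ≤ ε * ρ / 6 := by
      have h6 : D⁻¹ ^ 3 ≤ ε / 6 := by
        have h7 : D⁻¹ ≤ 1 / 3 := by
          rw [inv_eq_one_div]
          exact one_div_le_one_div_of_le (by norm_num) (by linarith)
        calc D⁻¹ ^ 3 = D⁻¹ ^ 2 * D⁻¹ := by ring
          _ ≤ ε / 2 * (1 / 3) := by gcongr
          _ = ε / 6 := by ring
      calc D⁻¹ ^ 3 * ρ ≤ ε / 6 * ρ := by gcongr
        _ = _ := by ring
    have h6 : 16 * D⁻¹ ≤ δ ^ 3 * β ^ 2 := by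
      rw [← div_eq_mul_inv, div_le_iff₀ hD0]; linarith
    have h7 : 16 * D⁻¹ * (D⁻¹ ^ 2 * N * (D⁻¹ ^ 3 * ρ) ^ d)
        ≤ δ ^ 3 * β ^ 2 * (ε * N / 2 * (ε * ρ / 6) ^ d) := by
      have h8 : D⁻¹ ^ 2 * N ≤ ε * N / 2 := by
        calc D⁻¹ ^ 2 * N ≤ ε / 2 * N := by gcongr
          _ = _ := by ring
      gcongr
    have e : 16 * D⁻¹ * (D⁻¹ ^ 2 * N * (D⁻¹ ^ 3 * ρ) ^ d)
        = 16 * (D⁻¹ ^ (3 + 3 * d) * (N * ρ ^ d)) := by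
      rw [mul_pow, ← pow_mul, pow_add]; ring
    rw [e] at h7
    have h9 : 1 ≤ D⁻¹ ^ (3 + 3 * d) * (N * ρ ^ d) := by
      calc (1 : ℝ) = D⁻¹ ^ (3 + 3 * d) * D ^ (3 + 3 * d) := by
            rw [← mul_pow, inv_mul_cancel₀ hD0.ne', one_pow]
        _ ≤ _ := by gcongr
    linarith

end

set_option maxHeartbeats 1600000 in
theorem proposition6p1
    (Λ : BohrDatum) (hΛ : Λ.IsRegular) (hε₀ : Λ.radius ≤ 1)
    (s₁ s₂ : ℤ) (E₁ E₂ : Finset ℤ)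
    (hE₁ : E₁ ⊆ shift s₁ Λ.carrier) (hE₂ : E₂ ⊆ shift s₂ Λ.carrier)
    (A : Finset (ℤ × ℤ)) (hAE : A ⊆ E₁ ×ˢ E₂) (hA : A.Nonempty) (hcorner : CornerFree A)
    (β₁ β₂ β δ α₀ ε D' : ℝ)
    (hβ₁ : (E₁.card : ℝ) = β₁ * (Λ.carrier.card : ℝ))
    (hβ₂ : (E₂.card : ℝ) = β₂ * (Λ.carrier.card : ℝ))
    (hβ : β = β₁ * β₂)
    (hδ : relDensity (E₁ ×ˢ E₂) A = δ)
    (hα₀ : α₀ = (2 : ℝ) ^ (-2000 : ℤ) * δ ^ 96 * β₁ ^ 48 * β₂ ^ 48)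
    (hε : ε = (2 : ℝ) ^ (-100 : ℤ) * α₀ ^ 2 / (100 * (Λ.dim : ℝ)))
    (hD' : D' = (2 : ℝ) ^ 250000 * δ ^ (-20000 : ℤ) * β ^ (-200 : ℤ) + (Λ.dim : ℝ))
    (hunif : PairUniform Λ s₁ s₂ E₁ E₂ α₀ ((2 : ℝ) ^ (-10 : ℤ) * ε ^ 2))
    (hN : (2 : ℝ) ^ 1000000 * D' ^ 3 * Real.log (1 / (δ * β * Λ.radius))
      ≤ Real.log (Λ.length : ℝ)) :
    ∃ (L : BohrDatum) (y₁ y₂ : ℤ) (F₁ F₂ : Finset ℤ) (β₁' β₂' β' α₀' ε' : ℝ),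
      L.IsRegular ∧ L.radius ≤ 1 ∧
      F₁ ⊆ shift (-y₁) E₁ ∩ L.carrier ∧ F₂ ⊆ shift (-y₂) E₂ ∩ L.carrier ∧
      (F₁.card : ℝ) = β₁' * (L.carrier.card : ℝ) ∧
      (F₂.card : ℝ) = β₂' * (L.carrier.card : ℝ) ∧
      β' = β₁' * β₂' ∧
      α₀' = (2 : ℝ) ^ (-2000 : ℤ) * δ ^ 96 * β' ^ 48 ∧
      ε' = (2 : ℝ) ^ (-100 : ℤ) * α₀' ^ 2 / (100 * D') ∧
      (2 : ℝ) ^ (-1500 : ℤ) * δ ^ 100 * β ≤ β' ∧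
      PairUniform L 0 0 F₁ F₂ α₀' ((2 : ℝ) ^ (-10 : ℤ) * ε' ^ 2) ∧
      (L.dim : ℝ) ≤ D' ∧
      ((2 : ℝ) ^ (-100 : ℤ) * ε' ^ 2) ^ L.dim * Λ.radius ≤ L.radius ∧
      ((2 : ℝ) ^ (-100 : ℤ) * ε' ^ 2) ^ L.dim * (Λ.length : ℝ) ≤ (L.length : ℝ) ∧
      δ + (2 : ℝ) ^ (-600 : ℤ) * δ ^ 37 ≤ relDensity (F₁ ×ˢ F₂) (planarShift y₁ y₂ A) := by
  have hl : (0 : ℝ) < #Λ.carrier := by exact_mod_cast Λ.card_pos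
  have hd := Λ.one_le_dim
  have hρ := Λ.radius_pos
  have hN0 : (0 : ℝ) < Λ.length := by exact_mod_cast Λ.length_pos
  -- the densities are positive and at most one
  obtain ⟨p, hp⟩ := hA
  obtain ⟨hp₁, hp₂⟩ := Finset.mem_product.1 (hAE hp)
  have hE₁0 : (0 : ℝ) < #E₁ := by exact_mod_cast Finset.card_pos.2 ⟨_, hp₁⟩
  have hE₂0 : (0 : ℝ) < #E₂ := by exact_mod_cast Finset.card_pos.2 ⟨_, hp₂⟩
  have hA0 : (0 : ℝ) < #A := by exact_mod_cast Finset.card_pos.2 ⟨_, hp⟩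
  have hβ₁0 : 0 < β₁ := pos_of_mul_pos_left (hβ₁ ▸ hE₁0) hl.le
  have hβ₂0 : 0 < β₂ := pos_of_mul_pos_left (hβ₂ ▸ hE₂0) hl.le
  have hle1 : ∀ {E : Finset ℤ} {s : ℤ} {γ : ℝ}, E ⊆ shift s Λ.carrier →
      (#E : ℝ) = γ * #Λ.carrier → γ ≤ 1 := by
    intro E s γ hE h
    refine le_of_mul_le_mul_right ?_ hl
    rw [← h, one_mul, ← card_shift s Λ.carrier]
    exact_mod_cast Finset.card_le_card hE
  have hβ₁1 := hle1 hE₁ hβ₁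
  have hβ₂1 := hle1 hE₂ hβ₂
  have hβ0 : 0 < β := hβ ▸ mul_pos hβ₁0 hβ₂0
  have hβ1 : β ≤ 1 := hβ ▸ mul_le_one₀ hβ₁1 hβ₂0.le hβ₂1
  have hAcard : (#A : ℝ) = δ * (#E₁ * #E₂) := by
    rw [← hδ, relDensity, Finset.inter_eq_left.2 hAE, Finset.card_product]
    push_cast
    field_simp
  have hδ0 : 0 < δ := pos_of_mul_pos_left (hAcard ▸ hA0) (by positivity)
  have hδ1 : δ ≤ 1 := by
    refine le_of_mul_le_mul_right ?_ (mul_pos hE₁0 hE₂0)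
    rw [← hAcard, one_mul, ← Nat.cast_mul, ← Finset.card_product]
    exact_mod_cast Finset.card_le_card hAE
  have hδβ0 : 0 < δ * β := mul_pos hδ0 hβ0
  have hδβ1 : δ * β ≤ 1 := mul_le_one₀ hδ1 hβ0.le hβ1
  -- the logarithm in the bound for the length
  obtain ⟨l, hldef⟩ : ∃ l, l = Real.log (1 / (δ * β * Λ.radius)) := ⟨_, rfl⟩
  have hl8 : 1 / 8 ≤ l := by
    rw [hldef]
    refine one_div_eight_le_log (hAE.trans (Finset.product_subset_product hE₁ hE₂)) hcorner ?_ hε₀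
      hδβ0 hδβ1
    rw [hAcard, hβ₁, hβ₂, hβ]; ring
  have hρl : -Real.log Λ.radius ≤ l := by
    rw [hldef, one_div, Real.log_inv, Real.log_mul hδβ0.ne' hρ.ne']
    linarith [Real.log_nonpos hδβ0.le hδβ1]
  -- the parameters
  obtain ⟨w, hw⟩ : ∃ w : ℝ, w = 2 := ⟨_, rfl⟩
  have hw1 : 1 ≤ w := by rw [hw]; norm_num
  have z2000 : (2 : ℝ) ^ (-2000 : ℤ) = (w ^ 2000)⁻¹ := by rw [hw, zpow_neg]; rfl
  have z600 : (2 : ℝ) ^ (-600 : ℤ) = (w ^ 600)⁻¹ := by rw [hw, zpow_neg]; rfl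
  have z1500 : (2 : ℝ) ^ (-1500 : ℤ) = (w ^ 1500)⁻¹ := by rw [hw, zpow_neg]; rfl
  have z100 : (2 : ℝ) ^ (-100 : ℤ) = (2 ^ 100)⁻¹ := by rw [zpow_neg]; rfl
  have z10 : (2 : ℝ) ^ (-10 : ℤ) = (2 ^ 10)⁻¹ := by rw [zpow_neg]; rfl
  obtain ⟨C, hC⟩ : ∃ C : ℝ, C = (2 : ℝ) ^ (-2000 : ℤ) := ⟨_, rfl⟩
  have hC0 : 0 < C := by rw [hC, z2000]; positivity
  have hC1 : C ≤ 1 := by rw [hC, z2000]; exact inv_le_one_of_one_le₀ (one_le_pow₀ hw1)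
  obtain ⟨x₀, hx₀⟩ : ∃ x₀, x₀ = δ ^ 25 * β / w ^ 41 := ⟨_, rfl⟩
  obtain ⟨lam, hlam⟩ : ∃ lam, lam = δ ^ 25 * β / w ^ 42 := ⟨_, rfl⟩
  have hxlam : x₀ = 2 * lam := by rw [hx₀, hlam, hw]; ring
  have hδ25 : δ ^ 25 * β ≤ 1 := mul_le_one₀ (pow_le_one₀ hδ0.le hδ1) hβ0.le hβ1
  have hlam0 : 0 < lam := by rw [hlam]; positivity
  have hx₀0 : 0 < x₀ := by linarith
  have hx₀1 : x₀ ≤ 1 := by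
    rw [hx₀]; exact div_le_one_of_le₀ (hδ25.trans (one_le_pow₀ hw1)) (by positivity)
  set a : ℝ → ℝ := fun t => (2 : ℝ) ^ (-2000 : ℤ) * δ ^ 96 * t ^ 48 with hadef
  set e : ℝ → ℝ := fun t => (2 : ℝ) ^ (-100 : ℤ) * a t ^ 2 / (100 * D') with hedef
  set h : ℝ → ℝ := fun t => (2 : ℝ) ^ (-10 : ℤ) * e t ^ 2 with hhdef
  have ha' : ∀ t, a t = C * δ ^ 96 * t ^ 48 := fun t => by rw [hC]
  have he' : ∀ t, e t = a t ^ 2 / 2 ^ 100 / (100 * D') := fun t => by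
    simp only [hedef]; rw [z100, div_eq_inv_mul (a t ^ 2)]
  have hh' : ∀ t, h t = e t ^ 2 / 2 ^ 10 := fun t => by
    simp only [hhdef]; rw [z10, div_eq_inv_mul]
  have hα₀' : α₀ = (w ^ 2000)⁻¹ * δ ^ 96 * β ^ 48 := by
    rw [hα₀, z2000, hβ, mul_pow, mul_assoc _ (β₁ ^ 48)]
  obtain ⟨W, hW⟩ : ∃ W, W = w ^ 20000 * δ⁻¹ ^ 6000 * β⁻¹ ^ 200 := ⟨_, rfl⟩
  obtain ⟨αmin, hαmin⟩ : ∃ αmin, αmin = a x₀ := ⟨_, rfl⟩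
  obtain ⟨ηmin, hηmin⟩ : ∃ ηmin, ηmin = h x₀ := ⟨_, rfl⟩
  have hαmin' : αmin = (w ^ 2000)⁻¹ * δ ^ 96 * x₀ ^ 48 := by rw [hαmin, ha', hC, z2000]
  obtain ⟨hW1, hW2, hW3, hW4, hW5, hW6⟩ := parameter_bounds hw hδ0 hδ1 hβ0 hβ1 hx₀ hlam
    hαmin' hα₀' hW
  have hWD : 2 ^ 20 * W + Λ.dim ≤ D' := by
    rw [hD', add_le_add_iff_right, zpow_neg, zpow_neg, ← inv_zpow, ← inv_zpow, zpow_ofNat,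
      zpow_ofNat, hW, ← hw, ← mul_assoc, ← mul_assoc, ← pow_add]
    exact monomial_le_monomial hw1 ((one_le_inv₀ hδ0).2 hδ1) ((one_le_inv₀ hβ0).2 hβ1)
      (by norm_num) (by norm_num) le_rfl
  have hWD' : W ≤ D' := by linarith
  have hdD : (Λ.dim : ℝ) ≤ D' := by linarith
  have hD0 : 0 < D' := by linarith
  have hD1 : 1 ≤ D' := by linarith
  obtain ⟨hαmin0, hηmin0, hηmin1, hηminD, ha1, hh1, he1⟩ := uniformity_bounds hC0 hC1 hδ0 hδ1 hx₀0
    hx₀1 hlam0 ha' he' hh' hαmin hηmin hW1 hWD' hW2 hW4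
  obtain ⟨k, hk⟩ : ∃ k, k = ⌈2 / (lam * αmin ^ 4 / 2 ^ 9)⌉₊ := ⟨_, rfl⟩
  have hgain : 0 < lam * αmin ^ 4 / 2 ^ 9 := by positivity
  have hkW : (k : ℝ) ≤ 2 * W + 1 := by
    rw [hk]
    refine (Nat.ceil_lt_add_one (by positivity)).le.trans ?_
    rw [div_eq_mul_inv]
    linarith
  have hkg : 2 ≤ k * (lam * αmin ^ 4 / 2 ^ 9) := by
    rw [← div_le_iff₀ hgain, hk]; exact Nat.le_ceil _
  obtain ⟨hlen1, hlen2⟩ := length_bounds (k := k) (by linarith) (by linarith) hdD Λ.dim_pos hl8 hρ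
    hρl hN0 (by
      refine le_trans ?_ hN
      rw [← hldef, mul_assoc]
      refine mul_le_mul_of_nonneg_right ?_ (by positivity)
      calc (16 : ℝ) = 2 ^ 4 := by norm_num
        _ ≤ 2 ^ 1000000 := pow_le_pow_right₀ one_le_two (by norm_num))
  clear hN hD' hldef
  have hα₀0 : 0 < α₀ := by rw [hα₀']; positivity
  have hε' : ε = α₀ ^ 2 / 2 ^ 100 / (100 * Λ.dim) := by rw [hε, z100, div_eq_inv_mul (α₀ ^ 2)]
  obtain ⟨hεD, hεN, hεbig⟩ := initial_bounds Λ.dim_pos hdD hW1 hWD' hδ0 hβ0 hα₀0 hρ hN0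
    hε' hW5 hW6 hlen1 hlen2
  have hε0 : 0 < ε := by
    have : 0 < D'⁻¹ ^ 2 := by positivity
    linarith
  -- the first increment; its gain exceeds the target by `x₀ + 2 lam`, which pays for the energy
  obtain ⟨b, hb⟩ : ∃ b, b = δ ^ 2 * (β₁ * β₂) / 2 ^ 41 := ⟨_, rfl⟩
  have hαb : α₀ ≤ b ^ 48 := by
    have e1 : b ^ 48 = (w ^ 1968)⁻¹ * δ ^ 96 * β ^ 48 := by
      rw [hb, ← hβ, hw, div_pow, mul_pow, ← pow_mul, ← pow_mul, div_eq_inv_mul, mul_assoc]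
    rw [e1, hα₀']
    gcongr
    norm_num
  have hb48 : b ^ 48 ≤ 1 := by
    rw [hb, ← hβ]
    refine pow_le_one₀ (by positivity) (div_le_one_of_le₀ ?_ (by positivity))
    have := mul_le_one₀ (pow_le_one₀ (n := 2) hδ0.le hδ1) hβ0.le hβ1
    linarith
  have hεb : 100 * Λ.dim * ε < b ^ 48 := by
    have e1 : 100 * Λ.dim * ε = α₀ ^ 2 / 2 ^ 100 := by
      rw [hε, z100]; field_simp
    rw [e1]
    have : α₀ ^ 2 ≤ α₀ := by
      calc α₀ ^ 2 = α₀ * α₀ := pow_two _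
        _ ≤ α₀ * 1 := mul_le_mul_of_nonneg_left (hαb.trans hb48) hα₀0.le
        _ = α₀ := mul_one _
    linarith
  obtain ⟨σ, hσ⟩ : ∃ σ, σ = (2 : ℝ) ^ (-600 : ℤ) * δ ^ 37 := ⟨_, rfl⟩
  have hσ0 : 0 ≤ σ := by rw [hσ]; positivity
  have hσ1 : σ ≤ δ ^ 25 / 2 ^ 40 := by
    rw [hσ, z600, div_eq_inv_mul, ← hw]
    have : δ ^ 37 ≤ δ ^ 25 := pow_le_pow_of_le_one hδ0.le hδ1 (by norm_num)
    gcongr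
    norm_num
  obtain ⟨Λ', hatt, hu₁, hu₂⟩ := hunif
  obtain ⟨K, hK, hKdim, hKr, hKr', hKn, i, j, U, hU, V, hV, hUE, hVE, hinc⟩ := exists_increment_bohr
    hΛ hε₀ hE₁ hE₂ hAE hcorner hβ₁ hβ₂ hAcard hβ₁0 hβ₂0 hδ0 hδ1 hatt hu₁ hu₂ hb hα₀0.le hαb hε0 hεb
    (by
      rw [z10]
      have : 0 ≤ ε ^ 2 := by positivity
      linarith) hεN (by rw [← hβ]; exact hεbig) hσ0 hσ1
  -- zero frequencies are added: they increase the exponents in the bounds for radius and length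
  have hpot : x₀ + 2 * lam ≤ potential A i j (δ + σ) lam (K.pad (3 * k + 1)).carrier U V := by
    have hk0 : (0 : ℝ) < #K.carrier := by exact_mod_cast K.card_pos
    have h1 : x₀ + 2 * lam = δ ^ 25 * (β₁ * β₂) / 2 ^ 40 := by
      rw [← hxlam, hx₀, hw, ← hβ]; ring
    rw [potential, K.pad_carrier, h1]
    have h2 := (le_div_iff₀ (by positivity)).2 hinc
    have h3 : 0 ≤ lam * (((#U : ℝ) / #K.carrier) ^ 2 + ((#V : ℝ) / #K.carrier) ^ 2) := by positivity
    linarith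
  have hqD : (D'⁻¹) ^ 6 ≤ (ηmin / 2) ^ 2 := by
    calc (D'⁻¹) ^ 6 = (D'⁻¹ ^ 3) ^ 2 := by ring
      _ ≤ _ := by gcongr
  have hDk : D'⁻¹ ^ (6 * k + 2) ≤ ((ηmin / 2) ^ 2) ^ k * (ε / 2) := by
    rw [pow_add, pow_mul]
    gcongr
  have hlenk : 10 ≤ ((ηmin / 2) ^ 2) ^ k * (K.pad (3 * k + 1)).length := by
    calc (10 : ℝ) = D'⁻¹ ^ (6 * k + 2) * (10 * D' ^ (6 * k + 2)) := by
          rw [mul_left_comm, ← mul_pow, inv_mul_cancel₀ hD0.ne', one_pow, mul_one]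
      _ ≤ ((ηmin / 2) ^ 2) ^ k * (ε / 2) * Λ.length := by gcongr
      _ = ((ηmin / 2) ^ 2) ^ k * (ε / 2 * Λ.length) := by ring
      _ ≤ _ := mul_le_mul_of_nonneg_left hKn (by positivity)
  have hpaddim : (((K.pad (3 * k + 1)).dim : ℕ) : ℝ) = Λ.dim + (3 * k + 1) := by
    rw [← hKdim]; simp only [BohrDatum.pad]; push_cast; ring
  have hdimk : (((K.pad (3 * k + 1)).dim : ℕ) : ℝ) + k ≤ D' := by rw [hpaddim]; linarith
  obtain ⟨L, z₁, z₂, F₁, F₂, hL, hLr, hF₁, hF₂, hdim1, hdim2, hrad, hlength, hz₁, hz₂, hLpot, hLu⟩ :=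
    exists_uniform_of_potential (A := A) (c := δ + σ) (by linarith)
      (by
        have : δ ^ 25 ≤ 1 := pow_le_one₀ hδ0.le hδ1
        linarith) hlam0 (by linarith) hαmin0 hηmin0 hηmin1
      ha1 hh1 k (K.pad (3 * k + 1)) U V i j (hK.pad _) hKr (by rw [K.pad_carrier]; exact hU)
      (by rw [K.pad_carrier]; exact hV) hpot (by linarith) hdimk hlenk
  obtain ⟨t, ht⟩ : ∃ t, t = (#F₁ : ℝ) / #L.carrier * ((#F₂ : ℝ) / #L.carrier) := ⟨_, rfl⟩
  have hL0 : (#L.carrier : ℝ) ≠ 0 := by exact_mod_cast L.card_pos.ne'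
  have hexc := le_excess_of_le_potential hF₁ hF₂ hlam0.le hLpot
  have hxt : x₀ ≤ t := ht ▸ hexc.trans (excess_le (by linarith) L.carrier F₁ F₂)
  have ht1 : t ≤ 1 := ht ▸ mul_le_one₀ (card_div_mem_Icc hF₁).2 (card_div_mem_Icc hF₂).1
    (card_div_mem_Icc hF₂).2
  obtain ⟨hy0, hyD⟩ := he1 t hxt ht1
  have hfin : ((2 : ℝ) ^ (-100 : ℤ) * e t ^ 2) ^ L.dim ≤ ((ηmin / 2) ^ 2) ^ k * (ε / 2) := by
    rw [z100, ← div_eq_inv_mul]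
    have hdimL : 3 * k + 1 ≤ L.dim := le_trans (by simp [BohrDatum.pad]) hdim1
    have hDi : D'⁻¹ ≤ 1 := inv_le_one_of_one_le₀ hD1
    have hDi0 : 0 < D'⁻¹ := by positivity
    calc (e t ^ 2 / 2 ^ 100) ^ L.dim ≤ (D'⁻¹ ^ 2) ^ L.dim := pow_le_pow_left₀ hy0 hyD _
      _ ≤ (D'⁻¹ ^ 2) ^ (3 * k + 1) :=
        pow_le_pow_of_le_one (by positivity) (pow_le_one₀ hDi0.le hDi) hdimL
      _ = D'⁻¹ ^ (6 * k + 2) := by rw [← pow_mul]; congr 1; ring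
      _ ≤ _ := hDk
  refine ⟨L, i + z₁, j + z₂, F₁, F₂, (#F₁ : ℝ) / #L.carrier, (#F₂ : ℝ) / #L.carrier, t, a t, e t,
    hL, hLr, ?_, ?_, (div_mul_cancel₀ _ hL0).symm, (div_mul_cancel₀ _ hL0).symm, ht, rfl, rfl, ?_,
    ht ▸ hLu, ?_, ?_, ?_, ?_⟩
  · refine fun u hu => Finset.mem_inter.2 ⟨?_, hF₁ hu⟩
    rw [mem_shift, show u - -(i + z₁) = i + (z₁ + u) by ring]
    exact hUE _ (hz₁ u hu)
  · refine fun v hv => Finset.mem_inter.2 ⟨?_, hF₂ hv⟩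
    rw [mem_shift, show v - -(j + z₂) = j + (z₂ + v) by ring]
    exact hVE _ (hz₂ v hv)
  · refine le_trans ?_ hxt
    rw [hx₀, z1500, div_eq_inv_mul, mul_assoc]
    have : δ ^ 100 ≤ δ ^ 25 := pow_le_pow_of_le_one hδ0.le hδ1 (by norm_num)
    gcongr
    norm_num
  · refine le_trans ?_ hdimk
    exact_mod_cast hdim2
  · calc ((2 : ℝ) ^ (-100 : ℤ) * e t ^ 2) ^ L.dim * Λ.radius
        ≤ ((ηmin / 2) ^ 2) ^ k * (ε / 2) * Λ.radius := by gcongr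
      _ = ((ηmin / 2) ^ 2) ^ k * (ε / 2 * Λ.radius) := by ring
      _ ≤ ((ηmin / 2) ^ 2) ^ k * K.radius := mul_le_mul_of_nonneg_left hKr' (by positivity)
      _ ≤ L.radius := hrad
  · calc ((2 : ℝ) ^ (-100 : ℤ) * e t ^ 2) ^ L.dim * Λ.length
        ≤ ((ηmin / 2) ^ 2) ^ k * (ε / 2) * Λ.length := by gcongr
      _ = ((ηmin / 2) ^ 2) ^ k * (ε / 2 * Λ.length) := by ring
      _ ≤ ((ηmin / 2) ^ 2) ^ k * K.length := mul_le_mul_of_nonneg_left hKn (by positivity)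
      _ ≤ L.length := hlength
  · rw [← hσ]
    exact le_relDensity_of_excess_pos (hx₀0.trans_le hexc)
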